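/- **Setting.** Let $B$ be a unital $C^*$-algebra. A $B$-valued probability space $(A,\mathbb E)$ is a unital complex algebra $A$ with a unital homomorphism $b\mapsto b1_A$ from $B$ to $A$ (which makes $A$ a $B$-$B$-bimodule) and a linear map $\mathbb E:A\to B$ with $\mathbb E[b_1ab_2]=b_1\mathbb E[a]b_2$ and $\mathbb E[b1_A]=b$. Let $\mathbb E_n=\mathbb E\otimes I_n:A\otimes M_n(\mathbb C)\to B\otimes M_n(\mathbb C)$ be the entrywise application of $\mathbb E$; then $(A\otimes M_n(\mathbb C),\mathbb E_n)$ is a $B\otimes M_n(\mathbb C)$-valued probability space. For an index set $I$ let $K(I)$ be the set of all words $(i_1,\dots,i_m)$, $m\ge 0$, in $I$ with $i_k\ne i_{k+1}$, including the empty word $\emptyset$. A family $J=(J_i)_{i\in I}$ of subsets of $K(I)$ is $I$-compatible if for every $i\in I$ and every word $(i_1,\dots,i_m)\in K(I)$, $m\ge0$, that does not start with $i$, one has $(i_1,\dots,i_m)\in J_i$ if and only if $(i,i_1,\dots,i_m)\in J_i$. A Hilbert $B$-$B$-bimodule with a specified vector is a pair $(M,\xi)$ of a $B$-$B$-bimodule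 $M$, complete for a $B$-valued inner product (linear for the right action, with $B$ acting on the left by a $*$-representation), and $\xi\in M$ with $\langle\xi,b\xi\rangle=b$ for $b\in B$. Let $M^\circ=(B\xi)^\perp$ and let $L(M)$ be the algebra of adjointable operators. The reduced free product of $(M_i,\xi_i)_{i\in I}$ is $M=B\xi\oplus\bigoplus_{(i_1,\dots,i_m)\in K(I),\,m\ge1}M_{i_1}^\circ\otimes_B\cdots\otimes_BM_{i_m}^\circ$. For $J'\subseteq K(I)$ let $P_{J'}$ be the orthogonal projection onto the sum of the summands with index in $J'$ ($B\xi$ for $\emptyset$). Let $M(i)$ be the sum of the summands whose word does not start with $i$, let $V_i:M_i\otimes_BM(i)\to M$ be the unitary with $\xi_i\otimes m\mapsto m$ and $m_i\otimes m\mapsto m_i\otimes m$ for $m_i\in M_i^\circ$, $m\in M(i)$ (where $m_i\otimes\xi$ is identified with $m_i$), and put $\lambda_i(a)=V_i(a\otimes1)V_i^{-1}$ for $a\in L(M_i)$. Let $J$ be $I$-compatible. A family $(A_i)_{i\in I}$ of (not necessarily unital) $B$-$B$-bimodule subalgebras of $A$ is $B$-valued $J$-independent in $(A,\mathbb E)$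 if there are Hilbert $B$-$B$-bimodules with specified vectors $(M_i,\xi_i)$ and $B$-$B$-bilinear algebra homomorphisms $\gamma_i:A_i\to L(M_i)$ such that, on the reduced free product $(M,\xi)$, $$\mathbb E[a_1\cdots a_m]=\big\langle\xi,\;P_{J_{i_1}}\lambda_{i_1}(\gamma_{i_1}(a_1))\cdots P_{J_{i_m}}\lambda_{i_m}(\gamma_{i_m}(a_m))\,\xi\big\rangle$$ for all $m\geq 0$, $i_1,\dots,i_m\in I$ and $a_k\in A_{i_k}$. **Proposition.** (a) Let $J$ be an $I$-compatible family and let $(A_i)_{i\in I}$ be $B$-valued $J$-independent in $(A,\mathbb E)$. Then for every $n\in\mathbb N$ the family $(A_i\otimes M_n(\mathbb C))_{i\in I}$ is $B\otimes M_n(\mathbb C)$-valued $J$-independent in $(A\otimes M_n(\mathbb C),\mathbb E_n)$. (b) The following families are $I$-compatible: $J_i=K(I)$ for all $i$; $J_i=\{\emptyset,(i)\}$ for all $i$; and, for $I=\{1,2\}$, $J_1=\{\emptyset,(1)\}$, $J_2=\{\emptyset,(1),(2),(2,1)\}$. Suppose that $A$ is a unital $C^*$-algebra, $b\mapsto b1_A$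 is a $*$-homomorphism and $\mathbb E[aa^*]\ge0$ for all $a\in A$. Then for $B$-$B$-bimodule subalgebras $(A_i)_{i\in I}$ of $A$, $J$-independence for these families is equivalent, respectively, to - free independence, if all $A_i$ contain $1_A$: $\mathbb E[a_1\cdots a_m]=0$ whenever $m\ge1$, $a_k\in A_{i_k}$, $i_1\ne i_2\ne\cdots\ne i_m$ and $\mathbb E[a_k]=0$ for all $k$; - Boolean independence: $\mathbb E[a_1\cdots a_m]=\mathbb E[a_1]\cdots\mathbb E[a_m]$ whenever $a_k\in A_{i_k}$ and $i_1\ne i_2\ne\cdots\ne i_m$; - monotone independence (for $I=\{1,2\}$ with $1<2$): $\mathbb E[a_1\cdots a_k\cdots a_m]=\mathbb E[a_1\cdots a_{k-1}\mathbb E[a_k]a_{k+1}\cdots a_m]$ whenever $a_j\in A_{i_j}$, $i_k>i_{k-1}$ (if $k>1$) and $i_k>i_{k+1}$ (if $k<m$). -/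

import Mathlib

open MulOpposite UniformSpace
open scoped TensorProduct DirectSum

universe u v v' w k uA

noncomputable section

namespace JIndep

section

/-! ### Hilbert bimodules over a C⋆-algebra -/

/-- A complex vector space with commuting left and right actions of `B` and a positive
semidefinite `B`-valued inner product, conjugate linear in the first variable,
for which the left action is by a `⋆`-representation. -/
structure PreHilbertBimodule (B : Type u) [CStarAlgebra B] [PartialOrder B] [StarOrderedRing B] where
  carrier : Type v
  [addCommGroup : AddCommGroup carrier]
  [module : Module ℂ carrier]
  /-- the left action `b ↦ (x ↦ b x)` -/
  left : B →ₐ[ℂ] Module.End ℂ carrier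
  /-- the right action `b ↦ (x ↦ x b)` -/
  right : Bᵐᵒᵖ →ₐ[ℂ] Module.End ℂ carrier
  left_right_comm : ∀ b c x, left b (right c x) = right c (left b x)
  /-- the inner product -/
  form : carrier → carrier → B
  form_add_right : ∀ x y z, form x (y + z) = form x y + form x z
  form_mul_right : ∀ x y b, form x (right (op b) y) = form x y * b
  star_form : ∀ x y, star (form x y) = form y x
  form_self_nonneg : ∀ x, 0 ≤ form x x
  form_left : ∀ b x y, form (left b x) y = form x (left (star b) y)

attribute [instance] PreHilbertBimodule.addCommGroup PreHilbertBimodule.module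

section Matrix

variable {B : Type u} [CStarAlgebra B] [PartialOrder B] [StarOrderedRing B]

theorem exists_negPart {D : Type*} [CStarAlgebra D] [PartialOrder D] [StarOrderedRing D]
    {T : D} (hT : IsSelfAdjoint T) :
    ∃ N : D, star N = N ∧ N * T * N = -(N * N * N) ∧ (∃ R, N * N * N = star R * R) ∧
      (N = 0 → ∃ S, T = star S * S) := by
  have hN0 : 0 ≤ T⁻ := CFC.negPart_nonneg T
  have hNs : star T⁻ = T⁻ := IsSelfAdjoint.of_nonneg hN0
  have h1 : T⁺ - T⁻ = T := CFC.posPart_sub_negPart T hT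
  refine ⟨T⁻, hNs, ?_, ?_, fun h => ?_⟩
  · calc T⁻ * T * T⁻ = T⁻ * (T⁺ - T⁻) * T⁻ := by rw [h1]
      _ = (T⁻ * T⁺ - T⁻ * T⁻) * T⁻ := by rw [mul_sub]
      _ = _ := by rw [CFC.negPart_mul_posPart T]; noncomm_ring
  · refine CStarAlgebra.nonneg_iff_eq_star_mul_self.mp ?_
    have := star_left_conjugate_nonneg hN0 T⁻
    rwa [hNs] at this
  · refine CStarAlgebra.nonneg_iff_eq_star_mul_self.mp ?_
    rw [← h1, h, sub_zero]
    exact CFC.posPart_nonneg T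

/-- A hermitian matrix over `B` that is positive on all columns is of the form `S⋆ S`. -/
theorem exists_eq_star_mul_self {n : Type*} [Fintype n] [DecidableEq n] (G : n → n → B)
    (hG : ∀ i j, star (G i j) = G j i)
    (hpos : ∀ b : n → B, 0 ≤ ∑ i, ∑ j, star (b i) * G i j * b j) :
    ∃ S : n → n → B, ∀ i j, G i j = ∑ p, star (S p i) * S p j := by
  let T : CStarMatrix n n B := CStarMatrix.ofMatrix (Matrix.of G)
  have hT : IsSelfAdjoint T := by
    ext i j
    rw [CStarMatrix.star_apply]
    exact hG j i
  obtain ⟨N, hNs, hTN, ⟨R, hR⟩, hfin⟩ := exists_negPart hT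
  have hR0 : R = 0 := by
    ext a p
    have h1 : 0 ≤ (N * T * N) p p := by
      have := hpos (fun i => N i p)
      convert this using 1
      rw [CStarMatrix.mul_apply, Finset.sum_comm]
      refine Finset.sum_congr rfl fun j _ => ?_
      rw [CStarMatrix.mul_apply, Finset.sum_mul]
      refine Finset.sum_congr rfl fun i _ => ?_
      have : star (N i p) = N p i := by
        conv_rhs => rw [← hNs, CStarMatrix.star_apply]
      rw [this]
      rfl
    have h2 : (N * N * N) p p = ∑ a, star (R a p) * R a p := by
      rw [hR, CStarMatrix.mul_apply]
      simp [CStarMatrix.star_apply]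
    have h3 : ∑ a, star (R a p) * R a p ≤ 0 := by
      rw [← h2]
      rw [hTN] at h1
      simpa using h1
    have h4 : ∑ a, star (R a p) * R a p = 0 :=
      le_antisymm h3 (Finset.sum_nonneg fun a _ => star_mul_self_nonneg _)
    have h5 := (Finset.sum_eq_zero_iff_of_nonneg
      (fun a _ => star_mul_self_nonneg (R a p))).mp h4 a (Finset.mem_univ _)
    simpa using h5
  have hN30 : N * N * N = 0 := by rw [hR, hR0]; simp
  have hNN : N * N = 0 := by
    have : star (N * N) * (N * N) = 0 := by
      rw [star_mul, hNs]
      rw [← mul_assoc, hN30, zero_mul]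
    exact CStarRing.star_mul_self_eq_zero_iff (N * N) |>.mp this
  have hNz : N = 0 := by
    have : star N * N = 0 := by rw [hNs, hNN]
    exact CStarRing.star_mul_self_eq_zero_iff N |>.mp this
  obtain ⟨S, hS⟩ := hfin hNz
  refine ⟨fun i j => S i j, fun i j => ?_⟩
  have : T i j = (star S * S) i j := by rw [← hS]
  rw [CStarMatrix.mul_apply] at this
  simp only [CStarMatrix.star_apply] at this
  exact this

end Matrix

namespace PreHilbertBimodule

variable {B : Type u} [CStarAlgebra B] [PartialOrder B] [StarOrderedRing B]
variable (P : PreHilbertBimodule.{u, v} B)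

theorem form_add_left (x y z : P.carrier) : P.form (x + y) z = P.form x z + P.form y z := by
  rw [← P.star_form, P.form_add_right, star_add, P.star_form, P.star_form]

theorem form_mul_left (x y : P.carrier) (b : B) :
    P.form (P.right (op b) x) y = star b * P.form x y := by
  rw [← P.star_form, P.form_mul_right, star_mul, P.star_form]

theorem form_smul_right (x y : P.carrier) (c : ℂ) : P.form x (c • y) = c • P.form x y := by
  have h : c • y = P.right (op (c • 1)) y := by
    rw [op_smul, map_smul, op_one, map_one]; rfl
  rw [h, P.form_mul_right, mul_smul_comm, mul_one]

theorem form_smul_left (x y : P.carrier) (c : ℂ) : P.form (c • x) y = star c • P.form x y := by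
  rw [← P.star_form, P.form_smul_right, star_smul, P.star_form]

/-- The inner product as a biadditive map. -/
def formHom : P.carrier →+ P.carrier →+ B :=
  AddMonoidHom.mk' (fun x => AddMonoidHom.mk' (P.form x) (P.form_add_right x))
    (fun x y => by ext z; exact P.form_add_left x y z)

@[simp] theorem formHom_apply (x y : P.carrier) : P.formHom x y = P.form x y := rfl

theorem form_zero_right (x : P.carrier) : P.form x 0 = 0 := map_zero (P.formHom x)

theorem form_zero_left (x : P.carrier) : P.form 0 x = 0 := by
  rw [← formHom_apply, map_zero]; rfl

theorem form_neg_right (x y : P.carrier) : P.form x (-y) = -P.form x y := map_neg (P.formHom x) y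

theorem form_sub_right (x y z : P.carrier) : P.form x (y - z) = P.form x y - P.form x z :=
  map_sub (P.formHom x) y z

theorem form_sub_left (x y z : P.carrier) : P.form (x - y) z = P.form x z - P.form y z := by
  rw [← P.star_form, form_sub_right, star_sub, P.star_form, P.star_form]

theorem form_sum_right {κ : Type*} (s : Finset κ) (x : P.carrier) (y : κ → P.carrier) :
    P.form x (∑ i ∈ s, y i) = ∑ i ∈ s, P.form x (y i) := map_sum (P.formHom x) y s

theorem form_sum_left {κ : Type*} (s : Finset κ) (x : κ → P.carrier) (y : P.carrier) :
    P.form (∑ i ∈ s, x i) y = ∑ i ∈ s, P.form (x i) y := by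
  rw [← formHom_apply, map_sum, AddMonoidHom.finsetSum_apply]; rfl

/-- Cauchy–Schwarz inequality. -/
theorem norm_form_sq_le (x y : P.carrier) :
    ‖P.form x y‖ ^ 2 ≤ ‖P.form x x‖ * ‖P.form y y‖ := by
  set c := P.form x y with hc
  have key : ∀ t : ℝ, (2 * t - t ^ 2 * ‖P.form x x‖) • (star c * c) ≤ P.form y y := by
    intro t
    have h0 := P.form_self_nonneg (P.right (op ((t : ℂ) • c)) x - y)
    have h1 : P.form (P.right (op ((t : ℂ) • c)) x - y) (P.right (op ((t : ℂ) • c)) x - y)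
        = t ^ 2 • (star c * P.form x x * c) - (2 * t) • (star c * c) + P.form y y := by
      have hs : P.form y x = star c := by rw [hc, P.star_form]
      simp only [form_sub_left, form_sub_right, P.form_mul_right, form_mul_left, ← hc, hs,
        Complex.coe_smul, star_smul, star_trivial, smul_mul_assoc, mul_smul_comm,
        mul_assoc, sub_mul]
      module
    have h2 : star c * P.form x x * c ≤ ‖P.form x x‖ • (star c * c) :=
      CStarAlgebra.star_left_conjugate_le_norm_smul (P.star_form x x)
    rw [h1] at h0
    have h3 : t ^ 2 • (star c * P.form x x * c) ≤ t ^ 2 • (‖P.form x x‖ • (star c * c)) :=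
      smul_le_smul_of_nonneg_left h2 (sq_nonneg t)
    rw [← sub_nonneg]
    have h4 := add_nonneg h0 (sub_nonneg.mpr h3)
    convert h4 using 1
    module
  have hcc : ‖star c * c‖ = ‖c‖ ^ 2 := by rw [CStarRing.norm_star_mul_self, sq]
  have knorm : ∀ t : ℝ, 0 ≤ 2 * t - t ^ 2 * ‖P.form x x‖ →
      (2 * t - t ^ 2 * ‖P.form x x‖) * ‖c‖ ^ 2 ≤ ‖P.form y y‖ := by
    intro t ht
    have := CStarAlgebra.norm_le_norm_of_nonneg_of_le
      (smul_nonneg ht (star_mul_self_nonneg c)) (key t)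
    rwa [norm_smul, hcc, Real.norm_of_nonneg ht] at this
  rcases (norm_nonneg (P.form x x)).eq_or_lt' with h | h
  · rw [h, zero_mul]
    by_contra hcon
    push Not at hcon
    have := knorm ((‖P.form y y‖ + 1) / (2 * ‖c‖ ^ 2)) (by rw [h, mul_zero, sub_zero]; positivity)
    rw [h, mul_zero, sub_zero] at this
    have hne : ‖c‖ ≠ 0 := fun h0 => by simp [h0] at hcon
    field_simp at this
    linarith
  · have := knorm (1 / ‖P.form x x‖) (by field_simp; norm_num)
    field_simp at this
    linarith

instance instNorm : Norm P.carrier := ⟨fun x => √‖P.form x x‖⟩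

theorem norm_def (x : P.carrier) : ‖x‖ = √‖P.form x x‖ := rfl

theorem norm_sq (x : P.carrier) : ‖x‖ ^ 2 = ‖P.form x x‖ := Real.sq_sqrt (norm_nonneg _)

theorem norm_form_le (x y : P.carrier) : ‖P.form x y‖ ≤ ‖x‖ * ‖y‖ := by
  rw [norm_def, norm_def, ← Real.sqrt_mul (norm_nonneg _)]
  exact Real.le_sqrt_of_sq_le (P.norm_form_sq_le x y)

theorem seminormedCore : SeminormedSpace.Core ℂ P.carrier where
  norm_nonneg x := Real.sqrt_nonneg _
  norm_smul c x := by
    rw [norm_def, norm_def, form_smul_left, form_smul_right, norm_smul, norm_smul, norm_star,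
      ← mul_assoc, Real.sqrt_mul (by positivity), Real.sqrt_mul_self (norm_nonneg _)]
  norm_triangle x y := by
    have hx : 0 ≤ ‖x‖ := Real.sqrt_nonneg _
    have hy : 0 ≤ ‖y‖ := Real.sqrt_nonneg _
    refine le_of_sq_le_sq ?_ (by positivity)
    rw [norm_sq, form_add_left, P.form_add_right, P.form_add_right]
    have h1 := P.norm_form_le x y
    have h2 := P.norm_form_le y x
    have h3 := P.norm_sq x
    have h4 := P.norm_sq y
    have h5 := norm_add_le (P.form x x + P.form x y) (P.form y x + P.form y y)
    have h6 := norm_add_le (P.form x x) (P.form x y)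
    have h7 := norm_add_le (P.form y x) (P.form y y)
    nlinarith

/-- The seminorm `‖x‖ = ‖⟨x, x⟩‖ ^ (1 / 2)`. -/
instance instSeminormedAddCommGroup : SeminormedAddCommGroup P.carrier :=
  SeminormedAddCommGroup.ofCore P.seminormedCore

instance instNormedSpace : NormedSpace ℂ P.carrier where
  norm_smul_le c x := (P.seminormedCore.norm_smul c x).le

theorem norm_left_le (b : B) (x : P.carrier) : ‖P.left b x‖ ≤ ‖b‖ * ‖x‖ := by
  refine le_of_sq_le_sq ?_ (by positivity)
  rw [mul_pow, norm_sq, norm_sq, P.form_left, ← Module.End.mul_apply, ← map_mul]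
  have h : 0 ≤ algebraMap ℝ B (‖b‖ ^ 2) - star b * b :=
    sub_nonneg.mpr CStarAlgebra.star_mul_le_algebraMap_norm_sq
  obtain ⟨d, hd⟩ := CStarAlgebra.nonneg_iff_eq_star_mul_self.mp h
  have h1 : P.form x (P.left (star b * b) x) ≤ (‖b‖ ^ 2) • P.form x x := by
    have h2 := P.form_self_nonneg (P.left d x)
    rw [P.form_left, ← Module.End.mul_apply, ← map_mul, ← hd, map_sub, LinearMap.sub_apply,
      form_sub_right, sub_nonneg] at h2
    refine h2.trans (le_of_eq ?_)
    have : algebraMap ℝ B (‖b‖ ^ 2) = ((‖b‖ ^ 2 : ℝ) : ℂ) • (1 : B) := by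
      rw [Algebra.algebraMap_eq_smul_one, Complex.coe_smul]
    rw [this, map_smul, map_one, LinearMap.smul_apply, Module.End.one_apply, form_smul_right,
      Complex.coe_smul]
  have h0 : 0 ≤ P.form x (P.left (star b * b) x) := by
    rw [map_mul, Module.End.mul_apply, ← P.form_left]
    exact P.form_self_nonneg _
  calc _ ≤ ‖(‖b‖ ^ 2) • P.form x x‖ := CStarAlgebra.norm_le_norm_of_nonneg_of_le h0 h1
    _ = _ := by rw [norm_smul, Real.norm_of_nonneg (by positivity)]

theorem norm_right_le (b : Bᵐᵒᵖ) (x : P.carrier) : ‖P.right b x‖ ≤ ‖b‖ * ‖x‖ := by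
  refine le_of_sq_le_sq ?_ (by positivity)
  obtain ⟨b, rfl⟩ := op_surjective b
  rw [mul_pow, norm_sq, norm_sq, P.form_mul_right, form_mul_left, norm_op]
  calc _ ≤ ‖star b‖ * ‖P.form x x‖ * ‖b‖ :=
        (norm_mul_le _ _).trans (by gcongr; exact norm_mul_le _ _)
    _ = _ := by rw [norm_star]; ring

end PreHilbertBimodule

/-- A Hilbert `B`-`B`-bimodule: a `B`-`B`-bimodule with a `B`-valued inner product that is
definite and complete for the norm `‖x‖ = ‖⟨x, x⟩‖ ^ (1 / 2)`. -/
structure HilbertBimodule (B : Type u) [CStarAlgebra B] [PartialOrder B] [StarOrderedRing B]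
    extends PreHilbertBimodule.{u, v} B where
  eq_zero_of_form_self : ∀ x : carrier, form x x = 0 → x = 0
  completeSpace : @CompleteSpace carrier
    (toPreHilbertBimodule.instSeminormedAddCommGroup.toPseudoMetricSpace.toUniformSpace)

end

section

variable {B : Type u} [CStarAlgebra B] [PartialOrder B] [StarOrderedRing B]

section completionRep

variable {V : Type*} [SeminormedAddCommGroup V] [NormedSpace ℂ V]
  {R : Type*} [Ring R] [Algebra ℂ R] (ρ : R →ₐ[ℂ] Module.End ℂ V)
  (h : ∀ r, ∃ C : ℝ, ∀ x, ‖ρ r x‖ ≤ C * ‖x‖)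

/-- The operators of a representation by bounded operators, extended to the completion. -/
def completionOp (r : R) : Completion V →L[ℂ] Completion V :=
  ((ρ r).mkContinuous (h r).choose (h r).choose_spec).completion

theorem completionOp_coe (r : R) (x : V) : completionOp ρ h r (x : Completion V) = (ρ r x : V) :=
  ContinuousLinearMap.completion_apply_coe _ x

theorem clm_ext {f g : Completion V →L[ℂ] Completion V}
    (hfg : ∀ x : V, f (x : Completion V) = g (x : Completion V)) : f = g :=
  DFunLike.coe_injective (Completion.ext f.continuous g.continuous hfg)

/-- A representation by bounded operators extends to the completion. -/
def completionRep : R →ₐ[ℂ] Module.End ℂ (Completion V) :=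
  AlgHom.ofLinearMap
    { toFun := fun r => (completionOp ρ h r : Completion V →ₗ[ℂ] Completion V)
      map_add' := fun r s => by
        rw [← ContinuousLinearMap.toLinearMap_add]
        refine congrArg _ (clm_ext fun x => ?_)
        rw [_root_.add_apply]
        simp only [completionOp_coe, map_add, LinearMap.add_apply, Completion.coe_add]
      map_smul' := fun c r => by
        rw [RingHom.id_apply, ← ContinuousLinearMap.toLinearMap_smul]
        refine congrArg _ (clm_ext fun x => ?_)
        rw [_root_.smul_apply]
        simp only [completionOp_coe, map_smul, LinearMap.smul_apply, Completion.coe_smul] }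
    (by
      refine congrArg (ContinuousLinearMap.toLinearMap) (clm_ext (g := 1) fun x => ?_)
      simp only [completionOp_coe, map_one, Module.End.one_apply, one_apply_eq_self])
    (fun r s => by
      refine congrArg (ContinuousLinearMap.toLinearMap)
        (clm_ext (g := completionOp ρ h r * completionOp ρ h s) fun x => ?_)
      simp only [completionOp_coe, map_mul, Module.End.mul_apply, mul_apply_eq_comp])

theorem completionRep_coe (r : R) (x : V) :
    completionRep ρ h r (x : Completion V) = (ρ r x : V) :=
  completionOp_coe ρ h r x

theorem continuous_completionRep (r : R) : Continuous (completionRep ρ h r) :=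
  (completionOp ρ h r).continuous

end completionRep

namespace HilbertBimodule

variable (H : HilbertBimodule.{u, v} B)

instance instCompleteSpace : CompleteSpace H.carrier := H.completeSpace

instance instT0Space : T0Space H.carrier := by
  let _ : NormedAddCommGroup H.carrier := NormedAddCommGroup.ofSeparation fun x hx => by
    refine H.eq_zero_of_form_self x ?_
    rw [← norm_eq_zero, ← H.norm_sq, hx]; simp
  infer_instance

end HilbertBimodule

namespace PreHilbertBimodule

variable (P : PreHilbertBimodule.{u, v} B)

theorem continuous_form : Continuous fun p : P.carrier × P.carrier => P.form p.1 p.2 := by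
  let f : P.carrier →L⋆[ℂ] P.carrier →L[ℂ] B :=
    LinearMap.mkContinuous₂ (LinearMap.mk₂'ₛₗ (starRingEnd ℂ) (RingHom.id ℂ) P.form
      P.form_add_left (fun c x y => P.form_smul_left x y c) P.form_add_right
      (fun c x y => P.form_smul_right x y c)) 1
      (fun x y => by rw [one_mul]; exact P.norm_form_le x y)
  exact (f.continuous.comp continuous_fst).clm_apply continuous_snd

/-- The continuous extension of the inner product to the completion. -/
def completionForm : Completion P.carrier → Completion P.carrier → B :=
  Function.curry <| ((Completion.isDenseInducing_toCompl P.carrier).prodMap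
    (Completion.isDenseInducing_toCompl P.carrier)).extend fun p => P.formHom p.1 p.2

theorem completionForm_coe (x y : P.carrier) :
    P.completionForm (x : Completion P.carrier) (y : Completion P.carrier) = P.form x y :=
  ((Completion.isDenseInducing_toCompl P.carrier).prodMap
    (Completion.isDenseInducing_toCompl P.carrier)).extend_eq P.continuous_form (x, y)

theorem continuous_completionForm :
    Continuous fun p : Completion P.carrier × Completion P.carrier =>
      P.completionForm p.1 p.2 :=
  (Completion.isDenseInducing_toCompl P.carrier).extend_Z_bilin (Completion.isDenseInducing_toCompl P.carrier)
    (φ := P.formHom) P.continuous_form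

@[fun_prop]
theorem _root_.Continuous.completionForm {α : Type*} [TopologicalSpace α]
    {P : PreHilbertBimodule.{u, v} B} {f g : α → Completion P.carrier}
    (hf : Continuous f) (hg : Continuous g) : Continuous fun a => P.completionForm (f a) (g a) :=
  P.continuous_completionForm.comp (hf.prodMk hg)

/-- The completion of a pre-Hilbert bimodule, before forgetting to the norm of the form. -/
def completionPre : PreHilbertBimodule.{u, v} B where
  carrier := Completion P.carrier
  left := completionRep P.left fun b => ⟨_, P.norm_left_le b⟩
  right := completionRep P.right fun b => ⟨_, P.norm_right_le b⟩
  left_right_comm b c x := by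
    have h1 := continuous_completionRep P.left (fun b => ⟨_, P.norm_left_le b⟩) b
    have h2 := continuous_completionRep P.right (fun b => ⟨_, P.norm_right_le b⟩) c
    induction x using Completion.induction_on with
    | hp => exact isClosed_eq (by fun_prop) (by fun_prop)
    | ih x => simp only [completionRep_coe, P.left_right_comm]
  form := P.completionForm
  form_add_right x y z := by
    induction x, y, z using Completion.induction_on₃ with
    | hp => exact isClosed_eq (by fun_prop) (by fun_prop)
    | ih x y z => simp only [← Completion.coe_add, completionForm_coe, P.form_add_right]
  form_mul_right x y b := by
    have h2 := continuous_completionRep P.right (fun b => ⟨_, P.norm_right_le b⟩) (op b)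
    induction x, y using Completion.induction_on₂ with
    | hp => exact isClosed_eq (by fun_prop) (by fun_prop)
    | ih x y => simp only [completionRep_coe, completionForm_coe, P.form_mul_right]
  star_form x y := by
    induction x, y using Completion.induction_on₂ with
    | hp => exact isClosed_eq (by fun_prop) (by fun_prop)
    | ih x y => simp only [completionForm_coe, P.star_form]
  form_self_nonneg x := by
    induction x using Completion.induction_on with
    | hp => exact isClosed_le continuous_const (by fun_prop)
    | ih x => rw [completionForm_coe]; exact P.form_self_nonneg x
  form_left b x y := by
    have h1 := continuous_completionRep P.left (fun b => ⟨_, P.norm_left_le b⟩) b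
    have h2 := continuous_completionRep P.left (fun b => ⟨_, P.norm_left_le b⟩) (star b)
    induction x, y using Completion.induction_on₂ with
    | hp => exact isClosed_eq (by fun_prop) (by fun_prop)
    | ih x y => simp only [completionRep_coe, completionForm_coe, P.form_left]

theorem norm_completionPre (x : Completion P.carrier) :
    P.completionPre.instNorm.norm x = ‖x‖ := by
  change √‖P.completionForm x x‖ = ‖x‖
  induction x using Completion.induction_on with
  | hp => exact isClosed_eq (by fun_prop) (by fun_prop)
  | ih x => rw [completionForm_coe, Completion.norm_coe, norm_def]

/-- The identity map from the completion, with its own norm, to the completion with the norm of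
the extended inner product. -/
def completionId : Completion P.carrier ≃ₗᵢ[ℂ] P.completionPre.carrier where
  toFun x := x
  invFun x := x
  map_add' _ _ := rfl
  map_smul' _ _ := rfl
  left_inv _ := rfl
  right_inv _ := rfl
  norm_map' := P.norm_completionPre

/-- The completion of a pre-Hilbert bimodule (vectors of length zero become zero). -/
def completion : HilbertBimodule.{u, v} B where
  toPreHilbertBimodule := P.completionPre
  eq_zero_of_form_self x hx := by
    have h : ‖P.completionId.symm x‖ = 0 := by
      rw [LinearIsometryEquiv.norm_map, norm_def, hx, norm_zero, Real.sqrt_zero]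
    have h' : P.completionId.symm x = 0 := norm_eq_zero.mp h
    simpa using h'
  completeSpace := (P.completionId.toIsometryEquiv.isometry.isUniformInducing.completeSpace_congr
    P.completionId.surjective).mp inferInstance

/-- The canonical map into the completion. -/
def toCompletion : P.carrier →ₗᵢ[ℂ] P.completion.carrier :=
  P.completionId.toLinearIsometry.comp Completion.toComplₗᵢ

theorem form_toCompletion (x y : P.carrier) :
    P.completion.form (P.toCompletion x) (P.toCompletion y) = P.form x y :=
  P.completionForm_coe x y

theorem left_toCompletion (b : B) (x : P.carrier) :
    P.completion.left b (P.toCompletion x) = P.toCompletion (P.left b x) :=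
  completionRep_coe _ _ b x

theorem right_toCompletion (b : Bᵐᵒᵖ) (x : P.carrier) :
    P.completion.right b (P.toCompletion x) = P.toCompletion (P.right b x) :=
  completionRep_coe _ _ b x

theorem denseRange_toCompletion : DenseRange P.toCompletion :=
  P.completionId.surjective.denseRange.comp Completion.denseRange_coe
    P.completionId.continuous

/-- Extension of a bounded linear map to the completion. -/
def extend {P : PreHilbertBimodule.{u, v} B} {H : HilbertBimodule.{u, v'} B}
    (f : P.carrier →ₗ[ℂ] H.carrier) (C : ℝ) (hf : ∀ x, ‖f x‖ ≤ C * ‖x‖) :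
    P.completion.carrier →L[ℂ] H.carrier :=
  (f.mkContinuous C hf).extend P.toCompletion.toContinuousLinearMap

@[simp] theorem extend_toCompletion {P : PreHilbertBimodule.{u, v} B}
    {H : HilbertBimodule.{u, v'} B}
    (f : P.carrier →ₗ[ℂ] H.carrier) (C : ℝ) (hf : ∀ x, ‖f x‖ ≤ C * ‖x‖) (x : P.carrier) :
    extend f C hf (P.toCompletion x) = f x :=
  ContinuousLinearMap.extend_eq _ P.denseRange_toCompletion
    P.toCompletion.isometry.isUniformInducing x

end PreHilbertBimodule

end

section

variable {B : Type u} [CStarAlgebra B] [PartialOrder B] [StarOrderedRing B]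

namespace PreHilbertBimodule

/-- `B` as a bimodule over itself, `⟨x, y⟩ = x⋆ y` (lifted to a larger universe). -/
def self (B : Type u) [CStarAlgebra B] [PartialOrder B] [StarOrderedRing B] :
    PreHilbertBimodule.{u, max u v} B where
  carrier := ULift.{v} B
  left := AlgHom.ofLinearMap
    { toFun := fun b =>
        { toFun := fun x => ⟨b * x.down⟩
          map_add' := fun x y => ULift.ext _ _ (mul_add _ _ _)
          map_smul' := fun c x => ULift.ext _ _ (mul_smul_comm _ _ _) }
      map_add' := fun b c => LinearMap.ext fun x => ULift.ext _ _ (add_mul _ _ _)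
      map_smul' := fun b c => LinearMap.ext fun x => ULift.ext _ _ (smul_mul_assoc _ _ _) }
    (LinearMap.ext fun x => ULift.ext _ _ (one_mul _))
    (fun b c => LinearMap.ext fun x => ULift.ext _ _ (mul_assoc _ _ _))
  right := AlgHom.ofLinearMap
    { toFun := fun b =>
        { toFun := fun x => ⟨x.down * unop b⟩
          map_add' := fun x y => ULift.ext _ _ (add_mul _ _ _)
          map_smul' := fun c x => ULift.ext _ _ (smul_mul_assoc _ _ _) }
      map_add' := fun b c => LinearMap.ext fun x => ULift.ext _ _ (mul_add _ _ _)
      map_smul' := fun b c => LinearMap.ext fun x => ULift.ext _ _ (mul_smul_comm _ _ _) }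
    (LinearMap.ext fun x => ULift.ext _ _ (mul_one _))
    (fun b c => LinearMap.ext fun x => ULift.ext _ _ (mul_assoc _ _ _).symm)
  left_right_comm b c x := ULift.ext _ _ (mul_assoc _ _ _).symm
  form x y := star x.down * y.down
  form_add_right x y z := mul_add _ _ _
  form_mul_right x y b := (mul_assoc _ _ _).symm
  star_form x y := by simp
  form_self_nonneg x := star_mul_self_nonneg _
  form_left b x y := by
    change star (b * x.down) * y.down = star x.down * (star b * y.down)
    rw [star_mul, mul_assoc]

end PreHilbertBimodule

/-- `B` as a Hilbert bimodule over itself. -/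
def HilbertBimodule.self (B : Type u) [CStarAlgebra B] [PartialOrder B] [StarOrderedRing B] :
    HilbertBimodule.{u, max u v} B where
  toPreHilbertBimodule := PreHilbertBimodule.self.{u, v} B
  eq_zero_of_form_self x hx :=
    ULift.ext _ _ ((CStarRing.star_mul_self_eq_zero_iff x.down).mp hx)
  completeSpace := by
    let f : B ≃ₗᵢ[ℂ] (PreHilbertBimodule.self.{u, v} B).carrier :=
      { toFun := ULift.up
        invFun := ULift.down
        map_add' := fun _ _ => rfl
        map_smul' := fun _ _ => rfl
        left_inv := fun _ => rfl
        right_inv := fun _ => rfl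
        norm_map' := fun x => by
          change √‖star x * x‖ = ‖x‖
          rw [CStarRing.norm_star_mul_self, Real.sqrt_mul_self (norm_nonneg _)] }
    exact (f.isometry.isUniformInducing.completeSpace_congr f.surjective).mp inferInstance

/-- A Hilbert bimodule with a specified vector `ξ` such that `⟨ξ, b ξ⟩ = b`. -/
structure PointedHilbertBimodule (B : Type u) [CStarAlgebra B] [PartialOrder B]
    [StarOrderedRing B] extends HilbertBimodule.{u, v} B where
  vac : carrier
  form_vac : ∀ b, form vac (left b vac) = b

namespace PointedHilbertBimodule

variable (M : PointedHilbertBimodule.{u, v} B)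

/-- The orthogonal complement of `B ξ`. -/
def complSubmodule : Submodule ℂ M.carrier where
  carrier := {x | ∀ b, M.form (M.left b M.vac) x = 0}
  add_mem' hx hy b := by rw [M.form_add_right, hx b, hy b, add_zero]
  zero_mem' b := M.form_zero_right _
  smul_mem' c x hx b := by rw [M.form_smul_right, hx b, smul_zero]

theorem left_mem (b : B) (x : M.carrier) (hx : x ∈ M.complSubmodule) :
    M.left b x ∈ M.complSubmodule := fun c => by
  have h := hx (star b * c)
  rwa [map_mul, Module.End.mul_apply, M.form_left, star_star] at h

theorem right_mem (b : Bᵐᵒᵖ) (x : M.carrier) (hx : x ∈ M.complSubmodule) :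
    M.right b x ∈ M.complSubmodule := fun c => by
  obtain ⟨b, rfl⟩ := op_surjective b
  rw [M.form_mul_right, hx c, zero_mul]

/-- A representation restricted to an invariant subspace. -/
def restrictRep {V R : Type*} [AddCommGroup V] [Module ℂ V] [Ring R] [Algebra ℂ R]
    (ρ : R →ₐ[ℂ] Module.End ℂ V) (N : Submodule ℂ V) (h : ∀ r, ∀ x ∈ N, ρ r x ∈ N) :
    R →ₐ[ℂ] Module.End ℂ N :=
  AlgHom.ofLinearMap
    { toFun := fun r => (ρ r).restrict (h r)
      map_add' := fun r s => by ext x; simp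
      map_smul' := fun c r => by ext x; simp }
    (by ext x; simp) (fun r s => by ext x; simp)

/-- The orthogonal complement `M°` of `B ξ` as a bimodule. -/
def complPre : PreHilbertBimodule.{u, v} B where
  carrier := M.complSubmodule
  left := restrictRep M.left _ M.left_mem
  right := restrictRep M.right _ M.right_mem
  left_right_comm b c x := Subtype.ext (M.left_right_comm b c x)
  form x y := M.form x y
  form_add_right _ _ _ := M.form_add_right _ _ _
  form_mul_right _ _ _ := M.form_mul_right _ _ _
  star_form _ _ := M.star_form _ _
  form_self_nonneg _ := M.form_self_nonneg _
  form_left _ _ _ := M.form_left _ _ _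

theorem isClosed_complSubmodule : IsClosed (M.complSubmodule : Set M.carrier) := by
  have h : (M.complSubmodule : Set M.carrier)
      = ⋂ b, {x | M.form (M.left b M.vac) x = 0} := by
    ext x; simp [complSubmodule]
  rw [h]
  exact isClosed_iInter fun b => isClosed_eq
    (M.continuous_form.comp (continuous_const.prodMk continuous_id)) continuous_const

/-- The Hilbert bimodule `M°`, the orthogonal complement of `B ξ`. -/
def compl : HilbertBimodule.{u, v} B where
  toPreHilbertBimodule := M.complPre
  eq_zero_of_form_self x hx := Subtype.ext (M.eq_zero_of_form_self _ hx)
  completeSpace := by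
    let f : M.complSubmodule ≃ₗᵢ[ℂ] M.complPre.carrier :=
      { toFun := fun x => x
        invFun := fun x => x
        map_add' := fun _ _ => rfl
        map_smul' := fun _ _ => rfl
        left_inv := fun _ => rfl
        right_inv := fun _ => rfl
        norm_map' := fun x => rfl }
    have : CompleteSpace M.complSubmodule := M.isClosed_complSubmodule.completeSpace_coe
    exact (f.isometry.isUniformInducing.completeSpace_congr f.surjective).mp this

theorem form_vac_left (b : B) (x : M.carrier) :
    M.form (M.left b M.vac) x = star b * M.form M.vac x := by
  have h : M.left b M.vac = M.right (op b) M.vac := by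
    rw [← sub_eq_zero]
    refine M.eq_zero_of_form_self _ ?_
    have h1 : M.form M.vac M.vac = 1 := by simpa using M.form_vac 1
    have h2 : M.form (M.left b M.vac) M.vac = star b := by
      rw [M.form_left, M.form_vac]
    have h3 : M.form (M.left b M.vac) (M.left b M.vac) = star b * b := by
      rw [M.form_left, ← Module.End.mul_apply, ← map_mul, M.form_vac]
    simp only [M.form_sub_left, M.form_sub_right, M.form_mul_right, M.form_mul_left, h1, h2, h3,
      M.form_vac]
    simp
  rw [h, M.form_mul_left]

/-- The orthogonal projection `m ↦ m - ⟨ξ, m⟩ ξ` onto `M°`. -/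
def toCompl : M.carrier →ₗ[ℂ] M.compl.carrier where
  toFun m := (⟨m - M.left (M.form M.vac m) M.vac, fun b => by
    rw [M.form_sub_right, M.form_vac_left, M.form_vac_left, M.form_vac, sub_self]⟩ :
      M.complSubmodule)
  map_add' x y := Subtype.ext (by
    change x + y - M.left (M.form M.vac (x + y)) M.vac
      = x - M.left (M.form M.vac x) M.vac + (y - M.left (M.form M.vac y) M.vac)
    rw [M.form_add_right, map_add, LinearMap.add_apply]; abel)
  map_smul' c x := Subtype.ext (by
    change c • x - M.left (M.form M.vac (c • x)) M.vac = c • (x - M.left (M.form M.vac x) M.vac)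
    rw [M.form_smul_right, map_smul, LinearMap.smul_apply, smul_sub])

theorem form_eq (x y : M.carrier) : M.form x y =
    star (M.form M.vac x) * M.form M.vac y + M.compl.form (M.toCompl x) (M.toCompl y) := by
  change _ = _ + M.form (x - M.left (M.form M.vac x) M.vac) (y - M.left (M.form M.vac y) M.vac)
  have h : ∀ b, M.form x (M.left b M.vac) = star (M.form M.vac x) * b := fun b => by
    rw [← M.star_form, M.form_vac_left, star_mul, star_star]
  simp only [M.form_sub_left, M.form_sub_right, M.form_vac_left, h, M.form_vac]
  abel

end PointedHilbertBimodule

namespace HilbertBimodule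

theorem finite_support_form {κ : Type k} (F : κ → HilbertBimodule.{u, v} B)
    (x y : ⨁ i, (F i).carrier) :
    (Function.support fun i => (F i).form (x i) (y i)).Finite := by
  refine (DFinsupp.finite_support y).subset fun i hi h => hi ?_
  change (F i).form (x i) (y i) = 0
  have h' : y i = 0 := h
  rw [h', (F i).form_zero_right]

/-- The algebraic direct sum of Hilbert bimodules, `⟨x, y⟩ = ∑ i, ⟨x i, y i⟩`. -/
def directSumPre {κ : Type k} (F : κ → HilbertBimodule.{u, v} B) :
    PreHilbertBimodule.{u, max k v} B where
  carrier := ⨁ i, (F i).carrier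
  left := AlgHom.ofLinearMap
    { toFun := fun b => DirectSum.lmap fun i => (F i).left b
      map_add' := fun b c => LinearMap.ext fun x => DFinsupp.ext fun i => by
        simp [DirectSum.lmap_apply]
      map_smul' := fun b c => LinearMap.ext fun x => DFinsupp.ext fun i =>
        congrArg (fun T : Module.End ℂ (F i).carrier => T (x i)) (map_smul (F i).left b c) }
    (LinearMap.ext fun x => DFinsupp.ext fun i => by simp [DirectSum.lmap_apply])
    (fun b c => LinearMap.ext fun x => DFinsupp.ext fun i => by simp [DirectSum.lmap_apply])
  right := AlgHom.ofLinearMap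
    { toFun := fun b => DirectSum.lmap fun i => (F i).right b
      map_add' := fun b c => LinearMap.ext fun x => DFinsupp.ext fun i => by
        simp [DirectSum.lmap_apply]
      map_smul' := fun b c => LinearMap.ext fun x => DFinsupp.ext fun i =>
        congrArg (fun T : Module.End ℂ (F i).carrier => T (x i)) (map_smul (F i).right b c) }
    (LinearMap.ext fun x => DFinsupp.ext fun i => by simp [DirectSum.lmap_apply])
    (fun b c => LinearMap.ext fun x => DFinsupp.ext fun i => by simp [DirectSum.lmap_apply])
  left_right_comm b c x := DFinsupp.ext fun i => (F i).left_right_comm b c (x i)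
  form x y := ∑ᶠ i, (F i).form (x i) (y i)
  form_add_right x y z := by
    rw [← finsum_add_distrib (finite_support_form F x y) (finite_support_form F x z)]
    exact finsum_congr fun i => (F i).form_add_right _ _ _
  form_mul_right x y b := by
    rw [finsum_mul' _ b (finite_support_form F x y)]
    exact finsum_congr fun i => (F i).form_mul_right _ _ _
  star_form x y := by
    have h := (starAddEquiv (R := B)).toAddMonoidHom.map_finsum (finite_support_form F x y)
    refine h.trans (finsum_congr fun i => (F i).star_form _ _)
  form_self_nonneg x := finsum_nonneg fun i => (F i).form_self_nonneg _
  form_left b x y := finsum_congr fun i => (F i).form_left b (x i) (y i)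

/-- The Hilbert direct sum of Hilbert bimodules. -/
abbrev directSum {κ : Type k} (F : κ → HilbertBimodule.{u, v} B) :
    HilbertBimodule.{u, max k v} B := (directSumPre F).completion

/-- The components of an element of the algebraic direct sum. -/
def coord {κ : Type k} (F : κ → HilbertBimodule.{u, v} B) (i : κ) :
    (directSumPre F).carrier →ₗ[ℂ] (F i).carrier :=
  DirectSum.component ℂ κ (fun i => (F i).carrier) i

theorem directSumPre_form {κ : Type k} (F : κ → HilbertBimodule.{u, v} B)
    (x y : (directSumPre F).carrier) :
    (directSumPre F).form x y = ∑ᶠ i, (F i).form (coord F i x) (coord F i y) := rfl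

/-- The inclusion of a summand in the algebraic direct sum. -/
def inclPre {κ : Type k} (F : κ → HilbertBimodule.{u, v} B) (i : κ) :
    (F i).carrier →ₗ[ℂ] (directSumPre F).carrier :=
  haveI := Classical.decEq κ
  DirectSum.lof ℂ κ (fun i => (F i).carrier) i

theorem inclPre_same {κ : Type k} (F : κ → HilbertBimodule.{u, v} B) (i : κ)
    (x : (F i).carrier) : coord F i (inclPre F i x) = x := by
  classical exact DirectSum.of_eq_same (β := fun i => (F i).carrier) i x

theorem inclPre_ne {κ : Type k} (F : κ → HilbertBimodule.{u, v} B) {i j : κ} (h : i ≠ j)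
    (x : (F i).carrier) : coord F j (inclPre F i x) = 0 := by
  classical exact DirectSum.of_eq_of_ne (β := fun i => (F i).carrier) i j x h.symm

theorem form_inclPre {κ : Type k} (F : κ → HilbertBimodule.{u, v} B) (i : κ)
    (x y : (F i).carrier) : (directSumPre F).form (inclPre F i x) (inclPre F i y)
      = (F i).form x y := by
  rw [directSumPre_form]
  refine (finsum_eq_single _ i fun j hj => ?_).trans ?_
  · rw [inclPre_ne F hj.symm, (F j).form_zero_left]
  · rw [inclPre_same, inclPre_same]

theorem form_inclPre_of_ne {κ : Type k} (F : κ → HilbertBimodule.{u, v} B) {i j : κ}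
    (h : i ≠ j) (x : (F i).carrier) (y : (F j).carrier) :
    (directSumPre F).form (inclPre F i x) (inclPre F j y) = 0 := by
  rw [directSumPre_form]
  refine finsum_eq_zero_of_forall_eq_zero fun l => ?_
  by_cases hl : i = l
  · rw [inclPre_ne F (j := l) (fun hj => h (hl.trans hj.symm)), (F l).form_zero_right]
  · rw [inclPre_ne F hl, (F l).form_zero_left]

@[elab_as_elim]
theorem directSumPre_induction {κ : Type k} (F : κ → HilbertBimodule.{u, v} B)
    {p : (directSumPre F).carrier → Prop} (x : (directSumPre F).carrier) (h0 : p 0)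
    (hi : ∀ i x, p (inclPre F i x)) (ha : ∀ x y, p x → p y → p (x + y)) : p x := by
  let _ := Classical.decEq κ
  exact DirectSum.induction_on x h0 (fun i y => hi i y) ha

/-- The inclusion of a summand. -/
def incl {κ : Type k} (F : κ → HilbertBimodule.{u, v} B) (i : κ) :
    (F i).carrier →ₗ[ℂ] (directSum F).carrier :=
  (directSumPre F).toCompletion.toLinearMap ∘ₗ inclPre F i

/-- Linear maps out of the algebraic direct sum. -/
def descPre {κ : Type k} (F : κ → HilbertBimodule.{u, v} B) {W : Type*} [AddCommGroup W]
    [Module ℂ W] (f : ∀ i, (F i).carrier →ₗ[ℂ] W) : (directSumPre F).carrier →ₗ[ℂ] W :=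
  haveI := Classical.decEq κ
  DirectSum.toModule ℂ κ W f

theorem descPre_inclPre {κ : Type k} (F : κ → HilbertBimodule.{u, v} B) {W : Type*}
    [AddCommGroup W] [Module ℂ W] (f : ∀ i, (F i).carrier →ₗ[ℂ] W) (i : κ) (x : (F i).carrier) :
    descPre F f (inclPre F i x) = f i x := by
  classical exact DirectSum.toModule_lof ℂ (M := fun i => (F i).carrier) i x

/-- The projection of the algebraic direct sum onto the summands with index in `J`. -/
def cutPre {κ : Type k} (F : κ → HilbertBimodule.{u, v} B) (J : Set κ) :
    (directSumPre F).carrier →ₗ[ℂ] (directSumPre F).carrier :=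
  haveI := Classical.decPred (· ∈ J)
  DirectSum.lmap fun i => if i ∈ J then LinearMap.id else 0

theorem coord_cutPre_of_mem {κ : Type k} (F : κ → HilbertBimodule.{u, v} B) {J : Set κ} {i : κ}
    (hi : i ∈ J) (x : (directSumPre F).carrier) : coord F i (cutPre F J x) = coord F i x := by
  let _ := Classical.decPred (· ∈ J)
  change (if i ∈ J then LinearMap.id else 0 : Module.End ℂ (F i).carrier) (coord F i x) = _
  rw [if_pos hi]; rfl

theorem coord_cutPre_of_notMem {κ : Type k} (F : κ → HilbertBimodule.{u, v} B) {J : Set κ}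
    {i : κ} (hi : i ∉ J) (x : (directSumPre F).carrier) : coord F i (cutPre F J x) = 0 := by
  let _ := Classical.decPred (· ∈ J)
  change (if i ∈ J then LinearMap.id else 0 : Module.End ℂ (F i).carrier) (coord F i x) = _
  rw [if_neg hi]; rfl

theorem norm_cutPre_le {κ : Type k} (F : κ → HilbertBimodule.{u, v} B) (J : Set κ)
    (x : (directSumPre F).carrier) : ‖cutPre F J x‖ ≤ 1 * ‖x‖ := by
  rw [one_mul, PreHilbertBimodule.norm_def, PreHilbertBimodule.norm_def]
  refine Real.sqrt_le_sqrt (CStarAlgebra.norm_le_norm_of_nonneg_of_le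
    ((directSumPre F).form_self_nonneg _) ?_)
  rw [directSumPre_form, directSumPre_form]
  refine finsum_le_finsum' (finite_support_form F (cutPre F J x) (cutPre F J x))
    (finite_support_form F x x) fun i => ?_
  by_cases hi : i ∈ J
  · rw [coord_cutPre_of_mem F hi]
  · rw [coord_cutPre_of_notMem F hi, (F i).form_zero_left]
    exact (F i).form_self_nonneg _

/-- The orthogonal projection of the Hilbert direct sum onto the summands with index in `J`. -/
def cut {κ : Type k} (F : κ → HilbertBimodule.{u, v} B) (J : Set κ) :
    (directSum F).carrier →L[ℂ] (directSum F).carrier :=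
  PreHilbertBimodule.extend (H := directSum F)
    ((directSumPre F).toCompletion.toLinearMap ∘ₗ cutPre F J) 1 fun x => by
      exact ((directSumPre F).toCompletion.norm_map _).le.trans (norm_cutPre_le F J x)

end HilbertBimodule

end

section

variable {B : Type u} [CStarAlgebra B] [PartialOrder B] [StarOrderedRing B]

namespace HilbertBimodule

/-- The algebra `L(M)` of adjointable operators of a Hilbert bimodule. -/
def adjointable (H : HilbertBimodule.{u, v} B) : Subalgebra ℂ (H.carrier →L[ℂ] H.carrier) where
  carrier := {T | ∃ S : H.carrier → H.carrier, ∀ x y, H.form (T x) y = H.form x (S y)}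
  mul_mem' := by
    rintro T T' ⟨S, hS⟩ ⟨S', hS'⟩
    exact ⟨fun y => S' (S y), fun x y => by rw [mul_apply_eq_comp, hS, hS']⟩
  add_mem' := by
    rintro T T' ⟨S, hS⟩ ⟨S', hS'⟩
    exact ⟨fun y => S y + S' y, fun x y => by
      rw [_root_.add_apply, H.form_add_left, hS, hS', H.form_add_right]⟩
  algebraMap_mem' c := ⟨fun y => star c • y, fun x y => by
    rw [Algebra.algebraMap_eq_smul_one, _root_.smul_apply, one_apply_eq_self, H.form_smul_left,
      H.form_smul_right]⟩

/-- The operator `x ↦ b x` as an adjointable operator. -/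
def leftOp (H : HilbertBimodule.{u, v} B) (b : B) : H.adjointable :=
  ⟨(H.left b).mkContinuous ‖b‖ (H.norm_left_le b), fun y => H.left (star b) y,
    fun x y => H.form_left b x y⟩

theorem adjointable_right {H : HilbertBimodule.{u, v} B} (T : H.adjointable) (b : Bᵐᵒᵖ)
    (x : H.carrier) : T.1 (H.right b x) = H.right b (T.1 x) := by
  obtain ⟨S, hS⟩ := T.2
  obtain ⟨b, rfl⟩ := op_surjective b
  have h : ∀ y, H.form (T.1 (H.right (op b) x) - H.right (op b) (T.1 x)) y = 0 := fun y => by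
    rw [H.form_sub_left, hS, H.form_mul_left, H.form_mul_left, hS, sub_self]
  exact sub_eq_zero.mp (H.eq_zero_of_form_self _ (h _))

theorem exists_inv_sqrt {a : B} (ha : 0 ≤ a) {ε : ℝ} (hε : 0 < ε) :
    ∃ p q : B, star p = p ∧ star q = q ∧ p * q = 1 ∧ q * p = 1 ∧ q * q = algebraMap ℝ B ε + a := by
  set h := algebraMap ℝ B ε + a
  have hh : IsStrictlyPositive h := by
    refine IsStrictlyPositive.add_nonneg ?_ ha
    refine ⟨?_, (IsUnit.mk0 ε hε.ne').map _⟩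
    exact algebraMap_nonneg B hε.le
  refine ⟨h ^ (-(1 / 2) : ℝ), h ^ (1 / 2 : ℝ), IsSelfAdjoint.of_nonneg CFC.rpow_nonneg,
    IsSelfAdjoint.of_nonneg CFC.rpow_nonneg, CFC.rpow_neg_mul_rpow _ hh,
    CFC.rpow_mul_rpow_neg _ hh, ?_⟩
  rw [← CFC.rpow_add hh.isUnit]
  norm_num
  exact CFC.rpow_one h hh.nonneg

theorem form_adjointable_le {H : HilbertBimodule.{u, v} B} (T : H.adjointable) (x : H.carrier) :
    H.form (T.1 x) (T.1 x) ≤ ‖T.1‖ ^ 2 • H.form x x := by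
  have key : ∀ ε : ℝ, 0 < ε →
      H.form (T.1 x) (T.1 x) ≤ ‖T.1‖ ^ 2 • (algebraMap ℝ B ε + H.form x x) := by
    intro ε hε
    obtain ⟨p, q, hp, hq, hpq, hqp, hqq⟩ := exists_inv_sqrt (H.form_self_nonneg x) hε
    set y := H.right (op p) x with hy
    have h1 : H.form y y ≤ 1 := by
      have : p * H.form x x * p ≤ p * (q * q) * p := by
        have := star_left_conjugate_le_conjugate
          (show H.form x x ≤ q * q by rw [hqq, le_add_iff_nonneg_left]; exact algebraMap_nonneg B hε.le) p
        rwa [hp] at this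
      rw [hy, H.form_mul_left, H.form_mul_right, hp, ← mul_assoc]
      refine this.trans (le_of_eq ?_)
      rw [← mul_assoc, hpq, one_mul, hqp]
    have h2 : ‖y‖ ≤ 1 := by
      rw [H.norm_def]
      exact Real.sqrt_le_one.mpr
        ((CStarAlgebra.norm_le_one_iff_of_nonneg _ (H.form_self_nonneg y)).mpr h1)
    have h3 : H.form (T.1 y) (T.1 y) ≤ algebraMap ℝ B (‖T.1‖ ^ 2) := by
      refine (IsSelfAdjoint.le_algebraMap_norm_self (H.star_form _ _)).trans ?_
      refine algebraMap_mono B ?_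
      rw [← H.norm_sq]
      have := T.1.le_opNorm y
      have : ‖T.1 y‖ ≤ ‖T.1‖ := this.trans (mul_le_of_le_one_right (norm_nonneg _) h2)
      gcongr
    have hxy : x = H.right (op q) y := by
      rw [hy, ← Module.End.mul_apply, ← map_mul, ← op_mul, hpq, op_one, map_one]; rfl
    have h4 : H.form (T.1 x) (T.1 x) = q * H.form (T.1 y) (T.1 y) * q := by
      conv_lhs => rw [hxy]
      rw [adjointable_right, H.form_mul_left, H.form_mul_right, hq, mul_assoc]
    rw [h4, ← hqq]
    have h5 := star_left_conjugate_le_conjugate h3 q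
    rw [hq] at h5
    refine h5.trans (le_of_eq ?_)
    rw [Algebra.algebraMap_eq_smul_one]
    simp
  have ht : Filter.Tendsto (fun ε : ℝ => ‖T.1‖ ^ 2 • (algebraMap ℝ B ε + H.form x x))
      (nhdsWithin 0 (Set.Ioi 0)) (nhds (‖T.1‖ ^ 2 • H.form x x)) := by
    have hc : Continuous fun ε : ℝ => ‖T.1‖ ^ 2 • (algebraMap ℝ B ε + H.form x x) := by
      have := continuous_algebraMap ℝ B
      fun_prop
    have := (hc.tendsto 0).mono_left (nhdsWithin_le_nhds (s := Set.Ioi 0))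
    simpa using this
  exact ge_of_tendsto ht (by filter_upwards [self_mem_nhdsWithin] with ε hε using key ε hε)

theorem _root_.JIndep.PreHilbertBimodule.sum_form_nonneg (F : PreHilbertBimodule.{u, v} B)
    {n : Type*} [Fintype n] (G : n → n → B)
    (hG : ∀ i j, star (G i j) = G j i)
    (hpos : ∀ b : n → B, 0 ≤ ∑ i, ∑ j, star (b i) * G i j * b j) (y : n → F.carrier) :
    0 ≤ ∑ i, ∑ j, F.form (y i) (F.left (G i j) (y j)) := by
  classical
  obtain ⟨S, hS⟩ := exists_eq_star_mul_self G hG hpos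
  have h : ∑ i, ∑ j, F.form (y i) (F.left (G i j) (y j))
      = ∑ p, F.form (∑ i, F.left (S p i) (y i)) (∑ j, F.left (S p j) (y j)) := by
    simp only [F.form_sum_left, F.form_sum_right, F.form_left]
    simp only [hS, map_sum, LinearMap.sum_apply, F.form_sum_right, map_mul, Module.End.mul_apply]
    conv_lhs =>
      enter [2, i]
      rw [Finset.sum_comm]
    rw [Finset.sum_comm]
  rw [h]
  exact Finset.sum_nonneg fun p _ => F.form_self_nonneg _

theorem tensor_addHom_ext {V W G : Type*} [AddCommGroup V] [Module ℂ V] [AddCommGroup W]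
    [Module ℂ W] [AddCommGroup G] {f g : V ⊗[ℂ] W →+ G}
    (h : ∀ x y, f (x ⊗ₜ y) = g (x ⊗ₜ y)) : f = g := by
  ext t
  induction t with
  | zero => simp only [map_zero]
  | add s t hs ht => simp only [map_add, hs, ht]
  | tmul x y => exact h x y

variable (E : HilbertBimodule.{u, v} B) (F : HilbertBimodule.{u, v'} B)

/-- The additive map `x' ⊗ y' ↦ ⟨y, ⟨x, x'⟩ y'⟩`. -/
def tensorFormAux (x : E.carrier) (y : F.carrier) : (E.carrier ⊗[ℂ] F.carrier) →+ B :=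
  TensorProduct.liftAddHom
    (AddMonoidHom.mk' (fun x' => AddMonoidHom.mk' (fun y' => F.form y (F.left (E.form x x') y'))
        (fun _ _ => by rw [map_add, F.form_add_right]))
      (fun _ _ => by
        ext
        simp [E.form_add_right, F.form_add_right]))
    (fun c x' y' => by
      simp [E.form_smul_right])

theorem tensorFormAux_tmul (x x' : E.carrier) (y y' : F.carrier) :
    tensorFormAux E F x y (x' ⊗ₜ y') = F.form y (F.left (E.form x x') y') := rfl

/-- The inner product of `E ⊗ F`: `⟨x ⊗ y, x' ⊗ y'⟩ = ⟨y, ⟨x, x'⟩ y'⟩`. -/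
def tensorForm : (E.carrier ⊗[ℂ] F.carrier) →+ (E.carrier ⊗[ℂ] F.carrier) →+ B :=
  TensorProduct.liftAddHom
    (AddMonoidHom.mk' (fun x => AddMonoidHom.mk' (fun y => tensorFormAux E F x y)
      (fun y₁ y₂ => tensor_addHom_ext fun x' y' => by
        simp only [AddMonoidHom.add_apply, tensorFormAux_tmul, F.form_add_left]))
      (fun x₁ x₂ => AddMonoidHom.ext fun y => tensor_addHom_ext fun x' y' => by
        simp only [AddMonoidHom.add_apply, AddMonoidHom.mk'_apply, tensorFormAux_tmul,
          E.form_add_left, map_add, LinearMap.add_apply, F.form_add_right]))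
    (fun c x y => tensor_addHom_ext fun x' y' => by
      simp only [AddMonoidHom.mk'_apply, tensorFormAux_tmul, E.form_smul_left, map_smul,
        LinearMap.smul_apply, F.form_smul_left, F.form_smul_right])

theorem tensorForm_tmul (x x' : E.carrier) (y y' : F.carrier) :
    tensorForm E F (x ⊗ₜ y) (x' ⊗ₜ y') = F.form y (F.left (E.form x x') y') := rfl

theorem exists_tensor_rep (t : E.carrier ⊗[ℂ] F.carrier) :
    ∃ (s : Finset (E.carrier × F.carrier)), t = ∑ p : s, p.1.1 ⊗ₜ[ℂ] p.1.2 := by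
  obtain ⟨s, hs⟩ := TensorProduct.exists_finset t
  exact ⟨s, by rw [hs, ← Finset.sum_coe_sort]⟩

theorem tensorForm_sum {n : Type*} [Fintype n] (x : n → E.carrier) (y : n → F.carrier) :
    tensorForm E F (∑ i, x i ⊗ₜ y i) (∑ i, x i ⊗ₜ y i)
      = ∑ i, ∑ j, F.form (y i) (F.left (E.form (x i) (x j)) (y j)) := by
  rw [map_sum (tensorForm E F), AddMonoidHom.finsetSum_apply]
  refine Finset.sum_congr rfl fun i _ => ?_
  rw [map_sum]
  rfl

/-- The algebraic tensor product over `ℂ` with its `B`-valued semi-inner product. The vectors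
`x b ⊗ y - x ⊗ b y` have length zero, so that its completion is the tensor product over `B`. -/
def tensorPre : PreHilbertBimodule.{u, max v v'} B where
  carrier := E.carrier ⊗[ℂ] F.carrier
  left := (Module.End.rTensorAlgHom ℂ E.carrier F.carrier).comp E.left
  right := (Module.End.lTensorAlgHom ℂ F.carrier E.carrier).comp F.right
  left_right_comm b c t := by
    induction t with
    | zero => simp only [map_zero]
    | add s t hs ht => simp only [map_add, hs, ht]
    | tmul x y => rfl
  form s t := tensorForm E F s t
  form_add_right s t t' := map_add _ _ _
  form_mul_right s t b := by
    induction s with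
    | zero => simp only [map_zero, AddMonoidHom.zero_apply, zero_mul]
    | add s s' hs hs' => simp only [map_add, AddMonoidHom.add_apply, hs, hs', add_mul]
    | tmul x y =>
      induction t with
      | zero => simp only [map_zero, zero_mul]
      | add t t' ht ht' => simp only [map_add, ht, ht', add_mul]
      | tmul x' y' =>
        change F.form y (F.left (E.form x x') (F.right (op b) y')) = _
        rw [F.left_right_comm, F.form_mul_right]
        rfl
  star_form s t := by
    induction s with
    | zero => simp only [map_zero, AddMonoidHom.zero_apply, star_zero]
    | add s s' hs hs' => simp only [map_add, AddMonoidHom.add_apply, hs, hs', star_add]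
    | tmul x y =>
      induction t with
      | zero => simp only [map_zero, AddMonoidHom.zero_apply, star_zero]
      | add t t' ht ht' => simp only [map_add, AddMonoidHom.add_apply, ht, ht', star_add]
      | tmul x' y' =>
        rw [tensorForm_tmul, tensorForm_tmul, F.star_form, F.form_left, E.star_form]
  form_self_nonneg t := by
    obtain ⟨s, rfl⟩ := exists_tensor_rep E F t
    rw [tensorForm_sum E F (fun p : s => p.1.1) (fun p : s => p.1.2)]
    refine F.sum_form_nonneg (fun i j : s => E.form i.1.1 j.1.1) (fun i j => E.star_form _ _)
      (fun b => ?_) (fun p : s => p.1.2)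
    have h := E.form_self_nonneg (∑ i : s, E.right (op (b i)) i.1.1)
    simpa only [E.form_sum_left, E.form_sum_right, E.form_mul_left, E.form_mul_right,
      ← mul_assoc] using h
  form_left b s t := by
    induction s with
    | zero => simp only [map_zero, AddMonoidHom.zero_apply]
    | add s s' hs hs' => simp only [map_add, AddMonoidHom.add_apply, hs, hs']
    | tmul x y =>
      induction t with
      | zero => simp only [map_zero]
      | add t t' ht ht' => simp only [map_add, ht, ht']
      | tmul x' y' =>
        change F.form y (F.left (E.form (E.left b x) x') y')
          = F.form y (F.left (E.form x (E.left (star b) x')) y')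
        rw [E.form_left]

/-- The (interior) tensor product `E ⊗_B F` of Hilbert bimodules. -/
abbrev tensor : HilbertBimodule.{u, max v v'} B := (tensorPre E F).completion

/-- The elementary tensor `x ⊗ y` in `E ⊗_B F`. -/
def tmul : E.carrier →ₗ[ℂ] F.carrier →ₗ[ℂ] (tensor E F).carrier :=
  (TensorProduct.mk ℂ E.carrier F.carrier).compr₂ (tensorPre E F).toCompletion.toLinearMap

theorem form_tmul (x x' : E.carrier) (y y' : F.carrier) :
    (tensor E F).form (tmul E F x y) (tmul E F x' y') = F.form y (F.left (E.form x x') y') :=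
  (tensorPre E F).form_toCompletion _ _

/-- The operator `T ⊗ 1` on the algebraic tensor product. -/
def tensorOpPre (T : E.adjointable) : (tensorPre E F).carrier →ₗ[ℂ] (tensorPre E F).carrier :=
  LinearMap.rTensor F.carrier (T.1 : E.carrier →ₗ[ℂ] E.carrier)

theorem norm_tensorOpPre_le (T : E.adjointable) (t : (tensorPre E F).carrier) :
    ‖tensorOpPre E F T t‖ ≤ ‖T.1‖ * ‖t‖ := by
  have key : tensorForm E F (tensorOpPre E F T t) (tensorOpPre E F T t)
      ≤ ‖T.1‖ ^ 2 • tensorForm E F t t := by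
    obtain ⟨s, hs⟩ := exists_tensor_rep E F t
    have hT : tensorOpPre E F T t = ∑ p : s, T.1 p.1.1 ⊗ₜ[ℂ] p.1.2 := by
      rw [hs]
      exact map_sum (LinearMap.rTensor F.carrier (T.1 : E.carrier →ₗ[ℂ] E.carrier)) _ _
    rw [hT, hs, tensorForm_sum E F (fun p : s => p.1.1) (fun p : s => p.1.2),
      tensorForm_sum E F (fun p : s => T.1 p.1.1) (fun p : s => p.1.2), ← sub_nonneg]
    have h := F.sum_form_nonneg (fun i j : s => ((‖T.1‖ ^ 2 : ℝ) : ℂ) • E.form i.1.1 j.1.1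
      - E.form (T.1 i.1.1) (T.1 j.1.1)) (fun i j => by
        rw [star_sub, E.star_form, Complex.coe_smul, Complex.coe_smul, star_smul, E.star_form]
        simp) (fun b => ?_) (fun p : s => p.1.2)
    · refine h.trans (le_of_eq ?_)
      rw [Finset.smul_sum, ← Finset.sum_sub_distrib]
      refine Finset.sum_congr rfl fun i _ => ?_
      rw [Finset.smul_sum, ← Finset.sum_sub_distrib]
      refine Finset.sum_congr rfl fun j _ => ?_
      rw [map_sub, map_smul, LinearMap.sub_apply, LinearMap.smul_apply, F.form_sub_right,
        F.form_smul_right, Complex.coe_smul]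
    · have h := sub_nonneg.mpr (form_adjointable_le T (∑ i : s, E.right (op (b i)) i.1.1))
      refine h.trans (le_of_eq ?_)
      simp only [map_sum, adjointable_right, E.form_sum_left, E.form_sum_right, E.form_mul_left,
        E.form_mul_right, Finset.smul_sum, ← Finset.sum_sub_distrib]
      refine Finset.sum_congr rfl fun i _ => Finset.sum_congr rfl fun j _ => ?_
      simp only [Complex.coe_smul, mul_sub, sub_mul, mul_assoc, mul_smul_comm, smul_mul_assoc]
  refine le_of_sq_le_sq ?_ (by positivity)
  rw [mul_pow, PreHilbertBimodule.norm_sq, PreHilbertBimodule.norm_sq]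
  calc _ ≤ ‖‖T.1‖ ^ 2 • tensorForm E F t t‖ :=
        CStarAlgebra.norm_le_norm_of_nonneg_of_le ((tensorPre E F).form_self_nonneg _) key
    _ = _ := by rw [norm_smul, Real.norm_of_nonneg (by positivity)]; rfl

/-- The operator `T ⊗ 1` on `E ⊗_B F`. -/
def tensorOp (T : E.adjointable) : (tensor E F).carrier →L[ℂ] (tensor E F).carrier :=
  PreHilbertBimodule.extend (H := tensor E F)
    ((tensorPre E F).toCompletion.toLinearMap ∘ₗ tensorOpPre E F T) ‖T.1‖ fun t =>
      ((tensorPre E F).toCompletion.norm_map _).le.trans (norm_tensorOpPre_le E F T t)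

theorem tensorOp_tmul (T : E.adjointable) (x : E.carrier) (y : F.carrier) :
    tensorOp E F T (tmul E F x y) = tmul E F (T.1 x) y :=
  PreHilbertBimodule.extend_toCompletion _ _ _ _

end HilbertBimodule

end

section

variable {B : Type u} [CStarAlgebra B] [PartialOrder B] [StarOrderedRing B]

/-! ### The reduced free product -/

/-- The set `K(I)` of words `(i₁, …, iₙ)` with `iⱼ ≠ iⱼ₊₁`, including the empty word. -/
abbrev AltWord (I : Type k) : Type k := {l : List I // l.IsChain (· ≠ ·)}

namespace AltWord

variable {I : Type k}

/-- The empty word. -/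
def nil : AltWord I := ⟨[], List.isChain_nil⟩

/-- The word does not start with `i`. -/
def NotStart (i : I) (l : AltWord I) : Prop := l.1.head? ≠ some i

/-- The word `(i, i₁, …, iₙ)`, where `i ≠ i₁`. -/
def cons (i : I) (l : AltWord I) (h : l.NotStart i) : AltWord I :=
  ⟨i :: l.1, List.isChain_cons.mpr ⟨fun j hj hij => h (by rw [hij]; exact hj), l.2⟩⟩

/-- The one-letter word `(i)`. -/
def single (i : I) : AltWord I := ⟨[i], List.isChain_singleton i⟩

end AltWord

variable {I : Type k} (M : I → PointedHilbertBimodule.{u, v} B)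

/-- `M°_{i₁} ⊗_B ⋯ ⊗_B M°_{iₙ}` (with `B` for the empty word). The recursion
`M°_{i₁} ⊗_B (⋯ ⊗_B (M°_{iₙ} ⊗_B B))` uses `M ⊗_B B = M`. -/
def wordModule : List I → HilbertBimodule.{u, max u v} B
  | [] => HilbertBimodule.self.{u, v} B
  | i :: l => HilbertBimodule.tensor (M i).compl (wordModule l)

/-- The map `m ↦ (y ↦ m ⊗ y)` from `M°_i` and the space of a word `l` to that of `(i, l)`. -/
def wordCons (i : I) (l : List I) : (M i).compl.carrier →ₗ[ℂ] (wordModule M l).carrier →ₗ[ℂ]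
    (wordModule M (i :: l)).carrier :=
  HilbertBimodule.tmul (M i).compl (wordModule M l)

/-- The reduced free product `M = B ξ ⊕ ⨁ M°_{i₁} ⊗_B ⋯ ⊗_B M°_{iₙ}`. -/
abbrev freeProduct : HilbertBimodule.{u, max k u v} B :=
  HilbertBimodule.directSum fun l : AltWord I => wordModule M l.1

/-- The inclusion of the space of a word in the reduced free product. -/
def wordIncl (l : AltWord I) : (wordModule M l.1).carrier →ₗ[ℂ] (freeProduct M).carrier :=
  HilbertBimodule.incl (fun l : AltWord I => wordModule M l.1) l

/-- The vector `ξ` of the reduced free product. -/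
def freeVac : (freeProduct M).carrier :=
  wordIncl M AltWord.nil (ULift.up (1 : B) : (HilbertBimodule.self.{u, v} B).carrier)

/-- The projection `P_J`, the sum of the orthogonal projections onto the summands
`M°_{i₁} ⊗_B ⋯ ⊗_B M°_{iₙ}` with `(i₁, …, iₙ) ∈ J`. -/
def wordProj (J : Set (AltWord I)) : (freeProduct M).carrier →L[ℂ] (freeProduct M).carrier :=
  HilbertBimodule.cut (fun l : AltWord I => wordModule M l.1) J

/-- The words that do not start with `i`. -/
abbrev CoWord (i : I) : Type k := {l : AltWord I // l.NotStart i}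

/-- The map `m ↦ (x ↦ m ⊗ x)` from `M°_i` and a summand of `M(i)` to the reduced free product. -/
def wordConsIncl (i : I) (l : CoWord i) : (M i).compl.carrier →ₗ[ℂ]
    (wordModule M l.1.1).carrier →ₗ[ℂ] (freeProduct M).carrier :=
  (wordCons M i l.1.1).compr₂ (wordIncl M (AltWord.cons i l.1 l.2))

/-- The bimodule `M(i)`, the sum over the words that do not start with `i`. -/
abbrev coModule (i : I) : HilbertBimodule.{u, max k u v} B :=
  HilbertBimodule.directSum fun l : CoWord i => wordModule M l.1.1

/-- The map `x ↦ V_i (m ⊗ x)` on a summand of `M(i)`: with `m = b ξ_i + m°`,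
`x ↦ b x + m° ⊗ x`. -/
def unitaryWord (i : I) (m : (M i).carrier) (l : CoWord i) :
    (wordModule M l.1.1).carrier →ₗ[ℂ] (freeProduct M).carrier :=
  wordIncl M l.1 ∘ₗ (wordModule M l.1.1).left ((M i).form (M i).vac m) +
    wordConsIncl M i l ((M i).toCompl m)

/-- The map `x ↦ V_i (m ⊗ x)` on the algebraic direct sum. -/
def unitaryPre (i : I) (m : (M i).carrier) :
    (HilbertBimodule.directSumPre fun l : CoWord i => wordModule M l.1.1).carrier →ₗ[ℂ]
      (freeProduct M).carrier :=
  HilbertBimodule.descPre _ (unitaryWord M i m)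

end

section

variable {B : Type u} [CStarAlgebra B] [PartialOrder B] [StarOrderedRing B]
variable {I : Type k} (M : I → PointedHilbertBimodule.{u, v} B)

/-- The elementary tensor `x ⊗ y` in the algebraic tensor product. -/
def HilbertBimodule.tmulPre (E : HilbertBimodule.{u, v} B) (F : HilbertBimodule.{u, v'} B)
    (x : E.carrier) (y : F.carrier) : (tensorPre E F).carrier :=
  (x ⊗ₜ[ℂ] y : E.carrier ⊗[ℂ] F.carrier)

@[elab_as_elim]
theorem HilbertBimodule.tensorPre_induction {E : HilbertBimodule.{u, v} B}
    {F : HilbertBimodule.{u, v'} B} {p : (tensorPre E F).carrier → Prop}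
    (t : (tensorPre E F).carrier) (h0 : p 0)
    (ht : ∀ x y, p (tmulPre E F x y))
    (ha : ∀ s t, p s → p t → p (s + t)) : p t :=
  TensorProduct.induction_on t h0 ht ha

theorem HilbertBimodule.tensor_form_ext (E : HilbertBimodule.{u, v} B)
    (F : HilbertBimodule.{u, v'} B) {H : HilbertBimodule.{u, w} B}
    (f : (tensorPre E F).carrier →ₗ[ℂ] H.carrier)
    (hf : ∀ (x x' : E.carrier) (y y' : F.carrier),
      H.form (f (tmulPre E F x y)) (f (tmulPre E F x' y'))
        = F.form y (F.left (E.form x x') y'))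
    (s t : (tensorPre E F).carrier) : H.form (f s) (f t) = (tensorPre E F).form s t := by
  induction s using HilbertBimodule.tensorPre_induction with
  | h0 => rw [map_zero, PreHilbertBimodule.form_zero_left, PreHilbertBimodule.form_zero_left]
  | ha s s' hs hs' => rw [map_add, PreHilbertBimodule.form_add_left, hs, hs',
      PreHilbertBimodule.form_add_left]
  | ht x y =>
    induction t using HilbertBimodule.tensorPre_induction with
    | h0 => rw [map_zero, PreHilbertBimodule.form_zero_right, PreHilbertBimodule.form_zero_right]
    | ha s s' hs hs' => rw [map_add, PreHilbertBimodule.form_add_right, hs, hs',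
        PreHilbertBimodule.form_add_right]
    | ht x' y' => exact hf x x' y y'

theorem HilbertBimodule.form_incl {κ : Type k} (F : κ → HilbertBimodule.{u, v} B) (i : κ)
    (x y : (F i).carrier) : (directSum F).form (incl F i x) (incl F i y) = (F i).form x y :=
  ((directSumPre F).form_toCompletion _ _).trans (form_inclPre F i x y)

theorem HilbertBimodule.form_incl_of_ne {κ : Type k} (F : κ → HilbertBimodule.{u, v} B) {i j : κ}
    (h : i ≠ j) (x : (F i).carrier) (y : (F j).carrier) :
    (directSum F).form (incl F i x) (incl F j y) = 0 :=
  ((directSumPre F).form_toCompletion _ _).trans (form_inclPre_of_ne F h x y)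

theorem form_wordIncl (l : AltWord I) (x y : (wordModule M l.1).carrier) :
    (freeProduct M).form (wordIncl M l x) (wordIncl M l y) = (wordModule M l.1).form x y :=
  HilbertBimodule.form_incl (fun l : AltWord I => wordModule M l.1) l x y

theorem form_wordIncl_of_ne {l l' : AltWord I} (h : l ≠ l') (x : (wordModule M l.1).carrier)
    (y : (wordModule M l'.1).carrier) :
    (freeProduct M).form (wordIncl M l x) (wordIncl M l' y) = 0 :=
  HilbertBimodule.form_incl_of_ne (fun l : AltWord I => wordModule M l.1) h x y

theorem form_wordCons (i : I) (l : List I) (m m' : (M i).compl.carrier)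
    (x x' : (wordModule M l).carrier) :
    (wordModule M (i :: l)).form (wordCons M i l m x) (wordCons M i l m' x')
      = (wordModule M l).form x ((wordModule M l).left ((M i).compl.form m m') x') :=
  HilbertBimodule.form_tmul _ _ m m' x x'

theorem CoWord.ne_cons {i : I} (l l' : CoWord i) : l.1 ≠ AltWord.cons i l'.1 l'.2 := fun h =>
  l.2 (by rw [h]; rfl)

theorem CoWord.cons_ne_cons {i : I} {l l' : CoWord i} (h : l ≠ l') :
    AltWord.cons i l.1 l.2 ≠ AltWord.cons i l'.1 l'.2 := fun h' =>
  h (Subtype.ext (Subtype.ext (List.cons_injective (congrArg Subtype.val h'))))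

theorem form_wordConsIncl (i : I) (l : CoWord i) (m m' : (M i).compl.carrier)
    (x x' : (wordModule M l.1.1).carrier) :
    (freeProduct M).form (wordConsIncl M i l m x) (wordConsIncl M i l m' x')
      = (wordModule M l.1.1).form x ((wordModule M l.1.1).left ((M i).compl.form m m') x') :=
  (form_wordIncl M (AltWord.cons i l.1 l.2) _ _).trans (form_wordCons M i l.1.1 m m' x x')

theorem form_wordConsIncl_of_ne (i : I) {l l' : CoWord i} (h : l ≠ l') (m m' : (M i).compl.carrier)
    (x : (wordModule M l.1.1).carrier) (x' : (wordModule M l'.1.1).carrier) :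
    (freeProduct M).form (wordConsIncl M i l m x) (wordConsIncl M i l' m' x') = 0 :=
  form_wordIncl_of_ne M (CoWord.cons_ne_cons h) _ _

theorem form_wordIncl_wordConsIncl (i : I) (l l' : CoWord i) (m' : (M i).compl.carrier)
    (x : (wordModule M l.1.1).carrier) (x' : (wordModule M l'.1.1).carrier) :
    (freeProduct M).form (wordIncl M l.1 x) (wordConsIncl M i l' m' x') = 0 :=
  form_wordIncl_of_ne M (CoWord.ne_cons l l') _ _

theorem form_wordConsIncl_wordIncl (i : I) (l l' : CoWord i) (m' : (M i).compl.carrier)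
    (x : (wordModule M l.1.1).carrier) (x' : (wordModule M l'.1.1).carrier) :
    (freeProduct M).form (wordConsIncl M i l' m' x') (wordIncl M l.1 x) = 0 :=
  form_wordIncl_of_ne M (CoWord.ne_cons l l').symm _ _

theorem form_unitaryWord (i : I) (m m' : (M i).carrier) (l : CoWord i)
    (x x' : (wordModule M l.1.1).carrier) :
    (freeProduct M).form (unitaryWord M i m l x) (unitaryWord M i m' l x')
      = (wordModule M l.1.1).form x ((wordModule M l.1.1).left ((M i).form m m') x') := by
  simp only [unitaryWord, LinearMap.add_apply, LinearMap.comp_apply,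
    PreHilbertBimodule.form_add_left, PreHilbertBimodule.form_add_right]
  rw [form_wordIncl, form_wordConsIncl, form_wordIncl_wordConsIncl, form_wordConsIncl_wordIncl,
    add_zero, zero_add, PreHilbertBimodule.form_left, ← Module.End.mul_apply, ← map_mul,
    (M i).form_eq m m', map_add, LinearMap.add_apply, PreHilbertBimodule.form_add_right]

theorem form_unitaryWord_of_ne (i : I) (m m' : (M i).carrier) {l l' : CoWord i} (h : l ≠ l')
    (x : (wordModule M l.1.1).carrier) (x' : (wordModule M l'.1.1).carrier) :
    (freeProduct M).form (unitaryWord M i m l x) (unitaryWord M i m' l' x') = 0 := by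
  simp only [unitaryWord, LinearMap.add_apply, LinearMap.comp_apply,
    PreHilbertBimodule.form_add_left, PreHilbertBimodule.form_add_right]
  rw [form_wordIncl_wordConsIncl, form_wordConsIncl_wordIncl, form_wordConsIncl_of_ne M i h,
    form_wordIncl_of_ne _ (fun h' => h (Subtype.ext h'))]
  simp

theorem directSumPre_left_inclPre {κ : Type k} (F : κ → HilbertBimodule.{u, v} B) (b : B) (i : κ)
    (x : (F i).carrier) : (HilbertBimodule.directSumPre F).left b (HilbertBimodule.inclPre F i x)
      = HilbertBimodule.inclPre F i ((F i).left b x) := by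
  classical
  exact DirectSum.lmap_lof (R := ℂ) (M := fun i => (F i).carrier) (N := fun i => (F i).carrier)
    (fun i => (F i).left b) i x

theorem form_unitaryPre (i : I) (m m' : (M i).carrier)
    (x x' : (HilbertBimodule.directSumPre fun l : CoWord i => wordModule M l.1.1).carrier) :
    (freeProduct M).form (unitaryPre M i m x) (unitaryPre M i m' x')
      = PreHilbertBimodule.form _ x (PreHilbertBimodule.left _ ((M i).form m m') x') := by
  induction x using HilbertBimodule.directSumPre_induction with
  | h0 => rw [map_zero, PreHilbertBimodule.form_zero_left, PreHilbertBimodule.form_zero_left]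
  | ha x y hx hy => rw [map_add, PreHilbertBimodule.form_add_left, hx, hy,
      PreHilbertBimodule.form_add_left]
  | hi l x =>
    induction x' using HilbertBimodule.directSumPre_induction with
    | h0 => simp only [map_zero, PreHilbertBimodule.form_zero_right]
    | ha x y hx hy => simp only [map_add, PreHilbertBimodule.form_add_right, hx, hy]
    | hi l' x' =>
      rw [unitaryPre, unitaryPre, HilbertBimodule.descPre_inclPre,
        HilbertBimodule.descPre_inclPre, directSumPre_left_inclPre]
      by_cases h : l = l'
      · subst h
        rw [form_unitaryWord, HilbertBimodule.form_inclPre]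
      · rw [form_unitaryWord_of_ne M i m m' h, HilbertBimodule.form_inclPre_of_ne _ h]

theorem norm_unitaryPre_le (i : I) (m : (M i).carrier)
    (x : (HilbertBimodule.directSumPre fun l : CoWord i => wordModule M l.1.1).carrier) :
    ‖unitaryPre M i m x‖ ≤ ‖m‖ * ‖x‖ := by
  refine le_of_sq_le_sq ?_ (by positivity)
  rw [PreHilbertBimodule.norm_sq, form_unitaryPre]
  calc _ ≤ ‖x‖ * (‖(M i).form m m‖ * ‖x‖) :=
        (PreHilbertBimodule.norm_form_le _ _ _).trans
          (by gcongr; exact PreHilbertBimodule.norm_left_le _ _ _)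
    _ = _ := by rw [← PreHilbertBimodule.norm_sq]; ring

/-- The map `x ↦ V_i (m ⊗ x)` on `M(i)`. -/
def unitaryVec (i : I) (m : (M i).carrier) : (coModule M i).carrier →L[ℂ] (freeProduct M).carrier :=
  PreHilbertBimodule.extend (unitaryPre M i m) ‖m‖ (norm_unitaryPre_le M i m)

theorem clm_ext_toCompletion {P : PreHilbertBimodule.{u, v} B} {H : HilbertBimodule.{u, v'} B}
    {f g : P.completion.carrier →L[ℂ] H.carrier}
    (h : ∀ x, f (P.toCompletion x) = g (P.toCompletion x)) : f = g :=
  DFunLike.coe_injective (P.denseRange_toCompletion.equalizer f.continuous g.continuous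
    (funext h))

theorem unitaryVec_toCompletion (i : I) (m : (M i).carrier) (x) :
    unitaryVec M i m (PreHilbertBimodule.toCompletion _ x) = unitaryPre M i m x :=
  PreHilbertBimodule.extend_toCompletion _ _ _ _

theorem unitaryWord_add (i : I) (m m' : (M i).carrier) (l : CoWord i) :
    unitaryWord M i (m + m') l = unitaryWord M i m l + unitaryWord M i m' l := by
  ext x
  simp only [unitaryWord, LinearMap.add_apply, LinearMap.comp_apply, map_add,
    PreHilbertBimodule.form_add_right]
  abel

theorem unitaryWord_smul (i : I) (c : ℂ) (m : (M i).carrier) (l : CoWord i) :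
    unitaryWord M i (c • m) l = c • unitaryWord M i m l := by
  ext x
  simp only [unitaryWord, LinearMap.add_apply, LinearMap.comp_apply, map_smul,
    PreHilbertBimodule.form_smul_right, LinearMap.smul_apply, smul_add]

theorem unitaryVec_add (i : I) (m m' : (M i).carrier) :
    unitaryVec M i (m + m') = unitaryVec M i m + unitaryVec M i m' := by
  refine clm_ext_toCompletion fun x => ?_
  rw [_root_.add_apply]
  simp only [unitaryVec_toCompletion]
  induction x using HilbertBimodule.directSumPre_induction with
  | h0 => simp only [map_zero, add_zero]
  | ha x y hx hy => simp only [map_add, hx, hy]; abel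
  | hi l x => simp only [unitaryPre, HilbertBimodule.descPre_inclPre, unitaryWord_add,
      LinearMap.add_apply]

theorem unitaryVec_smul (i : I) (c : ℂ) (m : (M i).carrier) :
    unitaryVec M i (c • m) = c • unitaryVec M i m := by
  refine clm_ext_toCompletion fun x => ?_
  rw [_root_.smul_apply]
  simp only [unitaryVec_toCompletion]
  induction x using HilbertBimodule.directSumPre_induction with
  | h0 => simp only [map_zero, smul_zero]
  | ha x y hx hy => simp only [map_add, hx, hy, smul_add]
  | hi l x => simp only [unitaryPre, HilbertBimodule.descPre_inclPre, unitaryWord_smul,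
      LinearMap.smul_apply]

theorem form_ext_toCompletion {P : PreHilbertBimodule.{u, v} B} {H : HilbertBimodule.{u, v'} B}
    (f g : P.completion.carrier →L[ℂ] H.carrier) (b : B)
    (h : ∀ x x', H.form (f (P.toCompletion x)) (g (P.toCompletion x')) = P.form x (P.left b x'))
    (x x' : P.completion.carrier) :
    H.form (f x) (g x') = P.completion.form x (P.completion.left b x') := by
  have hL : Continuous (P.completion.left b) := (P.completion.leftOp b).1.continuous
  have hd := P.denseRange_toCompletion
  have h1 : Continuous fun p : P.completion.carrier × P.completion.carrier =>
      H.form (f p.1) (g p.2) :=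
    H.continuous_form.comp ((f.continuous.comp continuous_fst).prodMk
      (g.continuous.comp continuous_snd))
  have h2 : Continuous fun p : P.completion.carrier × P.completion.carrier =>
      P.completion.form p.1 (P.completion.left b p.2) :=
    P.completion.continuous_form.comp (continuous_fst.prodMk (hL.comp continuous_snd))
  refine congrFun ((hd.prodMap hd).equalizer h1 h2 (funext ?_)) (x, x')
  rintro ⟨y, y'⟩
  simp only [Function.comp_apply, Prod.map_apply, h, PreHilbertBimodule.left_toCompletion,
    PreHilbertBimodule.form_toCompletion]

theorem form_unitaryVec (i : I) (m m' : (M i).carrier) (x x' : (coModule M i).carrier) :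
    (freeProduct M).form (unitaryVec M i m x) (unitaryVec M i m' x')
      = (coModule M i).form x ((coModule M i).left ((M i).form m m') x') := by
  refine form_ext_toCompletion (unitaryVec M i m) (unitaryVec M i m') ((M i).form m m')
    (fun y y' => ?_) x x'
  rw [unitaryVec_toCompletion, unitaryVec_toCompletion, form_unitaryPre]

/-- The map `V_i` on the algebraic tensor product `M_i ⊗ M(i)`. -/
def unitaryTensor (i : I) : (HilbertBimodule.tensorPre (M i).toHilbertBimodule
    (coModule M i)).carrier →ₗ[ℂ] (freeProduct M).carrier :=
  TensorProduct.lift (LinearMap.mk₂ ℂ (fun m x => unitaryVec M i m x)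
    (fun m m' x => by rw [unitaryVec_add, _root_.add_apply])
    (fun c m x => by rw [unitaryVec_smul, _root_.smul_apply])
    (fun m x x' => map_add _ _ _) (fun c m x => map_smul _ _ _))

theorem unitaryTensor_tmul (i : I) (m : (M i).carrier) (x : (coModule M i).carrier) :
    unitaryTensor M i (m ⊗ₜ[ℂ] x) = unitaryVec M i m x := rfl

theorem form_unitaryTensor (i : I) (s t) :
    (freeProduct M).form (unitaryTensor M i s) (unitaryTensor M i t)
      = PreHilbertBimodule.form _ s t := by
  refine HilbertBimodule.tensor_form_ext _ _ (unitaryTensor M i) (fun m m' x x' => ?_) s t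
  exact form_unitaryVec M i m m' x x'

theorem norm_unitaryTensor (i : I) (t) : ‖unitaryTensor M i t‖ = ‖t‖ := by
  rw [PreHilbertBimodule.norm_def, PreHilbertBimodule.norm_def, form_unitaryTensor]

/-- The operator `V_i : M_i ⊗_B M(i) → M`. -/
def unitaryCLM (i : I) : (HilbertBimodule.tensor (M i).toHilbertBimodule
    (coModule M i)).carrier →L[ℂ] (freeProduct M).carrier :=
  PreHilbertBimodule.extend (unitaryTensor M i) 1 fun t => by
    rw [one_mul, norm_unitaryTensor]

theorem unitaryCLM_toCompletion (i : I) (t) :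
    unitaryCLM M i (PreHilbertBimodule.toCompletion _ t) = unitaryTensor M i t :=
  PreHilbertBimodule.extend_toCompletion _ _ _ _

theorem norm_unitaryCLM (i : I) (t) : ‖unitaryCLM M i t‖ = ‖t‖ := by
  refine congrFun ((PreHilbertBimodule.denseRange_toCompletion
    (HilbertBimodule.tensorPre (M i).toHilbertBimodule (coModule M i))).equalizer
    (g := fun t => ‖unitaryCLM M i t‖) (h := fun t => ‖t‖) (by fun_prop) (by fun_prop)
    (funext fun t => ?_)) t
  simp only [Function.comp_apply, unitaryCLM_toCompletion, norm_unitaryTensor,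
    LinearIsometry.norm_map]

theorem unitaryCLM_tmul (i : I) (m : (M i).carrier) (l : CoWord i)
    (x : (wordModule M l.1.1).carrier) :
    unitaryCLM M i (HilbertBimodule.tmul (M i).toHilbertBimodule (coModule M i) m
      (HilbertBimodule.incl (fun l : CoWord i => wordModule M l.1.1) l x))
      = unitaryWord M i m l x := by
  refine (unitaryCLM_toCompletion M i _).trans ?_
  refine (unitaryTensor_tmul M i m _).trans ?_
  refine (unitaryVec_toCompletion M i m _).trans ?_
  exact HilbertBimodule.descPre_inclPre _ _ _ _

theorem toCompl_vac (N : PointedHilbertBimodule.{u, v} B) : N.toCompl N.vac = 0 := by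
  refine Subtype.ext ?_
  have h : N.form N.vac N.vac = 1 := by simpa using N.form_vac 1
  change N.vac - N.left (N.form N.vac N.vac) N.vac = 0
  rw [h, map_one, Module.End.one_apply, sub_self]

theorem toCompl_coe (N : PointedHilbertBimodule.{u, v} B) (m : N.complSubmodule) :
    N.toCompl m = m ∧ N.form N.vac m = 0 := by
  have h : N.form N.vac m = 0 := by simpa using m.2 1
  refine ⟨Subtype.ext ?_, h⟩
  change (m : N.carrier) - N.left (N.form N.vac m) N.vac = m
  rw [h, map_zero, LinearMap.zero_apply, sub_zero]

theorem unitaryWord_vac (i : I) (l : CoWord i) (x : (wordModule M l.1.1).carrier) :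
    unitaryWord M i (M i).vac l x = wordIncl M l.1 x := by
  have h : (M i).form (M i).vac (M i).vac = 1 := by simpa using (M i).form_vac 1
  simp only [unitaryWord, toCompl_vac, h, LinearMap.comp_apply, map_one,
    map_zero, Module.End.one_apply, add_zero]

theorem unitaryWord_compl (i : I) (m : (M i).complSubmodule) (l : CoWord i)
    (x : (wordModule M l.1.1).carrier) :
    unitaryWord M i m l x = wordConsIncl M i l m x := by
  obtain ⟨h1, h2⟩ := toCompl_coe (M i) m
  simp only [unitaryWord, h1, h2, LinearMap.add_apply, LinearMap.comp_apply, map_zero,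
    LinearMap.zero_apply, zero_add]

theorem continuous_wordIncl (l : AltWord I) : Continuous (wordIncl M l) :=
  AddMonoidHomClass.continuous_of_bound (wordIncl M l) 1 fun x => by
    rw [PreHilbertBimodule.norm_def, PreHilbertBimodule.norm_def, form_wordIncl, one_mul]

theorem wordIncl_mem_range (i : I) (l : AltWord I) (x : (wordModule M l.1).carrier) :
    wordIncl M l x ∈ (unitaryCLM M i).range := by
  have hclosed : IsClosed ((unitaryCLM M i).range : Set (freeProduct M).carrier) := by
    have hi : Isometry (unitaryCLM M i) :=
      AddMonoidHomClass.isometry_of_norm _ (norm_unitaryCLM M i)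
    exact hi.isUniformInducing.isComplete_range.isClosed
  obtain ⟨l, hl⟩ := l
  by_cases h : AltWord.NotStart i ⟨l, hl⟩
  · rw [← unitaryWord_vac M i ⟨⟨l, hl⟩, h⟩ x, ← unitaryCLM_tmul]
    exact ⟨_, rfl⟩
  · obtain ⟨l', rfl⟩ : ∃ l', l = i :: l' := by
      cases l with
      | nil => exact absurd (show AltWord.NotStart i ⟨[], hl⟩ by simp [AltWord.NotStart]) h
      | cons j l' =>
        refine ⟨l', ?_⟩
        by_contra hne
        exact h fun h' => hne (by simpa using h')
    have hl' := List.isChain_cons.mp hl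
    let L : CoWord i := ⟨⟨l', hl'.2⟩, fun h' => hl'.1 i h' rfl⟩
    have hd := PreHilbertBimodule.denseRange_toCompletion
      (HilbertBimodule.tensorPre (M i).compl (wordModule M l'))
    let f : (HilbertBimodule.tensor (M i).compl (wordModule M l')).carrier →ₗ[ℂ]
      (freeProduct M).carrier := wordIncl M ⟨i :: l', hl⟩
    have hf : Continuous f := continuous_wordIncl M ⟨i :: l', hl⟩
    refine hd.induction_on (p := fun x => f x ∈ (unitaryCLM M i).range) x
      (hclosed.preimage hf) fun t => ?_
    refine HilbertBimodule.tensorPre_induction t ?_ ?_ ?_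
    · rw [map_zero, map_zero]; exact zero_mem _
    · intro m y
      have := unitaryWord_compl M i m L y
      rw [← unitaryCLM_tmul] at this
      exact ⟨_, this⟩
    · intro s t hs ht
      rw [map_add, map_add]; exact add_mem hs ht

theorem surjective_unitaryCLM (i : I) : Function.Surjective (unitaryCLM M i) := by
  have hclosed : IsClosed ((unitaryCLM M i).range : Set (freeProduct M).carrier) := by
    have hi : Isometry (unitaryCLM M i) :=
      AddMonoidHomClass.isometry_of_norm _ (norm_unitaryCLM M i)
    exact hi.isUniformInducing.isComplete_range.isClosed
  intro y
  have hd := PreHilbertBimodule.denseRange_toCompletion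
    (HilbertBimodule.directSumPre fun l : AltWord I => wordModule M l.1)
  refine hd.induction_on (p := fun y => y ∈ (unitaryCLM M i).range) y hclosed fun t => ?_
  refine HilbertBimodule.directSumPre_induction _ t ?_ ?_ ?_
  · rw [map_zero]; exact zero_mem _
  · intro l x
    exact wordIncl_mem_range M i l x
  · intro s t hs ht
    rw [map_add]; exact add_mem hs ht

theorem injective_unitaryCLM (i : I) : Function.Injective (unitaryCLM M i) := by
  rw [injective_iff_map_eq_zero]
  intro x hx
  have h := norm_unitaryCLM M i x
  refine HilbertBimodule.eq_zero_of_form_self _ x ?_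
  rw [← norm_eq_zero, ← PreHilbertBimodule.norm_sq, ← h, hx, norm_zero]
  simp

/-- The unitary operator `V_i : M_i ⊗_B M(i) → M`. -/
def unitary (i : I) : (HilbertBimodule.tensor (M i).toHilbertBimodule
    (coModule M i)).carrier ≃ₗᵢ[ℂ] (freeProduct M).carrier where
  toLinearEquiv := LinearEquiv.ofBijective (unitaryCLM M i).toLinearMap
    ⟨injective_unitaryCLM M i,
      surjective_unitaryCLM M i⟩
  norm_map' := norm_unitaryCLM M i

/-- The embedding `λ_i(a) = V_i (a ⊗ 1) V_i⁻¹` of `L(M_i)` in the operators on `M`. -/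
def freeEmbed (i : I) (a : (M i).adjointable) :
    (freeProduct M).carrier →L[ℂ] (freeProduct M).carrier :=
  (unitary M i).toContinuousLinearEquiv.toContinuousLinearMap ∘L
    HilbertBimodule.tensorOp (M i).toHilbertBimodule (coModule M i) a ∘L
      (unitary M i).symm.toContinuousLinearEquiv.toContinuousLinearMap

end

section

/-! ### Operator-valued probability spaces and `J`-independence -/

/-- A `B`-valued probability space: a unital algebra `A` with a unital homomorphism `b ↦ b 1_A`
from `B`, which makes `A` a `B`-`B`-bimodule, and a conditional expectation `E : A → B`. -/
structure BProbSpace (B : Type u) (A : Type uA) [Ring B] [Algebra ℂ B] [Ring A] [Algebra ℂ A] where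
  /-- the map `b ↦ b 1_A` -/
  incl : B →ₐ[ℂ] A
  /-- the conditional expectation -/
  E : A →ₗ[ℂ] B
  E_bimodule : ∀ b₁ a b₂, E (incl b₁ * a * incl b₂) = b₁ * E a * b₂
  E_incl : ∀ b, E (incl b) = b

/-- A (not necessarily unital) subalgebra that is also a `B`-`B`-subbimodule. -/
structure BimoduleSubalgebra {B : Type u} {A : Type uA} [Ring B] [Algebra ℂ B] [Ring A]
    [Algebra ℂ A] (P : BProbSpace B A) extends NonUnitalSubalgebra ℂ A where
  incl_mul_mem : ∀ b a, a ∈ carrier → P.incl b * a ∈ carrier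
  mul_incl_mem : ∀ a b, a ∈ carrier → a * P.incl b ∈ carrier

section Matrix

variable {B : Type u} [CStarAlgebra B] {A : Type uA} [Ring A] [Algebra ℂ A]

/-- The `B ⊗ M_n(ℂ)`-valued probability space `(A ⊗ M_n(ℂ), E ⊗ I_n)`. -/
def BProbSpace.matrix (P : BProbSpace B A) (n : ℕ) :
    BProbSpace (CStarMatrix (Fin n) (Fin n) B) (Matrix (Fin n) (Fin n) A) where
  incl := AlgHom.ofLinearMap
    { toFun := fun b => Matrix.of fun i j => P.incl (b i j)
      map_add' := fun b b' => by ext i j; exact map_add P.incl _ _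
      map_smul' := fun c b => by ext i j; exact map_smul P.incl _ _ }
    (by
      ext i j
      change P.incl ((1 : Matrix (Fin n) (Fin n) B) i j) = (1 : Matrix (Fin n) (Fin n) A) i j
      by_cases h : i = j
      · subst h; rw [Matrix.one_apply_eq, Matrix.one_apply_eq, map_one]
      · rw [Matrix.one_apply_ne h, Matrix.one_apply_ne h, map_zero])
    (fun b b' => by
      ext i j
      rw [Matrix.mul_apply]
      change P.incl ((b * b') i j) = _
      rw [CStarMatrix.mul_apply, map_sum]
      exact Finset.sum_congr rfl fun k _ => map_mul P.incl _ _)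
  E :=
    { toFun := fun a => CStarMatrix.ofMatrix fun i j => P.E (a i j)
      map_add' := fun a a' => by ext i j; exact map_add P.E _ _
      map_smul' := fun c a => by ext i j; exact map_smul P.E _ _ }
  E_bimodule b₁ a b₂ := by
    ext i j
    rw [CStarMatrix.mul_apply]
    simp only [CStarMatrix.mul_apply, Finset.sum_mul]
    change P.E ((Matrix.of (fun i j => P.incl (b₁ i j)) * a
      * Matrix.of (fun i j => P.incl (b₂ i j))) i j) = _
    rw [Matrix.mul_apply]
    simp only [Matrix.mul_apply, Finset.sum_mul, map_sum, Matrix.of_apply, P.E_bimodule]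
    rfl
  E_incl b := by
    ext i j
    exact P.E_incl (b i j)

/-- `A_i ⊗ M_n(ℂ)`, the matrices with entries in `A_i`. -/
def BimoduleSubalgebra.matrix {P : BProbSpace B A} (S : BimoduleSubalgebra P) (n : ℕ) :
    BimoduleSubalgebra (P.matrix n) where
  carrier := {a | ∀ i j, a i j ∈ S.carrier}
  zero_mem' := fun i j => S.zero_mem'
  add_mem' := fun ha ha' i j => S.add_mem' (ha i j) (ha' i j)
  smul_mem' := fun c a ha i j => S.smul_mem' c (ha i j)
  mul_mem' := fun {a a'} ha ha' i j => by
    rw [Matrix.mul_apply]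
    exact sum_mem (S := S.toNonUnitalSubalgebra) fun k _ => S.mul_mem' (ha i k) (ha' k j)
  incl_mul_mem b a ha i j := by
    rw [Matrix.mul_apply]
    exact sum_mem (S := S.toNonUnitalSubalgebra) fun k _ => S.incl_mul_mem _ _ (ha k j)
  mul_incl_mem a b ha i j := by
    rw [Matrix.mul_apply]
    exact sum_mem (S := S.toNonUnitalSubalgebra) fun k _ => S.mul_incl_mem _ _ (ha i k)

end Matrix

section Independence

variable {B : Type u} [CStarAlgebra B] [PartialOrder B] [StarOrderedRing B] {I : Type k}
  {A : Type uA} [Ring A] [Algebra ℂ A]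

/-- The family `J` is `I`-compatible: for words `w` that do not start with `i`,
`w ∈ J_i` if and only if `(i, w) ∈ J_i`. -/
def Compatible (J : I → Set (AltWord I)) : Prop :=
  ∀ (i : I) (l : AltWord I) (h : l.NotStart i), l ∈ J i ↔ AltWord.cons i l h ∈ J i

/-- The product `b a` in a bimodule subalgebra. -/
def BimoduleSubalgebra.lmul {P : BProbSpace B A} (S : BimoduleSubalgebra P) (b : B)
    (a : S.toNonUnitalSubalgebra) : S.toNonUnitalSubalgebra :=
  ⟨P.incl b * a, S.incl_mul_mem b a a.2⟩

/-- The product `a b` in a bimodule subalgebra. -/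
def BimoduleSubalgebra.rmul {P : BProbSpace B A} (S : BimoduleSubalgebra P)
    (a : S.toNonUnitalSubalgebra) (b : B) : S.toNonUnitalSubalgebra :=
  ⟨a * P.incl b, S.mul_incl_mem a b a.2⟩

/-- The product `a₁ ⋯ a_m` in `A` of a list of elements `a_k ∈ A_{i_k}`. -/
def wordProd {P : BProbSpace B A} (S : I → BimoduleSubalgebra P)
    (l : List (Σ i, (S i).toNonUnitalSubalgebra)) : A :=
  (l.map fun p => (p.2 : A)).prod

/-- The family `S` is `B`-valued `J`-independent: there are Hilbert bimodules `(M_i, ξ_i)` with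
specified vectors and `B`-linear homomorphisms `γ_i : A_i → L(M_i)` such that
`E(a₁ ⋯ a_m) = ⟨ξ, P_{J_{i₁}} λ_{i₁}(γ_{i₁}(a₁)) ⋯ P_{J_{i_m}} λ_{i_m}(γ_{i_m}(a_m)) ξ⟩`
on their reduced free product, for all `a_k ∈ A_{i_k}`. -/
def JIndependent (P : BProbSpace B A) (J : I → Set (AltWord I)) (S : I → BimoduleSubalgebra P) :
    Prop :=
  ∃ (M : I → PointedHilbertBimodule.{u, w} B)
    (γ : ∀ i, (S i).toNonUnitalSubalgebra →ₙₐ[ℂ] (M i).adjointable),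
    (∀ i b a, γ i ((S i).lmul b a) = (M i).leftOp b * γ i a ∧
      γ i ((S i).rmul a b) = γ i a * (M i).leftOp b) ∧
    ∀ l : List (Σ i, (S i).toNonUnitalSubalgebra),
      P.E (wordProd S l) = (freeProduct M).form (freeVac M)
        ((l.map fun p => wordProj M (J p.1) * freeEmbed M p.1 (γ p.1 p.2)).prod (freeVac M))

/-- Free independence: `E(a₁ ⋯ a_n) = 0` for `a_k ∈ A_{i_k}` with `i₁ ≠ i₂ ≠ ⋯ ≠ i_n` and
`E(a_k) = 0`, where `n ≥ 1`. -/
def FreelyIndependent (P : BProbSpace B A) (S : I → BimoduleSubalgebra P) : Prop :=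
  ∀ l : List (Σ i, (S i).toNonUnitalSubalgebra), l ≠ [] → (l.map Sigma.fst).IsChain (· ≠ ·) →
    (∀ p ∈ l, P.E (p.2 : A) = 0) → P.E (wordProd S l) = 0

/-- Boolean independence: `E(a₁ ⋯ a_n) = E(a₁) ⋯ E(a_n)` for `a_k ∈ A_{i_k}` with
`i₁ ≠ i₂ ≠ ⋯ ≠ i_n`. -/
def BooleanIndependent (P : BProbSpace B A) (S : I → BimoduleSubalgebra P) : Prop :=
  ∀ l : List (Σ i, (S i).toNonUnitalSubalgebra), (l.map Sigma.fst).IsChain (· ≠ ·) →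
    P.E (wordProd S l) = (l.map fun p => P.E (p.2 : A)).prod

/-- Monotone independence: `E(a₁ ⋯ a_k ⋯ a_n) = E(a₁ ⋯ E(a_k) ⋯ a_n)` for `a_j ∈ A_{i_j}` with
`i_k > i_{k-1}` (if `k > 1`) and `i_k > i_{k+1}` (if `k < n`). -/
def MonotoneIndependent [LT I] (P : BProbSpace B A) (S : I → BimoduleSubalgebra P) : Prop :=
  ∀ (l₁ l₂ : List (Σ i, (S i).toNonUnitalSubalgebra)) (i : I) (a : (S i).toNonUnitalSubalgebra),
    (∀ p ∈ l₁.getLast?, p.1 < i) → (∀ p ∈ l₂.head?, p.1 < i) →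
      P.E (wordProd S l₁ * a * wordProd S l₂)
        = P.E (wordProd S l₁ * P.incl (P.E a) * wordProd S l₂)

/-- The family `J_i = K(I)`. -/
def freeFamily (I : Type k) : I → Set (AltWord I) := fun _ => Set.univ

/-- The family `J_i = {∅, (i)}`. -/
def booleanFamily (I : Type k) : I → Set (AltWord I) := fun i => {AltWord.nil, AltWord.single i}

/-- The two-element family `J_1 = {∅, (1)}`, `J_2 = {∅, (1), (2), (2, 1)}`, where the indices
`1 < 2` are the elements `0 < 1` of `Fin 2`. -/
def monotoneFamily : Fin 2 → Set (AltWord (Fin 2)) :=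
  ![{AltWord.nil, AltWord.single 0},
    {AltWord.nil, AltWord.single 0, AltWord.single 1,
      AltWord.cons 1 (AltWord.single 0) (by simp [AltWord.NotStart, AltWord.single])}]

end Independence

end

end JIndep

end

set_option linter.unusedSectionVars false

noncomputable section

namespace JIndep

section FreeProductOperators

variable {B : Type u} [CStarAlgebra B] [PartialOrder B] [StarOrderedRing B]
variable {I : Type k} (M : I → PointedHilbertBimodule.{u, v} B)

/-! ### Operators on the reduced free product -/

/-! Write `T_i(a) = P_{J_i} λ_i(γ_i(a))`. Under the unitary `V_i : M_i ⊗ M(i) → M` the operator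
`λ_i(a)` acts on the first leg only, and compatibility makes `P_{J_i}` act on the second leg only,
so the two commute (`freeEmbed_mul_wordProj`). Hence `T_i` is multiplicative (`letterOp_mul`). Both
`E[a_1 ⋯ a_m]` and the vacuum moment are unchanged when neighbouring letters from the same algebra
are multiplied, so by induction on the length only alternating words have to be compared
(`E_wordProd_eq_moment_of_alternating`).

The computations for the three families rest on one formula (`letterOp_wordIncl`): if `x` lies in
the summand of a word in `J_i` that does not start with `i`, then `T_i(a) x = ⟨ξ_i, γ_i(a) ξ_i⟩ x +
(γ_i(a) ξ_i)° ⊗ x`, a scalar part and a creation part. In the free case, centred letters only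
create, and the result is orthogonal to `ξ`. In the Boolean case, a letter kills what a neighbour of
another index created, and the scalar parts multiply. In the monotone case, between vectors in the
range of `P_{J_1}` the letter `T_2(a)` acts as its scalar part. One-letter words show that the
scalar part is `E[a]`, so `J`-independence implies the three classical notions.

Conversely, each classical rule computes all mixed moments from `E` on the single algebras, and the
vacuum moments obey the same rule as soon as every vector state `⟨ξ_i, γ_i(a) ξ_i⟩` equals `E[a]`.
Such a representation is the GNS bimodule of `(A, E)`, the completion of `A` for `⟨x, y⟩ = E[x⋆ y]`,
taken for every index; `E_star` and `norm_gnsMul_le` are what positivity of `E` on a C⋆-algebra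
contributes.

For matrices, take `M_n(M_i)` with the diagonal vector `ξ_i` and apply `γ_i` to the entries. The
matrix product `M_n(E) ⊗ M_n(F) → M_n(E ⊗ F)` preserves inner products, and on words it assembles to
an isometry `freeMat` from the free product of the `M_n(M_i)` into `M_n(M)`. It takes the vacuum to
the diagonal vacuum and intertwines `P_J` and `λ_i` with their entrywise versions. Moments are inner
products, so an isometry suffices, and each entry of a matrix moment is a sum of scalar moments. -/

theorem PreHilbertBimodule.continuousLinearMap_ext_toCompletion {P : PreHilbertBimodule.{u, v} B}
    {W : Type*} [TopologicalSpace W] [T2Space W] [AddCommGroup W] [Module ℂ W]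
    {f g : P.completion.carrier →L[ℂ] W}
    (h : ∀ x, f (P.toCompletion x) = g (P.toCompletion x)) : f = g :=
  DFunLike.coe_injective (P.denseRange_toCompletion.equalizer f.continuous g.continuous
    (funext h))

/-- Continuous linear maps on a Hilbert direct sum that agree on the summands are equal. -/
theorem HilbertBimodule.directSum_ext {κ : Type k} (F : κ → HilbertBimodule.{u, v} B)
    {W : Type*} [TopologicalSpace W] [T2Space W] [AddCommGroup W] [Module ℂ W]
    {f g : (HilbertBimodule.directSum F).carrier →L[ℂ] W}
    (h : ∀ i x, f (HilbertBimodule.incl F i x) = g (HilbertBimodule.incl F i x)) : f = g := by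
  refine PreHilbertBimodule.continuousLinearMap_ext_toCompletion fun x => ?_
  refine HilbertBimodule.directSumPre_induction F x ?_ h fun x y hx hy => ?_
  · simp only [map_zero]
  · simp only [map_add, hx, hy]

/-- Continuous linear maps on the reduced free product that agree on the summands are equal. -/
theorem freeProduct_ext {W : Type*} [TopologicalSpace W] [T2Space W] [AddCommGroup W] [Module ℂ W]
    {f g : (freeProduct M).carrier →L[ℂ] W}
    (h : ∀ l x, f (wordIncl M l x) = g (wordIncl M l x)) : f = g :=
  HilbertBimodule.directSum_ext (fun l : AltWord I => wordModule M l.1) h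

theorem tensor_ext (E : HilbertBimodule.{u, v} B) (F : HilbertBimodule.{u, v'} B)
    {W : Type*} [TopologicalSpace W] [T2Space W] [AddCommGroup W] [Module ℂ W]
    {f g : (HilbertBimodule.tensor E F).carrier →L[ℂ] W}
    (h : ∀ x y, f (HilbertBimodule.tmul E F x y) = g (HilbertBimodule.tmul E F x y)) : f = g := by
  refine PreHilbertBimodule.continuousLinearMap_ext_toCompletion fun t => ?_
  refine HilbertBimodule.tensorPre_induction t ?_ h fun x y hx hy => ?_
  · simp only [map_zero]
  · simp only [map_add, hx, hy]

theorem HilbertBimodule.norm_tmul_le (E : HilbertBimodule.{u, v} B) (F : HilbertBimodule.{u, v'} B)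
    (x : E.carrier) (y : F.carrier) : ‖HilbertBimodule.tmul E F x y‖ ≤ ‖x‖ * ‖y‖ := by
  refine le_of_sq_le_sq ?_ (by positivity)
  rw [PreHilbertBimodule.norm_sq, HilbertBimodule.form_tmul]
  calc _ ≤ ‖y‖ * (‖E.form x x‖ * ‖y‖) :=
        (PreHilbertBimodule.norm_form_le _ _ _).trans
          (by gcongr; exact PreHilbertBimodule.norm_left_le _ _ _)
    _ = _ := by rw [← PreHilbertBimodule.norm_sq]; ring

/-- Continuous linear maps on the reduced free product that agree on all `V_i (m ⊗ x)`, for a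
fixed `i`, are equal. -/
theorem freeProduct_ext_unitaryWord (i : I) {W : Type*} [TopologicalSpace W] [T2Space W]
    [AddCommGroup W] [Module ℂ W] {f g : (freeProduct M).carrier →L[ℂ] W}
    (h : ∀ m l x, f (unitaryWord M i m l x) = g (unitaryWord M i m l x)) : f = g := by
  have key : f ∘L unitaryCLM M i = g ∘L unitaryCLM M i := by
    refine tensor_ext _ _ fun m y => ?_
    -- For fixed `m` the map `y ↦ m ⊗ y` is bounded by `‖m‖`, so equality in the second leg needs
    -- checking only on the summands of `M(i)`.
    let c : (coModule M i).carrier →L[ℂ] (HilbertBimodule.tensor (M i).toHilbertBimodule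
        (coModule M i)).carrier :=
      (HilbertBimodule.tmul (M i).toHilbertBimodule (coModule M i) m).mkContinuous ‖m‖
        (HilbertBimodule.norm_tmul_le _ _ m)
    have : f ∘L unitaryCLM M i ∘L c = g ∘L unitaryCLM M i ∘L c := by
      refine HilbertBimodule.directSum_ext _ fun l x => ?_
      have := h m l x
      rwa [← unitaryCLM_tmul] at this
    exact DFunLike.congr_fun this y
  ext y
  obtain ⟨t, rfl⟩ := surjective_unitaryCLM M i y
  exact DFunLike.congr_fun key t

theorem freeEmbed_unitaryCLM (i : I) (a : (M i).adjointable) (t) :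
    freeEmbed M i a (unitaryCLM M i t)
      = unitaryCLM M i (HilbertBimodule.tensorOp (M i).toHilbertBimodule (coModule M i) a t) := by
  have h : (unitary M i).symm (unitaryCLM M i t) = t := (unitary M i).symm_apply_apply t
  change unitary M i (HilbertBimodule.tensorOp _ _ a ((unitary M i).symm (unitaryCLM M i t))) = _
  rw [h]
  rfl

/-- `V_i` carries `a ⊗ 1` to `λ_i(a)`, so only the `M_i`-leg changes. As continuous maps are
determined by their values on these vectors, the algebraic rules for `λ_i` are read off from this
formula. -/
theorem freeEmbed_unitaryWord (i : I) (a : (M i).adjointable) (m : (M i).carrier) (l : CoWord i)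
    (x : (wordModule M l.1.1).carrier) :
    freeEmbed M i a (unitaryWord M i m l x) = unitaryWord M i (a.1 m) l x := by
  rw [← unitaryCLM_tmul, freeEmbed_unitaryCLM, HilbertBimodule.tensorOp_tmul, unitaryCLM_tmul]

/-- The summand of a word not starting with `i` consists of the vectors `V_i (ξ_i ⊗ x)`; the
operator replaces `ξ_i` by `a ξ_i`. -/
theorem freeEmbed_wordIncl (i : I) (a : (M i).adjointable) (l : CoWord i)
    (x : (wordModule M l.1.1).carrier) :
    freeEmbed M i a (wordIncl M l.1 x) = unitaryWord M i (a.1 (M i).vac) l x := by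
  rw [← unitaryWord_vac M i, freeEmbed_unitaryWord]

theorem freeEmbed_mul (i : I) (a a' : (M i).adjointable) :
    freeEmbed M i (a * a') = freeEmbed M i a * freeEmbed M i a' := by
  refine freeProduct_ext_unitaryWord M i fun m l x => ?_
  rw [mul_apply_eq_comp]
  simp only [freeEmbed_unitaryWord]
  rfl

theorem freeEmbed_one (i : I) : freeEmbed M i 1 = 1 := by
  refine freeProduct_ext_unitaryWord M i fun m l x => ?_
  simp only [freeEmbed_unitaryWord]
  rfl

theorem freeEmbed_add (i : I) (a a' : (M i).adjointable) :
    freeEmbed M i (a + a') = freeEmbed M i a + freeEmbed M i a' := by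
  refine freeProduct_ext_unitaryWord M i fun m l x => ?_
  rw [_root_.add_apply]
  simp only [freeEmbed_unitaryWord]
  change unitaryWord M i (a.1 m + a'.1 m) l x = _
  rw [unitaryWord_add]
  rfl

/-! ### The left action of `B` on the reduced free product -/

theorem HilbertBimodule.left_incl {κ : Type k} (F : κ → HilbertBimodule.{u, v} B) (b : B) (i : κ)
    (x : (F i).carrier) : (HilbertBimodule.directSum F).left b (HilbertBimodule.incl F i x)
      = HilbertBimodule.incl F i ((F i).left b x) := by
  refine (PreHilbertBimodule.left_toCompletion _ b _).trans ?_
  exact congrArg _ (directSumPre_left_inclPre F b i x)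

theorem left_wordIncl (b : B) (l : AltWord I) (x : (wordModule M l.1).carrier) :
    (freeProduct M).left b (wordIncl M l x) = wordIncl M l ((wordModule M l.1).left b x) :=
  HilbertBimodule.left_incl (fun l : AltWord I => wordModule M l.1) b l x

theorem left_wordCons (b : B) (i : I) (l : List I) (m : (M i).compl.carrier)
    (x : (wordModule M l).carrier) : (wordModule M (i :: l)).left b (wordCons M i l m x)
      = wordCons M i l ((M i).compl.left b m) x :=
  PreHilbertBimodule.left_toCompletion (HilbertBimodule.tensorPre (M i).compl (wordModule M l)) b _

theorem left_wordConsIncl (b : B) (i : I) (l : CoWord i) (m : (M i).compl.carrier)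
    (x : (wordModule M l.1.1).carrier) : (freeProduct M).left b (wordConsIncl M i l m x)
      = wordConsIncl M i l ((M i).compl.left b m) x :=
  (left_wordIncl M b (AltWord.cons i l.1 l.2) _).trans
    (congrArg (wordIncl M (AltWord.cons i l.1 l.2)) (left_wordCons M b i l.1.1 m x))

theorem unitaryWord_apply (i : I) (m : (M i).carrier) (l : CoWord i)
    (x : (wordModule M l.1.1).carrier) : unitaryWord M i m l x
      = wordIncl M l.1 ((wordModule M l.1.1).left ((M i).form (M i).vac m) x)
        + wordConsIncl M i l ((M i).toCompl m) x := rfl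

theorem form_vac_left_right (N : PointedHilbertBimodule.{u, v} B) (b : B) (m : N.carrier) :
    N.form N.vac (N.left b m) = b * N.form N.vac m := by
  have := N.form_vac_left (star b) m
  rwa [N.form_left, star_star] at this

theorem toCompl_left (N : PointedHilbertBimodule.{u, v} B) (b : B) (m : N.carrier) :
    N.toCompl (N.left b m) = N.compl.left b (N.toCompl m) := by
  refine Subtype.ext ?_
  change N.left b m - N.left (N.form N.vac (N.left b m)) N.vac
    = N.left b (m - N.left (N.form N.vac m) N.vac)
  rw [form_vac_left_right, map_sub, map_mul]
  rfl

/-- Both `m ↦ ⟨ξ_i, m⟩` and the projection onto `M_i°` are left `B`-linear, hence so is `V_i`. -/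
theorem left_unitaryWord (i : I) (b : B) (m : (M i).carrier) (l : CoWord i)
    (x : (wordModule M l.1.1).carrier) :
    (freeProduct M).left b (unitaryWord M i m l x) = unitaryWord M i ((M i).left b m) l x := by
  rw [unitaryWord_apply, unitaryWord_apply, map_add, left_wordIncl, left_wordConsIncl,
    form_vac_left_right, map_mul, toCompl_left]
  rfl

/-- On `B` every `λ_i` gives the same operator, the left action on `M`. This lets elements of `B`
pass between letters of different indices. -/
theorem freeEmbed_leftOp (i : I) (b : B) :
    freeEmbed M i ((M i).leftOp b) = ((freeProduct M).leftOp b).1 := by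
  refine freeProduct_ext_unitaryWord M i fun m l x => ?_
  rw [freeEmbed_unitaryWord]
  exact (left_unitaryWord M i b m l x).symm

/-! ### The projections `P_J` on the summands -/

theorem HilbertBimodule.directSumPre_ext {κ : Type k} (F : κ → HilbertBimodule.{u, v} B)
    {x y : (HilbertBimodule.directSumPre F).carrier}
    (h : ∀ i, HilbertBimodule.coord F i x = HilbertBimodule.coord F i y) : x = y :=
  DFinsupp.ext h

theorem HilbertBimodule.cut_incl_of_mem {κ : Type k} (F : κ → HilbertBimodule.{u, v} B) {J : Set κ}
    {i : κ} (hi : i ∈ J) (x : (F i).carrier) :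
    HilbertBimodule.cut F J (HilbertBimodule.incl F i x) = HilbertBimodule.incl F i x := by
  classical
  refine (PreHilbertBimodule.extend_toCompletion _ _ _ _).trans ?_
  refine congrArg (HilbertBimodule.directSumPre F).toCompletion ?_
  refine HilbertBimodule.directSumPre_ext F fun j => ?_
  by_cases hj : j ∈ J
  · rw [HilbertBimodule.coord_cutPre_of_mem F hj]
  · rw [HilbertBimodule.coord_cutPre_of_notMem F hj,
      HilbertBimodule.inclPre_ne F (fun h : i = j => hj (h ▸ hi))]

theorem HilbertBimodule.cut_incl_of_notMem {κ : Type k} (F : κ → HilbertBimodule.{u, v} B)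
    {J : Set κ} {i : κ} (hi : i ∉ J) (x : (F i).carrier) :
    HilbertBimodule.cut F J (HilbertBimodule.incl F i x) = 0 := by
  classical
  refine (PreHilbertBimodule.extend_toCompletion _ _ _ _).trans ?_
  rw [← map_zero (HilbertBimodule.directSumPre F).toCompletion]
  refine congrArg (HilbertBimodule.directSumPre F).toCompletion ?_
  refine HilbertBimodule.directSumPre_ext F fun j => ?_
  rw [map_zero]
  by_cases hj : j ∈ J
  · rw [HilbertBimodule.coord_cutPre_of_mem F hj,
      HilbertBimodule.inclPre_ne F (fun h : i = j => hi (h ▸ hj))]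
  · rw [HilbertBimodule.coord_cutPre_of_notMem F hj]

variable {M} in
theorem wordProj_wordIncl_of_mem {J : Set (AltWord I)} {l : AltWord I} (hl : l ∈ J)
    (x : (wordModule M l.1).carrier) : wordProj M J (wordIncl M l x) = wordIncl M l x :=
  HilbertBimodule.cut_incl_of_mem (fun l : AltWord I => wordModule M l.1) hl x

variable {M} in
theorem wordProj_wordIncl_of_notMem {J : Set (AltWord I)} {l : AltWord I} (hl : l ∉ J)
    (x : (wordModule M l.1).carrier) : wordProj M J (wordIncl M l x) = 0 :=
  HilbertBimodule.cut_incl_of_notMem (fun l : AltWord I => wordModule M l.1) hl x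

variable {M} in
theorem wordProj_wordConsIncl_of_mem {J : Set (AltWord I)} {i : I} {l : CoWord i}
    (hl : AltWord.cons i l.1 l.2 ∈ J) (m : (M i).compl.carrier)
    (x : (wordModule M l.1.1).carrier) :
    wordProj M J (wordConsIncl M i l m x) = wordConsIncl M i l m x :=
  wordProj_wordIncl_of_mem hl _

variable {M} in
theorem wordProj_wordConsIncl_of_notMem {J : Set (AltWord I)} {i : I} {l : CoWord i}
    (hl : AltWord.cons i l.1 l.2 ∉ J) (m : (M i).compl.carrier)
    (x : (wordModule M l.1.1).carrier) :
    wordProj M J (wordConsIncl M i l m x) = 0 :=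
  wordProj_wordIncl_of_notMem hl _

theorem wordProj_univ : wordProj M Set.univ = 1 := by
  refine freeProduct_ext M fun l x => ?_
  rw [wordProj_wordIncl_of_mem (Set.mem_univ _)]
  rfl

theorem wordProj_mul_self (J : Set (AltWord I)) : wordProj M J * wordProj M J = wordProj M J := by
  refine freeProduct_ext M fun l x => ?_
  rw [mul_apply_eq_comp]
  by_cases hl : l ∈ J
  · simp only [wordProj_wordIncl_of_mem hl]
  · simp only [wordProj_wordIncl_of_notMem hl, map_zero]

theorem leftOp_mul_wordProj (b : B) (J : Set (AltWord I)) :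
    ((freeProduct M).leftOp b).1 * wordProj M J = wordProj M J * ((freeProduct M).leftOp b).1 := by
  refine freeProduct_ext M fun l x => ?_
  rw [mul_apply_eq_comp, mul_apply_eq_comp]
  change (freeProduct M).left b _ = wordProj M J ((freeProduct M).left b _)
  rw [left_wordIncl]
  by_cases hl : l ∈ J
  · rw [wordProj_wordIncl_of_mem hl, wordProj_wordIncl_of_mem hl, left_wordIncl]
  · rw [wordProj_wordIncl_of_notMem hl, wordProj_wordIncl_of_notMem hl, map_zero]

/-! ### Consequences of compatibility -/

section

variable {M} {J : I → Set (AltWord I)}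

/-- The vector `V_i (m ⊗ x)` has components only at `l` and at `(i, l)`, and compatibility puts both
words in `J_i` or neither. -/
theorem wordProj_unitaryWord_of_mem (hJ : Compatible J) {i : I} {l : CoWord i} (hl : l.1 ∈ J i)
    (m : (M i).carrier) (x : (wordModule M l.1.1).carrier) :
    wordProj M (J i) (unitaryWord M i m l x) = unitaryWord M i m l x := by
  rw [unitaryWord_apply, map_add, wordProj_wordIncl_of_mem hl,
    wordProj_wordConsIncl_of_mem ((hJ i l.1 l.2).mp hl)]

theorem wordProj_unitaryWord_of_notMem (hJ : Compatible J) {i : I} {l : CoWord i} (hl : l.1 ∉ J i)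
    (m : (M i).carrier) (x : (wordModule M l.1.1).carrier) :
    wordProj M (J i) (unitaryWord M i m l x) = 0 := by
  rw [unitaryWord_apply, map_add, wordProj_wordIncl_of_notMem hl,
    wordProj_wordConsIncl_of_notMem (fun h => hl ((hJ i l.1 l.2).mpr h)), add_zero]

/-- In the coordinates `M_i ⊗ M(i)` the projection is `1 ⊗ Q`, where `Q` cuts `M(i)` down to the
words in `J_i`, while `λ_i(a)` is `a ⊗ 1`. -/
theorem freeEmbed_mul_wordProj (hJ : Compatible J) (i : I) (a : (M i).adjointable) :
    freeEmbed M i a * wordProj M (J i) = wordProj M (J i) * freeEmbed M i a := by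
  refine freeProduct_ext_unitaryWord M i fun m l x => ?_
  rw [mul_apply_eq_comp, mul_apply_eq_comp, freeEmbed_unitaryWord]
  by_cases hl : l.1 ∈ J i
  · rw [wordProj_unitaryWord_of_mem hJ hl, wordProj_unitaryWord_of_mem hJ hl,
      freeEmbed_unitaryWord]
  · rw [wordProj_unitaryWord_of_notMem hJ hl, wordProj_unitaryWord_of_notMem hJ hl, map_zero]

/-- After commuting, the two projections merge into one. So `a ↦ P_{J_i} λ_i(a)` is multiplicative,
although in general it does not send `1` to the identity. -/
theorem wordProj_mul_freeEmbed_mul (hJ : Compatible J) (i : I) (a a' : (M i).adjointable) :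
    (wordProj M (J i) * freeEmbed M i a) * (wordProj M (J i) * freeEmbed M i a')
      = wordProj M (J i) * freeEmbed M i (a * a') := by
  rw [← freeEmbed_mul_wordProj hJ, mul_assoc, ← mul_assoc (wordProj M (J i)), wordProj_mul_self,
    ← mul_assoc, freeEmbed_mul_wordProj hJ, mul_assoc, freeEmbed_mul]

end

/-- The vector `b` in the summand `B` of the empty word. -/
def nilVec (b : B) : (wordModule M (AltWord.nil : AltWord I).1).carrier :=
  (ULift.up b : (HilbertBimodule.self.{u, v} B).carrier)

theorem freeVac_eq : freeVac M = wordIncl M AltWord.nil (nilVec M 1) := rfl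

theorem left_nilVec (b c : B) : (wordModule M (AltWord.nil : AltWord I).1).left b (nilVec M c)
    = nilVec M (b * c) := rfl

theorem form_nilVec (b c : B) : (wordModule M (AltWord.nil : AltWord I).1).form
    (nilVec M b) (nilVec M c) = star b * c := rfl

theorem form_nilVec_left (b : B) (x : (wordModule M (AltWord.nil : AltWord I).1).carrier) :
    (wordModule M (AltWord.nil : AltWord I).1).form (nilVec M 1)
      ((wordModule M (AltWord.nil : AltWord I).1).left b x)
      = b * (wordModule M (AltWord.nil : AltWord I).1).form (nilVec M 1) x := by
  obtain ⟨c, rfl⟩ : ∃ c, x = nilVec M c := ⟨x.down, rfl⟩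
  rw [left_nilVec, form_nilVec, form_nilVec, star_one, one_mul, one_mul]

theorem form_freeVac_wordIncl_nil (b : B) :
    (freeProduct M).form (freeVac M) (wordIncl M AltWord.nil (nilVec M b)) = b := by
  rw [freeVac_eq, form_wordIncl, form_nilVec, star_one, one_mul]

theorem form_freeVac_wordIncl_of_ne {l : AltWord I} (hl : l.1 ≠ [])
    (x : (wordModule M l.1).carrier) :
    (freeProduct M).form (freeVac M) (wordIncl M l x) = 0 :=
  form_wordIncl_of_ne M (fun h => hl (congrArg Subtype.val h).symm) _ _

/-- The linear functional `x ↦ ⟨y, x⟩`. -/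
def PreHilbertBimodule.formCLM (P : PreHilbertBimodule.{u, v} B) (y : P.carrier) :
    P.carrier →L[ℂ] B :=
  LinearMap.mkContinuous
    { toFun := P.form y
      map_add' := P.form_add_right y
      map_smul' := fun c x => P.form_smul_right y x c } ‖y‖ (P.norm_form_le y)

/-- The functional `⟨ξ, ·⟩` sees only the component at the empty word, a copy of `B` with `B` acting
by multiplication. -/
theorem form_freeVac_left (b : B) (x : (freeProduct M).carrier) :
    (freeProduct M).form (freeVac M) ((freeProduct M).left b x)
      = b * (freeProduct M).form (freeVac M) x := by
  have h : (freeProduct M).formCLM (freeVac M) ∘L ((freeProduct M).leftOp b).1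
      = ContinuousLinearMap.mul ℂ B b ∘L (freeProduct M).formCLM (freeVac M) := by
    refine freeProduct_ext M fun l x => ?_
    change (freeProduct M).form (freeVac M) ((freeProduct M).left b (wordIncl M l x))
      = b * (freeProduct M).form (freeVac M) (wordIncl M l x)
    rw [left_wordIncl]
    by_cases hl : l = AltWord.nil
    · subst hl
      rw [freeVac_eq, form_wordIncl, form_wordIncl, form_nilVec_left]
    · have hl' : l.1 ≠ [] := fun h => hl (Subtype.ext h)
      rw [form_freeVac_wordIncl_of_ne M hl', form_freeVac_wordIncl_of_ne M hl', mul_zero]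
  exact DFunLike.congr_fun h x

theorem form_freeVac_wordProj {J : Set (AltWord I)} (hJ : AltWord.nil ∈ J)
    (x : (freeProduct M).carrier) :
    (freeProduct M).form (freeVac M) (wordProj M J x) = (freeProduct M).form (freeVac M) x := by
  have h : (freeProduct M).formCLM (freeVac M) ∘L wordProj M J
      = (freeProduct M).formCLM (freeVac M) := by
    refine freeProduct_ext M fun l x => ?_
    change (freeProduct M).form (freeVac M) (wordProj M J (wordIncl M l x))
      = (freeProduct M).form (freeVac M) (wordIncl M l x)
    by_cases hl : l ∈ J
    · rw [wordProj_wordIncl_of_mem hl]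
    · rw [wordProj_wordIncl_of_notMem hl, PreHilbertBimodule.form_zero_right]
      refine (form_freeVac_wordIncl_of_ne M (fun h => hl ?_) x).symm
      rwa [show l = AltWord.nil from Subtype.ext h]
  exact DFunLike.congr_fun h x

end FreeProductOperators

section Moments

/-! ### Moments of words of operators -/

variable {B : Type u} [CStarAlgebra B] [PartialOrder B] [StarOrderedRing B] {I : Type k}
  {A : Type uA} [Ring A] [Algebra ℂ A] {P : BProbSpace B A} {S : I → BimoduleSubalgebra P}
  {M : I → PointedHilbertBimodule.{u, w} B}

/-- The homomorphisms `γ_i` are `B`-`B`-bilinear. -/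
def IsBimoduleHom (γ : ∀ i, (S i).toNonUnitalSubalgebra →ₙₐ[ℂ] (M i).adjointable) : Prop :=
  ∀ i b a, γ i ((S i).lmul b a) = (M i).leftOp b * γ i a ∧
    γ i ((S i).rmul a b) = γ i a * (M i).leftOp b

variable (J : I → Set (AltWord I))
  (γ : ∀ i, (S i).toNonUnitalSubalgebra →ₙₐ[ℂ] (M i).adjointable)

/-- The operator `P_{J_i} λ_i(γ_i(a))`. -/
def letterOp (p : Σ i, (S i).toNonUnitalSubalgebra) :
    (freeProduct M).carrier →L[ℂ] (freeProduct M).carrier :=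
  wordProj M (J p.1) * freeEmbed M p.1 (γ p.1 p.2)

/-- The product of the operators `P_{J_i} λ_i(γ_i(a))` of a list. -/
def wordOp (l : List (Σ i, (S i).toNonUnitalSubalgebra)) :
    (freeProduct M).carrier →L[ℂ] (freeProduct M).carrier :=
  (l.map (letterOp J γ)).prod

/-- The vacuum expectation of a product of operators `P_{J_i} λ_i(γ_i(a))`. -/
def moment (l : List (Σ i, (S i).toNonUnitalSubalgebra)) : B :=
  (freeProduct M).form (freeVac M) (wordOp J γ l (freeVac M))

/-- The vector state `⟨ξ_i, γ_i(a) ξ_i⟩`. -/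
def vacState (p : Σ i, (S i).toNonUnitalSubalgebra) : B :=
  (M p.1).form (M p.1).vac ((γ p.1 p.2).1 (M p.1).vac)

theorem jIndependent_iff : JIndependent.{u, w} P J S ↔
    ∃ (M : I → PointedHilbertBimodule.{u, w} B)
      (γ : ∀ i, (S i).toNonUnitalSubalgebra →ₙₐ[ℂ] (M i).adjointable),
      IsBimoduleHom γ ∧ ∀ l, P.E (wordProd S l) = moment J γ l := Iff.rfl

theorem wordOp_nil : wordOp J γ [] = 1 := rfl

theorem wordOp_cons (p : Σ i, (S i).toNonUnitalSubalgebra) (l) :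
    wordOp J γ (p :: l) = letterOp J γ p * wordOp J γ l := by
  rw [wordOp, List.map_cons, List.prod_cons]; rfl

theorem wordOp_append (l l' : List (Σ i, (S i).toNonUnitalSubalgebra)) :
    wordOp J γ (l ++ l') = wordOp J γ l * wordOp J γ l' := by
  rw [wordOp, List.map_append, List.prod_append]; rfl

theorem wordProd_nil : wordProd S [] = 1 := rfl

theorem wordProd_cons (p : Σ i, (S i).toNonUnitalSubalgebra) (l) :
    wordProd S (p :: l) = p.2 * wordProd S l := by
  rw [wordProd, List.map_cons, List.prod_cons]; rfl

theorem wordProd_append (l l' : List (Σ i, (S i).toNonUnitalSubalgebra)) :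
    wordProd S (l ++ l') = wordProd S l * wordProd S l' := by
  rw [wordProd, List.map_append, List.prod_append]; rfl

theorem wordProd_merge (l₁ l₂ : List (Σ i, (S i).toNonUnitalSubalgebra)) (i : I)
    (a a' : (S i).toNonUnitalSubalgebra) :
    wordProd S (l₁ ++ ⟨i, a⟩ :: ⟨i, a'⟩ :: l₂) = wordProd S (l₁ ++ ⟨i, a * a'⟩ :: l₂) := by
  simp only [wordProd_append, wordProd_cons, NonUnitalSubalgebra.coe_mul, mul_assoc]

variable {J γ}

theorem letterOp_mul (hJ : Compatible J) (i : I) (a a' : (S i).toNonUnitalSubalgebra) :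
    letterOp J γ ⟨i, a⟩ * letterOp J γ ⟨i, a'⟩ = letterOp J γ ⟨i, a * a'⟩ := by
  rw [letterOp, letterOp, wordProj_mul_freeEmbed_mul hJ, ← map_mul]; rfl

/-- The counterpart of `wordProd_merge`: products in `A` and vacuum moments obey the same merging
rule, which is why alternating words suffice. -/
theorem moment_merge (hJ : Compatible J) (l₁ l₂ : List (Σ i, (S i).toNonUnitalSubalgebra)) (i : I)
    (a a' : (S i).toNonUnitalSubalgebra) :
    moment J γ (l₁ ++ ⟨i, a⟩ :: ⟨i, a'⟩ :: l₂) = moment J γ (l₁ ++ ⟨i, a * a'⟩ :: l₂) := by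
  simp only [moment, wordOp_append, wordOp_cons, ← letterOp_mul hJ, mul_assoc]

theorem letterOp_add (i : I) (a a' : (S i).toNonUnitalSubalgebra) :
    letterOp J γ ⟨i, a + a'⟩ = letterOp J γ ⟨i, a⟩ + letterOp J γ ⟨i, a'⟩ := by
  rw [letterOp, map_add, freeEmbed_add, mul_add]; rfl

theorem letterOp_lmul (hγ : IsBimoduleHom γ) (i : I) (b : B) (a : (S i).toNonUnitalSubalgebra) :
    letterOp J γ ⟨i, (S i).lmul b a⟩ = ((freeProduct M).leftOp b).1 * letterOp J γ ⟨i, a⟩ := by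
  rw [letterOp, letterOp, (hγ i b a).1, freeEmbed_mul, freeEmbed_leftOp, ← mul_assoc,
    ← leftOp_mul_wordProj, mul_assoc]

theorem letterOp_rmul (hγ : IsBimoduleHom γ) (i : I) (b : B) (a : (S i).toNonUnitalSubalgebra) :
    letterOp J γ ⟨i, (S i).rmul a b⟩ = letterOp J γ ⟨i, a⟩ * ((freeProduct M).leftOp b).1 := by
  rw [letterOp, letterOp, (hγ i b a).2, freeEmbed_mul, freeEmbed_leftOp, mul_assoc]

theorem letterOp_eq (hJ : Compatible J) (p : Σ i, (S i).toNonUnitalSubalgebra) :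
    letterOp J γ p = freeEmbed M p.1 (γ p.1 p.2) * wordProj M (J p.1) :=
  (freeEmbed_mul_wordProj hJ p.1 _).symm

/-- The projection commutes with `λ_i`, so it may be applied first. -/
theorem letterOp_apply_of_wordProj_eq_zero (hJ : Compatible J)
    (p : Σ i, (S i).toNonUnitalSubalgebra) {x : (freeProduct M).carrier}
    (hx : wordProj M (J p.1) x = 0) : letterOp J γ p x = 0 := by
  rw [letterOp_eq hJ, mul_apply_eq_comp, hx, map_zero]

/-- The basic formula: a letter acts on such a vector as a scalar part, left multiplication by the
vector state, plus a creation part that puts the component of `γ_i(a) ξ_i` in `M_i°` in front.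
Compatibility ensures that the projection removes neither. -/
theorem letterOp_wordIncl (hJ : Compatible J) (p : Σ i, (S i).toNonUnitalSubalgebra)
    (l : CoWord p.1) (hl : l.1 ∈ J p.1) (x : (wordModule M l.1.1).carrier) :
    letterOp J γ p (wordIncl M l.1 x)
      = wordIncl M l.1 ((wordModule M l.1.1).left (vacState γ p) x)
        + wordConsIncl M p.1 l ((M p.1).toCompl ((γ p.1 p.2).1 (M p.1).vac)) x := by
  rw [letterOp, mul_apply_eq_comp, freeEmbed_wordIncl, wordProj_unitaryWord_of_mem hJ hl,
    unitaryWord_apply]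
  rfl

/-- The empty word, which does not start with `i`. -/
def CoWord.nil (i : I) : CoWord i := ⟨AltWord.nil, by simp [AltWord.NotStart, AltWord.nil]⟩

theorem letterOp_nilVec (hJ : Compatible J) (p : Σ i, (S i).toNonUnitalSubalgebra)
    (hp : AltWord.nil ∈ J p.1) (b : B) :
    letterOp J γ p (wordIncl M AltWord.nil (nilVec M b))
      = wordIncl M AltWord.nil (nilVec M (vacState γ p * b))
        + wordConsIncl M p.1 (CoWord.nil p.1)
          ((M p.1).toCompl ((γ p.1 p.2).1 (M p.1).vac)) (nilVec M b) :=
  letterOp_wordIncl hJ p (CoWord.nil p.1) hp (nilVec M b)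

theorem form_freeVac_wordConsIncl (i : I) (l : CoWord i) (m : (M i).compl.carrier)
    (x : (wordModule M l.1.1).carrier) :
    (freeProduct M).form (freeVac M) (wordConsIncl M i l m x) = 0 :=
  form_freeVac_wordIncl_of_ne M (l := AltWord.cons i l.1 l.2) (List.cons_ne_nil _ _) _

theorem form_freeVac_letterOp_nilVec (hJ : Compatible J) (p : Σ i, (S i).toNonUnitalSubalgebra)
    (hp : AltWord.nil ∈ J p.1) (b : B) :
    (freeProduct M).form (freeVac M) (letterOp J γ p (wordIncl M AltWord.nil (nilVec M b)))
      = vacState γ p * b := by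
  rw [letterOp_nilVec hJ p hp, PreHilbertBimodule.form_add_right, form_freeVac_wordIncl_nil]
  exact (congrArg (_ + ·) (form_freeVac_wordConsIncl p.1 (CoWord.nil p.1) _ (nilVec M b))).trans
    (add_zero _)

theorem moment_nil : moment J γ [] = 1 :=
  form_freeVac_wordIncl_nil M 1

theorem moment_singleton (hJ : Compatible J) (p : Σ i, (S i).toNonUnitalSubalgebra)
    (hp : AltWord.nil ∈ J p.1) : moment J γ [p] = vacState γ p := by
  rw [moment, wordOp_cons, wordOp_nil, mul_one, freeVac_eq M, ← freeVac_eq M]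
  exact (form_freeVac_letterOp_nilVec hJ p hp 1).trans (mul_one _)

/-- The moment formula for one-letter words already forces each vector state to be `E`, provided
that the empty word survives every projection. -/
theorem vacState_eq_of_moment (hJ : Compatible J) (hnil : ∀ i, AltWord.nil ∈ J i)
    (h : ∀ l, P.E (wordProd S l) = moment J γ l) (p : Σ i, (S i).toNonUnitalSubalgebra) :
    vacState γ p = P.E (p.2 : A) := by
  rw [← moment_singleton hJ p (hnil _), ← h, wordProd_cons, wordProd_nil, mul_one]

theorem E_incl_mul (P : BProbSpace B A) (b : B) (a : A) : P.E (P.incl b * a) = b * P.E a := by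
  simpa using P.E_bimodule b a 1

/-- Inserting an element of `B` in a moment. -/
theorem E_wordProd_insert (hγ : IsBimoduleHom γ)
    (l₁ l₂ : List (Σ i, (S i).toNonUnitalSubalgebra))
    (h : ∀ l : List (Σ i, (S i).toNonUnitalSubalgebra), l.length ≤ l₁.length + l₂.length →
      P.E (wordProd S l) = moment J γ l) (b : B) :
    P.E (wordProd S l₁ * P.incl b * wordProd S l₂)
      = (freeProduct M).form (freeVac M)
        (wordOp J γ l₁ ((freeProduct M).left b (wordOp J γ l₂ (freeVac M)))) := by
  -- An element of `B` in front of the word comes out by left linearity of `E` and of `⟨ξ, ·⟩`.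
  -- Elsewhere it is absorbed into the preceding letter, as `a b` is again in `A_i`; no unit in
  -- `A_i` is needed and the length stays at `l₁.length + l₂.length`.
  rcases List.eq_nil_or_concat l₁ with rfl | ⟨l, ⟨i, a⟩, rfl⟩
  · rw [wordProd_nil, one_mul, E_incl_mul, h l₂ (by simp)]
    exact (form_freeVac_left M b _).symm
  · have h1 : wordProd S (l ++ [⟨i, a⟩]) * P.incl b * wordProd S l₂
        = wordProd S (l ++ ⟨i, (S i).rmul a b⟩ :: l₂) := by
      simp only [wordProd_append, wordProd_cons, wordProd_nil, mul_one, mul_assoc,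
        BimoduleSubalgebra.rmul]
    rw [List.concat_eq_append, h1, h _ (by simp; omega), moment, wordOp_append, wordOp_cons,
      letterOp_rmul hγ, wordOp_append, wordOp_cons, wordOp_nil, mul_one]
    rfl

/-- To identify the moments it is enough to treat alternating words, assuming the result for
shorter words. -/
theorem E_wordProd_eq_moment_of_alternating (hJ : Compatible J)
    (h : ∀ l : List (Σ i, (S i).toNonUnitalSubalgebra), (l.map Sigma.fst).IsChain (· ≠ ·) →
      (∀ l' : List (Σ i, (S i).toNonUnitalSubalgebra), l'.length < l.length →
        P.E (wordProd S l') = moment J γ l') → P.E (wordProd S l) = moment J γ l)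
    (l : List (Σ i, (S i).toNonUnitalSubalgebra)) : P.E (wordProd S l) = moment J γ l := by
  induction hn : l.length using Nat.strong_induction_on generalizing l with
  | _ n ih =>
    subst hn
    by_cases hl : (l.map Sigma.fst).IsChain (· ≠ ·)
    · exact h l hl fun l' hl' => ih _ hl' l' rfl
    -- A word that is not alternating has two neighbours with the same index; multiplying them
    -- shortens it by one letter on both sides of the equation.
    · rw [List.isChain_map, List.isChain_iff_forall_rel_of_append_cons_cons] at hl
      push Not at hl
      obtain ⟨⟨i, a⟩, ⟨j, a'⟩, l₁, l₂, rfl, hij⟩ := hl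
      obtain rfl : i = j := hij
      rw [wordProd_merge, moment_merge hJ]
      exact ih _ (by simp) _ rfl

end Moments

section Free

/-! ### Free independence -/

variable {B : Type u} [CStarAlgebra B] [PartialOrder B] [StarOrderedRing B] {I : Type k}
  {A : Type uA} [Ring A] [Algebra ℂ A] {P : BProbSpace B A} {S : I → BimoduleSubalgebra P}
  {M : I → PointedHilbertBimodule.{u, w} B}
  {γ : ∀ i, (S i).toNonUnitalSubalgebra →ₙₐ[ℂ] (M i).adjointable}

theorem compatible_freeFamily (I : Type k) : Compatible (freeFamily I) :=
  fun _ _ _ => Iff.rfl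

/-- An alternating product of centered elements maps `ξ` into the summand of its word. -/
theorem exists_wordOp_eq_wordIncl (l : List (Σ i, (S i).toNonUnitalSubalgebra))
    (hl : (l.map Sigma.fst).IsChain (· ≠ ·)) (h0 : ∀ p ∈ l, vacState γ p = 0) :
    ∃ x, wordOp (freeFamily I) γ l (freeVac M) = wordIncl M ⟨l.map Sigma.fst, hl⟩ x := by
  induction l with
  | nil => exact ⟨nilVec M 1, rfl⟩
  | cons p l ih =>
    have hl' := List.isChain_cons.mp hl
    obtain ⟨x, hx⟩ := ih hl'.2 fun q hq => h0 q (List.mem_cons_of_mem _ hq)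
    let L : CoWord p.1 := ⟨⟨l.map Sigma.fst, hl'.2⟩, fun h => hl'.1 p.1 h rfl⟩
    have h1 := letterOp_wordIncl (γ := γ) (compatible_freeFamily I) p L (Set.mem_univ _) x
    -- The scalar part is zero for a centred letter, so only the creation part is left.
    rw [h0 p List.mem_cons_self, map_zero, LinearMap.zero_apply, map_zero, zero_add] at h1
    refine ⟨wordCons M p.1 (l.map Sigma.fst)
      ((M p.1).toCompl ((γ p.1 p.2).1 (M p.1).vac)) x, ?_⟩
    rw [wordOp_cons, mul_apply_eq_comp, hx]
    exact h1

/-- The product maps `ξ` into the summand of a nonempty word, which is orthogonal to `ξ`. -/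
theorem moment_freeFamily_eq_zero {l : List (Σ i, (S i).toNonUnitalSubalgebra)} (hne : l ≠ [])
    (hl : (l.map Sigma.fst).IsChain (· ≠ ·)) (h0 : ∀ p ∈ l, vacState γ p = 0) :
    moment (freeFamily I) γ l = 0 := by
  obtain ⟨x, hx⟩ := exists_wordOp_eq_wordIncl l hl h0
  rw [moment, hx]
  exact form_freeVac_wordIncl_of_ne M (l := ⟨l.map Sigma.fst, hl⟩) (by simpa using hne) x

theorem JIndependent.freelyIndependent (h : JIndependent.{u, w} P (freeFamily I) S) :
    FreelyIndependent P S := by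
  obtain ⟨M, γ, -, h⟩ := jIndependent_iff (freeFamily I) |>.mp h
  intro l hne hl h0
  rw [h]
  refine moment_freeFamily_eq_zero hne hl fun p hp => ?_
  rw [vacState_eq_of_moment (compatible_freeFamily I) (fun _ => Set.mem_univ _) h, h0 p hp]

theorem incl_mem (h1 : ∀ i, 1 ∈ (S i).carrier) (i : I) (b : B) :
    P.incl b ∈ (S i).toNonUnitalSubalgebra := by
  have := (S i).incl_mul_mem b 1 (h1 i)
  rwa [mul_one] at this

/-- For `J_i = K(I)` there is no projection, and `γ_i(1) = 1` together with bilinearity turns `b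
1_A` into the left action of `b`. This is what allows centring a letter inside a vacuum moment. -/
theorem letterOp_freeFamily_incl (hγ : IsBimoduleHom γ) (h1 : ∀ i, 1 ∈ (S i).carrier)
    (hγ1 : ∀ i, γ i ⟨1, h1 i⟩ = 1) (i : I) (b : B) :
    letterOp (freeFamily I) γ ⟨i, ⟨P.incl b, incl_mem h1 i b⟩⟩ = ((freeProduct M).leftOp b).1 := by
  have h : (⟨P.incl b, incl_mem h1 i b⟩ : (S i).toNonUnitalSubalgebra)
      = (S i).lmul b ⟨1, h1 i⟩ := Subtype.ext (mul_one _).symm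
  rw [h, letterOp_lmul hγ, letterOp, hγ1, freeEmbed_one, mul_one, freeFamily, wordProj_univ,
    mul_one]

/-- Centring one letter at a time, `a = (a - E[a]) + E[a]`, reduces every alternating moment to a
fully centred one, where both sides vanish, and to shorter words. The splitting is available on the
operator side as well because the unit of `A_i` is represented by the identity. -/
theorem FreelyIndependent.E_eq_moment (hS : FreelyIndependent P S) (hγ : IsBimoduleHom γ)
    (h1 : ∀ i, 1 ∈ (S i).carrier) (hγ1 : ∀ i, γ i ⟨1, h1 i⟩ = 1)
    (hE : ∀ p, vacState γ p = P.E (p.2 : A)) (l : List (Σ i, (S i).toNonUnitalSubalgebra)) :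
    P.E (wordProd S l) = moment (freeFamily I) γ l := by
  refine E_wordProd_eq_moment_of_alternating (compatible_freeFamily I) (fun l hl ih => ?_) l
  -- The prefix `l₁` collects the letters that are already centred and `l₂` those still to be
  -- treated; the induction on `l₂` runs inside the induction on the total length.
  suffices H : ∀ l₂ l₁ : List (Σ i, (S i).toNonUnitalSubalgebra),
      ((l₁ ++ l₂).map Sigma.fst).IsChain (· ≠ ·) → (∀ p ∈ l₁, P.E (p.2 : A) = 0) →
      (∀ l' : List (Σ i, (S i).toNonUnitalSubalgebra), l'.length < (l₁ ++ l₂).length →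
        P.E (wordProd S l') = moment (freeFamily I) γ l') →
      P.E (wordProd S (l₁ ++ l₂)) = moment (freeFamily I) γ (l₁ ++ l₂) from
    H l [] hl (by simp) ih
  intro l₂
  induction l₂ with
  | nil =>
    intro l₁ hl h0 _
    rw [List.append_nil] at hl ⊢
    rcases eq_or_ne l₁ [] with rfl | hne
    · rw [wordProd_nil, moment_nil, ← map_one P.incl, P.E_incl]
    · rw [hS l₁ hne hl h0, moment_freeFamily_eq_zero hne hl fun p hp => by rw [hE, h0 p hp]]
  | cons p l₂ ih' =>
    intro l₁ hl h0 ih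
    obtain ⟨i, a⟩ := p
    let c : (S i).toNonUnitalSubalgebra := ⟨P.incl (P.E a), incl_mem h1 i _⟩
    let q : Σ i, (S i).toNonUnitalSubalgebra := ⟨i, a - c⟩
    have hw : wordProd S (l₁ ++ ⟨i, a⟩ :: l₂) = wordProd S ((l₁ ++ [q]) ++ l₂)
        + wordProd S l₁ * P.incl (P.E a) * wordProd S l₂ := by
      simp only [wordProd_append, wordProd_cons, wordProd_nil, mul_one, q]
      have hc : ((a - c : (S i).toNonUnitalSubalgebra) : A) = a - P.incl (P.E a) := rfl
      rw [hc]
      noncomm_ring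
    have hm : moment (freeFamily I) γ (l₁ ++ ⟨i, a⟩ :: l₂)
        = moment (freeFamily I) γ ((l₁ ++ [q]) ++ l₂)
          + (freeProduct M).form (freeVac M) (wordOp (freeFamily I) γ l₁
            ((freeProduct M).left (P.E a) (wordOp (freeFamily I) γ l₂ (freeVac M)))) := by
      have hop : letterOp (freeFamily I) γ ⟨i, a⟩ = letterOp (freeFamily I) γ ⟨i, a - c⟩
          + ((freeProduct M).leftOp (P.E a)).1 := by
        rw [← letterOp_freeFamily_incl hγ h1 hγ1 i, ← letterOp_add, sub_add_cancel]
      simp only [moment, wordOp_append, wordOp_cons, wordOp_nil, mul_one, hop, q]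
      rw [← PreHilbertBimodule.form_add_right, add_mul, mul_add]
      rfl
    -- The first summand moves the centred letter into the prefix and keeps the indices, hence the
    -- alternation. The second has an element of `B` in place of the letter and falls under the
    -- length hypothesis.
    rw [hw, map_add, hm, ih' (l₁ ++ [q]) (by simpa using hl) ?_ (by simpa using ih),
      E_wordProd_insert hγ l₁ l₂ fun l' hl' => ih l' (by simp; omega)]
    intro p hp
    rcases List.mem_append.mp hp with hp | hp
    · exact h0 p hp
    · obtain rfl := List.mem_singleton.mp hp
      change P.E ((a : A) - P.incl (P.E a)) = 0
      rw [map_sub, P.E_incl, sub_self]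

end Free

section Boolean

/-! ### Boolean independence -/

variable {B : Type u} [CStarAlgebra B] [PartialOrder B] [StarOrderedRing B] {I : Type k}
  {A : Type uA} [Ring A] [Algebra ℂ A] {P : BProbSpace B A} {S : I → BimoduleSubalgebra P}
  {M : I → PointedHilbertBimodule.{u, w} B}
  {γ : ∀ i, (S i).toNonUnitalSubalgebra →ₙₐ[ℂ] (M i).adjointable}

theorem mem_booleanFamily {i : I} {l : AltWord I} :
    l ∈ booleanFamily I i ↔ l.1 = [] ∨ l.1 = [i] := by
  simp only [booleanFamily, Set.mem_insert_iff, Set.mem_singleton_iff, Subtype.ext_iff]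
  rfl

theorem compatible_booleanFamily (I : Type k) : Compatible (booleanFamily I) := by
  intro i l h
  rw [mem_booleanFamily, mem_booleanFamily]
  have h' : l.1 ≠ [i] := fun h' => h (by rw [h']; rfl)
  simp [AltWord.cons, h']

/-- Each letter but the leftmost contributes only its scalar part, because what it creates is killed
by the next letter to its left. The leftmost letter is left unevaluated: nothing stands before it to
remove its creation part, which disappears only after pairing with `ξ`. -/
theorem wordOp_booleanFamily (l : List (Σ i, (S i).toNonUnitalSubalgebra)) :
    ∀ p : Σ i, (S i).toNonUnitalSubalgebra, ((p :: l).map Sigma.fst).IsChain (· ≠ ·) →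
    wordOp (booleanFamily I) γ (p :: l) (freeVac M)
      = letterOp (booleanFamily I) γ p
        (wordIncl M AltWord.nil (nilVec M (l.map (vacState γ)).prod)) := by
  induction l with
  | nil => intro p _; rfl
  | cons q l ih =>
    intro p hp
    rw [List.map_cons, List.map_cons, List.isChain_cons_cons] at hp
    -- The vector created by `q` sits at the word `(q.1)`, which is neither empty nor `(p.1)`, since
    -- neighbouring indices differ.
    have hz : letterOp (booleanFamily I) γ p (wordConsIncl M q.1 (CoWord.nil q.1)
        ((M q.1).toCompl ((γ q.1 q.2).1 (M q.1).vac))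
        (nilVec M (l.map (vacState γ)).prod)) = 0 := by
      refine letterOp_apply_of_wordProj_eq_zero (compatible_booleanFamily I) p
        (wordProj_wordConsIncl_of_notMem ?_ _ _)
      rw [mem_booleanFamily]
      simpa [AltWord.cons, CoWord.nil, AltWord.nil] using hp.1.symm
    rw [wordOp_cons, mul_apply_eq_comp, ih q hp.2, letterOp_nilVec (compatible_booleanFamily I) q
      (mem_booleanFamily.mpr (Or.inl rfl)), map_add, hz, add_zero, List.map_cons, List.prod_cons]

theorem moment_booleanFamily {l : List (Σ i, (S i).toNonUnitalSubalgebra)}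
    (hl : (l.map Sigma.fst).IsChain (· ≠ ·)) :
    moment (booleanFamily I) γ l = (l.map (vacState γ)).prod := by
  cases l with
  | nil => exact moment_nil
  | cons p l =>
    rw [moment, wordOp_booleanFamily l p hl, form_freeVac_letterOp_nilVec
      (compatible_booleanFamily I) p (mem_booleanFamily.mpr (Or.inl rfl)), List.map_cons,
      List.prod_cons]

theorem JIndependent.booleanIndependent (h : JIndependent.{u, w} P (booleanFamily I) S) :
    BooleanIndependent P S := by
  obtain ⟨M, γ, -, h⟩ := jIndependent_iff (booleanFamily I) |>.mp h
  intro l hl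
  rw [h, moment_booleanFamily hl]
  congr 2
  funext p
  exact vacState_eq_of_moment (compatible_booleanFamily I)
    (fun _ => mem_booleanFamily.mpr (Or.inl rfl)) h p

theorem BooleanIndependent.E_eq_moment (hS : BooleanIndependent P S)
    (hE : ∀ p, vacState γ p = P.E (p.2 : A)) (l : List (Σ i, (S i).toNonUnitalSubalgebra)) :
    P.E (wordProd S l) = moment (booleanFamily I) γ l := by
  refine E_wordProd_eq_moment_of_alternating (compatible_booleanFamily I) (fun l hl _ => ?_) l
  rw [hS l hl, moment_booleanFamily hl]
  exact congrArg List.prod (List.map_congr_left fun p _ => (hE p).symm)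

end Boolean

section Monotone

/-! ### Monotone independence -/

variable {B : Type u} [CStarAlgebra B] [PartialOrder B] [StarOrderedRing B]
  {A : Type uA} [Ring A] [Algebra ℂ A] {P : BProbSpace B A} {S : Fin 2 → BimoduleSubalgebra P}
  {M : Fin 2 → PointedHilbertBimodule.{u, w} B}
  {γ : ∀ i, (S i).toNonUnitalSubalgebra →ₙₐ[ℂ] (M i).adjointable}

theorem mem_monotoneFamily_zero {l : AltWord (Fin 2)} :
    l ∈ monotoneFamily 0 ↔ l.1 = [] ∨ l.1 = [0] := by
  simp only [monotoneFamily, Matrix.cons_val_zero, Set.mem_insert_iff, Set.mem_singleton_iff,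
    Subtype.ext_iff]
  rfl

theorem mem_monotoneFamily_one {l : AltWord (Fin 2)} :
    l ∈ monotoneFamily 1 ↔ l.1 = [] ∨ l.1 = [0] ∨ l.1 = [1] ∨ l.1 = [1, 0] := by
  simp only [monotoneFamily, Matrix.cons_val_one, Matrix.cons_val_zero, Set.mem_insert_iff, Set.mem_singleton_iff,
    Subtype.ext_iff]
  rfl

theorem nil_mem_monotoneFamily (i : Fin 2) : AltWord.nil ∈ monotoneFamily i := by
  revert i
  rw [Fin.forall_fin_two]
  exact ⟨mem_monotoneFamily_zero.mpr (Or.inl rfl), mem_monotoneFamily_one.mpr (Or.inl rfl)⟩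

theorem compatible_monotoneFamily : Compatible monotoneFamily := by
  unfold Compatible
  rw [Fin.forall_fin_two]
  refine ⟨fun l h => ?_, fun l h => ?_⟩
  · rw [mem_monotoneFamily_zero, mem_monotoneFamily_zero]
    have h' : l.1 ≠ [0] := fun h' => h (by rw [h']; rfl)
    simp [AltWord.cons, h']
  · rw [mem_monotoneFamily_one, mem_monotoneFamily_one]
    have h1 : l.1 ≠ [1] := fun h' => h (by rw [h']; rfl)
    have h2 : l.1 ≠ [1, 0] := fun h' => h (by rw [h']; rfl)
    simp [AltWord.cons, h1, h2]

/-- Between vectors in the range of `P_{J_1}`, the operator `P_{J_2} λ_2(γ_2(a))` acts as the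
left multiplication by `⟨ξ_2, γ_2(a) ξ_2⟩`. -/
theorem wordProj_letterOp_wordProj (a : (S 1).toNonUnitalSubalgebra) :
    wordProj M (monotoneFamily 0) * letterOp monotoneFamily γ ⟨1, a⟩
        * wordProj M (monotoneFamily 0)
      = ((freeProduct M).leftOp (vacState γ ⟨1, a⟩)).1 * wordProj M (monotoneFamily 0) := by
  refine freeProduct_ext M fun l x => ?_
  simp only [mul_apply_eq_comp]
  by_cases hl : l ∈ monotoneFamily 0
  · have hl0 := mem_monotoneFamily_zero.mp hl
    -- The words `∅` and `(1)` of `J_1` do not start with `2` and lie in `J_2`, so the basic formula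
    -- applies. The indices `1` and `2` are `0` and `1` in `Fin 2`.
    let L : CoWord (1 : Fin 2) := ⟨l, by rcases hl0 with h | h <;> simp [AltWord.NotStart, h]⟩
    have hl1 : L.1 ∈ monotoneFamily 1 := mem_monotoneFamily_one.mpr (by tauto)
    -- The creation part lands at `(2)` or `(2, 1)`; no word of `J_1` starts with `2`, so the left
    -- projection leaves only the scalar part.
    have hc : AltWord.cons 1 L.1 L.2 ∉ monotoneFamily 0 := by
      rw [mem_monotoneFamily_zero]
      simp [AltWord.cons]
    have h1 := letterOp_wordIncl (γ := γ) compatible_monotoneFamily ⟨1, a⟩ L hl1 x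
    rw [wordProj_wordIncl_of_mem hl]
    refine (congrArg (wordProj M (monotoneFamily 0)) h1).trans ?_
    rw [map_add, wordProj_wordConsIncl_of_notMem hc, add_zero]
    exact (wordProj_wordIncl_of_mem hl _).trans (left_wordIncl M _ l x).symm
  · simp only [wordProj_wordIncl_of_notMem hl, map_zero]

/-- Either the word is empty and `ξ` itself is in the range of `P_{J_1}`, or its first letter has
the lower index and its operator begins with that projection. -/
theorem wordProj_wordOp_freeVac (l : List (Σ i, (S i).toNonUnitalSubalgebra))
    (hl : ∀ p ∈ l.head?, p.1 < 1) :
    wordProj M (monotoneFamily 0) (wordOp monotoneFamily γ l (freeVac M))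
      = wordOp monotoneFamily γ l (freeVac M) := by
  cases l with
  | nil => exact wordProj_wordIncl_of_mem (nil_mem_monotoneFamily 0) (nilVec M 1)
  | cons p l =>
    obtain ⟨i, a⟩ := p
    obtain rfl : i = 0 := Fin.lt_one_iff i |>.mp (hl ⟨i, a⟩ rfl)
    rw [wordOp_cons, letterOp, ← mul_apply_eq_comp, ← mul_assoc, ← mul_assoc, wordProj_mul_self]

/-- The mirror image on the left: an operator of lower index can also be written with `P_{J_1}` at
its right end, by commutation, and `⟨ξ, ·⟩` itself ignores the projection. -/
theorem form_freeVac_wordOp_wordProj (l : List (Σ i, (S i).toNonUnitalSubalgebra))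
    (hl : ∀ p ∈ l.getLast?, p.1 < 1) (x : (freeProduct M).carrier) :
    (freeProduct M).form (freeVac M)
        (wordOp monotoneFamily γ l (wordProj M (monotoneFamily 0) x))
      = (freeProduct M).form (freeVac M) (wordOp monotoneFamily γ l x) := by
  rcases List.eq_nil_or_concat l with rfl | ⟨l, ⟨i, a⟩, rfl⟩
  · exact form_freeVac_wordProj M (nil_mem_monotoneFamily 0) x
  · obtain rfl : i = 0 := Fin.lt_one_iff i |>.mp (hl ⟨i, a⟩ (by simp))
    rw [List.concat_eq_append, wordOp_append, wordOp_cons, wordOp_nil, mul_one,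
      letterOp_eq compatible_monotoneFamily, ← mul_apply_eq_comp, mul_assoc, mul_assoc,
      wordProj_mul_self]

/-- The neighbours of a local maximum supply a copy of `P_{J_1}` on either side of it, and between
these the letter is its scalar part. -/
theorem moment_monotoneFamily (l₁ l₂ : List (Σ i, (S i).toNonUnitalSubalgebra))
    (a : (S 1).toNonUnitalSubalgebra) (h₁ : ∀ p ∈ l₁.getLast?, p.1 < 1)
    (h₂ : ∀ p ∈ l₂.head?, p.1 < 1) :
    moment monotoneFamily γ (l₁ ++ ⟨1, a⟩ :: l₂)
      = (freeProduct M).form (freeVac M) (wordOp monotoneFamily γ l₁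
        ((freeProduct M).left (vacState γ ⟨1, a⟩)
          (wordOp monotoneFamily γ l₂ (freeVac M)))) := by
  have key := DFunLike.congr_fun (wordProj_letterOp_wordProj (γ := γ) a)
    (wordOp monotoneFamily γ l₂ (freeVac M))
  simp only [mul_apply_eq_comp, wordProj_wordOp_freeVac l₂ h₂] at key
  rw [moment, wordOp_append, wordOp_cons, mul_apply_eq_comp, mul_apply_eq_comp,
    ← form_freeVac_wordOp_wordProj l₁ h₁, key]
  rfl

theorem JIndependent.monotoneIndependent (h : JIndependent.{u, w} P monotoneFamily S) :
    MonotoneIndependent P S := by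
  obtain ⟨M, γ, hγ, h⟩ := jIndependent_iff monotoneFamily |>.mp h
  intro l₁ l₂ i a h₁ h₂
  have hw : wordProd S l₁ * a * wordProd S l₂ = wordProd S (l₁ ++ ⟨i, a⟩ :: l₂) := by
    rw [wordProd_append, wordProd_cons, mul_assoc]
  obtain rfl | rfl : i = 0 ∨ i = 1 := by omega
  -- No index is below the smaller one, so a local maximum at this index has no neighbours and the
  -- claim is `E[a] = E[E[a]]`.
  · obtain rfl : l₁ = [] := by
      rw [← List.getLast?_eq_none_iff, Option.eq_none_iff_forall_not_mem]
      exact fun p hp => absurd (h₁ p hp) (Fin.not_lt_zero _)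
    obtain rfl : l₂ = [] := by
      rw [← List.head?_eq_none_iff, Option.eq_none_iff_forall_not_mem]
      exact fun p hp => absurd (h₂ p hp) (Fin.not_lt_zero _)
    simp only [wordProd_nil, one_mul, mul_one, P.E_incl]
  · rw [hw, h, moment_monotoneFamily l₁ l₂ a h₁ h₂,
      E_wordProd_insert hγ l₁ l₂ fun l _ => h l,
      vacState_eq_of_moment compatible_monotoneFamily nil_mem_monotoneFamily h]

/-- In an alternating word a letter of the higher index is automatically a local maximum. Both sides
replace it by its expectation, which reduces to shorter words. -/
theorem MonotoneIndependent.E_eq_moment (hS : MonotoneIndependent P S) (hγ : IsBimoduleHom γ)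
    (hE : ∀ p, vacState γ p = P.E (p.2 : A)) (l : List (Σ i, (S i).toNonUnitalSubalgebra)) :
    P.E (wordProd S l) = moment monotoneFamily γ l := by
  refine E_wordProd_eq_moment_of_alternating compatible_monotoneFamily (fun l hl ih => ?_) l
  by_cases h1 : ∃ p ∈ l, p.1 = 1
  · obtain ⟨⟨i, a⟩, hp, hi⟩ := h1
    obtain rfl : i = 1 := hi
    obtain ⟨l₁, l₂, rfl⟩ := List.mem_iff_append.mp hp
    rw [List.isChain_map, List.isChain_append, List.isChain_cons] at hl
    have h₁ : ∀ p ∈ l₁.getLast?, p.1 < 1 := fun p hp => by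
      have : p.1 ≠ 1 := hl.2.2 p hp _ rfl
      omega
    have h₂ : ∀ p ∈ l₂.head?, p.1 < 1 := fun p hp => by
      have : 1 ≠ p.1 := hl.2.1.1 p hp
      omega
    rw [moment_monotoneFamily l₁ l₂ a h₁ h₂, hE, wordProd_append, wordProd_cons, ← mul_assoc,
      hS l₁ l₂ 1 a h₁ h₂, E_wordProd_insert hγ l₁ l₂ fun l' hl' => ih l' (by simp; omega)]
  -- Without a letter of the higher index, alternation leaves at most one letter.
  · push Not at h1
    rcases l with _ | ⟨p, _ | ⟨q, l⟩⟩
    · rw [wordProd_nil, moment_nil, ← map_one P.incl, P.E_incl]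
    · rw [moment_singleton compatible_monotoneFamily p (nil_mem_monotoneFamily _), hE,
        wordProd_cons, wordProd_nil, mul_one]
    · have hp := h1 p (by simp)
      have hq := h1 q (by simp)
      rw [List.map_cons, List.map_cons, List.isChain_cons_cons] at hl
      exact absurd (show p.1 = q.1 by omega) hl.1

end Monotone

section GNS

/-! ### The GNS bimodule of an operator-valued probability space -/

variable {B : Type u} [CStarAlgebra B] [PartialOrder B] [StarOrderedRing B]
  {A : Type uA} [CStarAlgebra A] (P : BProbSpace B A)

theorem E_star_mul_self_nonneg (hpos : ∀ a, 0 ≤ P.E (a * star a)) (a : A) :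
    0 ≤ P.E (star a * a) := by
  simpa using hpos (star a)

/-- Positivity of `E` makes the images of positive elements self-adjoint; self-adjoint elements are
differences of positive ones, and the general case follows through real and imaginary parts. This
gives the hermitian symmetry of the GNS inner product. -/
theorem E_star (hpos : ∀ a, 0 ≤ P.E (a * star a)) (a : A) : P.E (star a) = star (P.E a) := by
  -- No order on `A` is part of the data, so the spectral order is introduced locally in order to
  -- speak of positive and negative parts.
  let _ := CStarAlgebra.spectralOrder A
  have _ := CStarAlgebra.spectralOrderedRing A
  have hnn : ∀ a : A, 0 ≤ a → star (P.E a) = P.E a := fun a ha => by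
    obtain ⟨d, rfl⟩ := CStarAlgebra.nonneg_iff_eq_star_mul_self.mp ha
    exact IsSelfAdjoint.of_nonneg (E_star_mul_self_nonneg P hpos d)
  have hsa : ∀ a : A, IsSelfAdjoint a → star (P.E a) = P.E a := fun a ha => by
    rw [← CFC.posPart_sub_negPart a ha, map_sub, star_sub, hnn _ (CFC.posPart_nonneg a),
      hnn _ (CFC.negPart_nonneg a)]
  have hre := hsa _ (realPart a).2
  have him := hsa _ (imaginaryPart a).2
  conv_lhs => rw [← realPart_add_I_smul_imaginaryPart a]
  conv_rhs => rw [← realPart_add_I_smul_imaginaryPart a]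
  rw [star_add, star_smul, (realPart a).2.star_eq, (imaginaryPart a).2.star_eq, map_add, map_add,
    map_smul, map_smul, star_add, star_smul, hre, him]

/-- The algebra `A` as a `B`-`B`-bimodule, with inner product `⟨x, y⟩ = E(x⋆ y)`. -/
def gnsPre (hstar : ∀ b, P.incl (star b) = star (P.incl b))
    (hpos : ∀ a, 0 ≤ P.E (a * star a)) : PreHilbertBimodule.{u, max w uA} B where
  carrier := ULift.{w} A
  left := AlgHom.ofLinearMap
    { toFun := fun b =>
        { toFun := fun x => ⟨P.incl b * x.down⟩
          map_add' := fun x y => ULift.ext _ _ (mul_add _ _ _)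
          map_smul' := fun c x => ULift.ext _ _ (mul_smul_comm _ _ _) }
      map_add' := fun b c => LinearMap.ext fun x => ULift.ext _ _ (by
        change P.incl (b + c) * x.down = P.incl b * x.down + P.incl c * x.down
        rw [map_add, add_mul])
      map_smul' := fun b c => LinearMap.ext fun x => ULift.ext _ _ (by
        change P.incl (b • c) * x.down = b • (P.incl c * x.down)
        rw [map_smul, smul_mul_assoc]) }
    (LinearMap.ext fun x => ULift.ext _ _ (by
      change P.incl 1 * x.down = x.down
      rw [map_one, one_mul]))
    (fun b c => LinearMap.ext fun x => ULift.ext _ _ (by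
      change P.incl (b * c) * x.down = P.incl b * (P.incl c * x.down)
      rw [map_mul, mul_assoc]))
  right := AlgHom.ofLinearMap
    { toFun := fun b =>
        { toFun := fun x => ⟨x.down * P.incl (unop b)⟩
          map_add' := fun x y => ULift.ext _ _ (add_mul _ _ _)
          map_smul' := fun c x => ULift.ext _ _ (smul_mul_assoc _ _ _) }
      map_add' := fun b c => LinearMap.ext fun x => ULift.ext _ _ (by
        change x.down * P.incl (unop b + unop c)
          = x.down * P.incl (unop b) + x.down * P.incl (unop c)
        rw [map_add, mul_add])
      map_smul' := fun b c => LinearMap.ext fun x => ULift.ext _ _ (by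
        change x.down * P.incl (b • unop c) = b • (x.down * P.incl (unop c))
        rw [map_smul, mul_smul_comm]) }
    (LinearMap.ext fun x => ULift.ext _ _ (by
      change x.down * P.incl 1 = x.down
      rw [map_one, mul_one]))
    (fun b c => LinearMap.ext fun x => ULift.ext _ _ (by
      change x.down * P.incl (unop c * unop b) = x.down * P.incl (unop c) * P.incl (unop b)
      rw [map_mul, mul_assoc]))
  left_right_comm b c x := ULift.ext _ _ (mul_assoc _ _ _).symm
  form x y := P.E (star x.down * y.down)
  form_add_right x y z := by
    change P.E (star x.down * (y.down + z.down)) = _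
    rw [mul_add, map_add]
  form_mul_right x y b := by
    change P.E (star x.down * (y.down * P.incl b)) = _
    simpa [mul_assoc] using P.E_bimodule 1 (star x.down * y.down) b
  star_form x y := by rw [← E_star P hpos, star_mul, star_star]
  form_self_nonneg x := E_star_mul_self_nonneg P hpos _
  form_left b x y := by
    change P.E (star (P.incl b * x.down) * y.down) = P.E (star x.down * (P.incl (star b) * y.down))
    rw [star_mul, hstar, mul_assoc]

variable (hstar : ∀ b, P.incl (star b) = star (P.incl b)) (hpos : ∀ a, 0 ≤ P.E (a * star a))

/-- The vector of the GNS bimodule given by an element of `A`. -/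
def gnsVec (a : A) : (gnsPre.{u, w} P hstar hpos).carrier := ULift.up a

theorem exists_eq_gnsVec (x : (gnsPre.{u, w} P hstar hpos).carrier) :
    ∃ a, x = gnsVec P hstar hpos a := ⟨x.down, rfl⟩

theorem form_gnsVec (a a' : A) : (gnsPre.{u, w} P hstar hpos).form
    (gnsVec P hstar hpos a) (gnsVec P hstar hpos a') = P.E (star a * a') := rfl

theorem left_gnsVec (b : B) (a : A) : (gnsPre.{u, w} P hstar hpos).left b (gnsVec P hstar hpos a)
    = gnsVec P hstar hpos (P.incl b * a) := rfl

/-- Left multiplication on the GNS bimodule, before completion. -/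
def gnsMul (a : A) : (gnsPre.{u, w} P hstar hpos).carrier →ₗ[ℂ]
    (gnsPre.{u, w} P hstar hpos).carrier where
  toFun x := gnsVec P hstar hpos (a * x.down)
  map_add' _ _ := ULift.ext _ _ (mul_add _ _ _)
  map_smul' _ _ := ULift.ext _ _ (mul_smul_comm _ _ _)

theorem gnsMul_gnsVec (a a' : A) : gnsMul P hstar hpos a (gnsVec.{u, w} P hstar hpos a')
    = gnsVec P hstar hpos (a * a') := rfl

/-- In the C⋆-algebra `A` one has `‖a‖² - a⋆ a = d⋆ d`. Conjugating by `x` and applying `E` gives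
`E[(a x)⋆ (a x)] ≤ ‖a‖² E[x⋆ x]`. -/
theorem norm_gnsMul_le (a : A) (x : (gnsPre.{u, w} P hstar hpos).carrier) :
    ‖gnsMul P hstar hpos a x‖ ≤ ‖a‖ * ‖x‖ := by
  let _ := CStarAlgebra.spectralOrder A
  have _ := CStarAlgebra.spectralOrderedRing A
  obtain ⟨x, rfl⟩ := exists_eq_gnsVec P hstar hpos x
  refine le_of_sq_le_sq ?_ (by positivity)
  rw [mul_pow, PreHilbertBimodule.norm_sq, PreHilbertBimodule.norm_sq, gnsMul_gnsVec, form_gnsVec,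
    form_gnsVec]
  have h : 0 ≤ algebraMap ℝ A (‖a‖ ^ 2) - star a * a :=
    sub_nonneg.mpr CStarAlgebra.star_mul_le_algebraMap_norm_sq
  obtain ⟨d, hd⟩ := CStarAlgebra.nonneg_iff_eq_star_mul_self.mp h
  have h1 : P.E (star (a * x) * (a * x)) ≤ (‖a‖ ^ 2) • P.E (star x * x) := by
    have h2 := E_star_mul_self_nonneg P hpos (d * x)
    have h3 : star (d * x) * (d * x)
        = ((‖a‖ ^ 2 : ℝ) : ℂ) • (star x * x) - star (a * x) * (a * x) := by
      have : star (d * x) * (d * x) = star x * (star d * d) * x := by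
        rw [star_mul]; noncomm_ring
      rw [this, ← hd, Algebra.algebraMap_eq_smul_one, star_mul, Complex.coe_smul, mul_sub, sub_mul,
        mul_smul_comm, mul_one, smul_mul_assoc]
      noncomm_ring
    rwa [h3, map_sub, map_smul, Complex.coe_smul, sub_nonneg] at h2
  calc _ ≤ ‖(‖a‖ ^ 2) • P.E (star x * x)‖ := CStarAlgebra.norm_le_norm_of_nonneg_of_le
        (E_star_mul_self_nonneg P hpos _) h1
    _ = _ := by rw [norm_smul, Real.norm_of_nonneg (by positivity)]

/-- Left multiplication on the GNS bimodule. -/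
def gnsOp (a : A) : (gnsPre.{u, w} P hstar hpos).completion.carrier →L[ℂ]
    (gnsPre.{u, w} P hstar hpos).completion.carrier :=
  PreHilbertBimodule.extend
    ((gnsPre.{u, w} P hstar hpos).toCompletion.toLinearMap ∘ₗ gnsMul P hstar hpos a) ‖a‖ fun x =>
      ((gnsPre.{u, w} P hstar hpos).toCompletion.norm_map _).le.trans
        (norm_gnsMul_le P hstar hpos a x)

theorem gnsOp_toCompletion (a a' : A) :
    gnsOp P hstar hpos a ((gnsPre.{u, w} P hstar hpos).toCompletion (gnsVec P hstar hpos a'))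
      = (gnsPre.{u, w} P hstar hpos).toCompletion (gnsVec P hstar hpos (a * a')) :=
  PreHilbertBimodule.extend_toCompletion _ _ _ _

theorem gnsOp_ext {f g : (gnsPre.{u, w} P hstar hpos).completion.carrier →L[ℂ]
    (gnsPre.{u, w} P hstar hpos).completion.carrier}
    (h : ∀ a, f ((gnsPre.{u, w} P hstar hpos).toCompletion (gnsVec P hstar hpos a))
      = g ((gnsPre.{u, w} P hstar hpos).toCompletion (gnsVec P hstar hpos a))) : f = g :=
  clm_ext_toCompletion fun x => h x.down

/-- On `A` this is `(a x)⋆ y = x⋆ (a⋆ y)`, and it extends by density in both variables. It makes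
left multiplications adjointable, also for a subalgebra that is not closed under the star, since the
adjoint is only required to exist on the bimodule. -/
theorem form_gnsOp (a : A) (x y : (gnsPre.{u, w} P hstar hpos).completion.carrier) :
    (gnsPre.{u, w} P hstar hpos).completion.form (gnsOp P hstar hpos a x) y
      = (gnsPre.{u, w} P hstar hpos).completion.form x (gnsOp P hstar hpos (star a) y) := by
  let H := gnsPre.{u, w} P hstar hpos
  have hd := H.denseRange_toCompletion
  have h1 : Continuous fun p : H.completion.carrier × H.completion.carrier =>
      H.completion.form (gnsOp P hstar hpos a p.1) p.2 :=
    H.completion.continuous_form.comp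
      (((gnsOp P hstar hpos a).continuous.comp continuous_fst).prodMk continuous_snd)
  have h2 : Continuous fun p : H.completion.carrier × H.completion.carrier =>
      H.completion.form p.1 (gnsOp P hstar hpos (star a) p.2) :=
    H.completion.continuous_form.comp
      (continuous_fst.prodMk ((gnsOp P hstar hpos (star a)).continuous.comp continuous_snd))
  refine congrFun ((hd.prodMap hd).equalizer h1 h2 (funext ?_)) (x, y)
  rintro ⟨x, y⟩
  obtain ⟨x, rfl⟩ := exists_eq_gnsVec P hstar hpos x
  obtain ⟨y, rfl⟩ := exists_eq_gnsVec P hstar hpos y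
  simp only [Function.comp_apply, Prod.map_apply]
  rw [gnsOp_toCompletion, gnsOp_toCompletion, PreHilbertBimodule.form_toCompletion,
    PreHilbertBimodule.form_toCompletion, form_gnsVec, form_gnsVec, star_mul, mul_assoc]

/-- The GNS bimodule of `(A, E)`, with the vector `1`. -/
def gns : PointedHilbertBimodule.{u, max w uA} B where
  toHilbertBimodule := (gnsPre.{u, w} P hstar hpos).completion
  vac := (gnsPre.{u, w} P hstar hpos).toCompletion (gnsVec P hstar hpos 1)
  form_vac b := by
    rw [PreHilbertBimodule.left_toCompletion, PreHilbertBimodule.form_toCompletion, left_gnsVec,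
      form_gnsVec, star_one, one_mul, mul_one, P.E_incl]

/-- The representation of a subalgebra of `A` on the GNS bimodule. -/
def gnsRep (S : BimoduleSubalgebra P) :
    S.toNonUnitalSubalgebra →ₙₐ[ℂ] (gns.{u, w} P hstar hpos).adjointable where
  toFun a := ⟨gnsOp P hstar hpos a, gnsOp P hstar hpos (star (a : A)), form_gnsOp P hstar hpos a⟩
  map_smul' c a := Subtype.ext (gnsOp_ext P hstar hpos fun x => by
    change gnsOp P hstar hpos (c • (a : A)) _ = c • gnsOp P hstar hpos a _
    rw [gnsOp_toCompletion, gnsOp_toCompletion, smul_mul_assoc, ← map_smul]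
    rfl)
  map_zero' := Subtype.ext (gnsOp_ext P hstar hpos fun x => by
    change gnsOp P hstar hpos 0 _ = 0
    rw [gnsOp_toCompletion, zero_mul]
    exact map_zero _)
  map_add' a a' := Subtype.ext (gnsOp_ext P hstar hpos fun x => by
    change gnsOp P hstar hpos ((a : A) + a') _ = gnsOp P hstar hpos a _ + gnsOp P hstar hpos a' _
    rw [gnsOp_toCompletion, gnsOp_toCompletion, gnsOp_toCompletion, add_mul, ← map_add]
    rfl)
  map_mul' a a' := Subtype.ext (gnsOp_ext P hstar hpos fun x => by
    change gnsOp P hstar hpos ((a : A) * a') _ = gnsOp P hstar hpos a (gnsOp P hstar hpos a' _)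
    rw [gnsOp_toCompletion, gnsOp_toCompletion, gnsOp_toCompletion, mul_assoc])

theorem leftOp_gns (b : B) :
    ((gns.{u, w} P hstar hpos).leftOp b).1 = gnsOp P hstar hpos (P.incl b) :=
  gnsOp_ext P hstar hpos fun a => by
    rw [gnsOp_toCompletion]
    exact PreHilbertBimodule.left_toCompletion _ b _

theorem gnsOp_mul (a a' : A) : gnsOp.{u, w} P hstar hpos (a * a')
    = gnsOp P hstar hpos a * gnsOp P hstar hpos a' :=
  gnsOp_ext P hstar hpos fun x => by
    rw [mul_apply_eq_comp, gnsOp_toCompletion, gnsOp_toCompletion, gnsOp_toCompletion, mul_assoc]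

variable {I : Type k} (S : I → BimoduleSubalgebra P)

theorem isBimoduleHom_gnsRep : IsBimoduleHom (M := fun _ : I => gns.{u, w} P hstar hpos)
    fun i => gnsRep P hstar hpos (S i) := fun _ b a =>
  ⟨Subtype.ext ((gnsOp_mul P hstar hpos _ _).trans
    (congrArg (· * gnsOp P hstar hpos a) (leftOp_gns P hstar hpos b).symm)),
   Subtype.ext ((gnsOp_mul P hstar hpos _ _).trans
    (congrArg (gnsOp P hstar hpos a * ·) (leftOp_gns P hstar hpos b).symm))⟩

/-- The reason for choosing the GNS bimodule: its vector state at `1` is `E`, which is the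
hypothesis under which each classical notion determines the vacuum moments. -/
theorem vacState_gnsRep (p : Σ i, (S i).toNonUnitalSubalgebra) :
    vacState (M := fun _ : I => gns.{u, w} P hstar hpos) (fun i => gnsRep P hstar hpos (S i)) p
      = P.E (p.2 : A) := by
  change (gnsPre.{u, w} P hstar hpos).completion.form
    ((gnsPre.{u, w} P hstar hpos).toCompletion (gnsVec P hstar hpos 1))
    (gnsOp P hstar hpos p.2 ((gnsPre.{u, w} P hstar hpos).toCompletion (gnsVec P hstar hpos 1))) = _
  rw [gnsOp_toCompletion, PreHilbertBimodule.form_toCompletion, form_gnsVec, star_one, one_mul,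
    mul_one]

theorem gnsRep_one (h1 : ∀ i, 1 ∈ (S i).carrier) (i : I) :
    gnsRep.{u, w} P hstar hpos (S i) ⟨1, h1 i⟩ = 1 :=
  Subtype.ext (gnsOp_ext P hstar hpos fun a => by
    change gnsOp P hstar hpos 1 _ = _
    rw [gnsOp_toCompletion, one_mul]
    rfl)

/-! ### The three equivalences -/

variable {P}

/-- The same GNS bimodule serves for every index: only the moments within each `A_i` have to be
represented, and the free product produces the joint ones. Its lift of `A` accounts for the universe
`max w uA`. -/
theorem jIndependent_freeFamily_iff
    (hstar : ∀ b, P.incl (star b) = star (P.incl b)) (hpos : ∀ a, 0 ≤ P.E (a * star a))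
    (S : I → BimoduleSubalgebra P) (h1 : ∀ i, 1 ∈ (S i).carrier) :
    JIndependent.{u, max w uA} P (freeFamily I) S ↔ FreelyIndependent P S := by
  refine ⟨JIndependent.freelyIndependent, fun h => (jIndependent_iff _).mpr
    ⟨fun _ => gns.{u, w} P hstar hpos, fun i => gnsRep P hstar hpos (S i),
      isBimoduleHom_gnsRep P hstar hpos S, ?_⟩⟩
  exact h.E_eq_moment (isBimoduleHom_gnsRep P hstar hpos S) h1 (gnsRep_one P hstar hpos S h1)
    (vacState_gnsRep P hstar hpos S)

theorem jIndependent_booleanFamily_iff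
    (hstar : ∀ b, P.incl (star b) = star (P.incl b)) (hpos : ∀ a, 0 ≤ P.E (a * star a))
    (S : I → BimoduleSubalgebra P) :
    JIndependent.{u, max w uA} P (booleanFamily I) S ↔ BooleanIndependent P S := by
  refine ⟨JIndependent.booleanIndependent, fun h => (jIndependent_iff _).mpr
    ⟨fun _ => gns.{u, w} P hstar hpos, fun i => gnsRep P hstar hpos (S i),
      isBimoduleHom_gnsRep P hstar hpos S, ?_⟩⟩
  exact h.E_eq_moment (vacState_gnsRep P hstar hpos S)

theorem jIndependent_monotoneFamily_iff
    (hstar : ∀ b, P.incl (star b) = star (P.incl b)) (hpos : ∀ a, 0 ≤ P.E (a * star a))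
    (S : Fin 2 → BimoduleSubalgebra P) :
    JIndependent.{u, max w uA} P monotoneFamily S ↔ MonotoneIndependent P S := by
  refine ⟨JIndependent.monotoneIndependent, fun h => (jIndependent_iff _).mpr
    ⟨fun _ => gns.{u, w} P hstar hpos, fun i => gnsRep P hstar hpos (S i),
      isBimoduleHom_gnsRep P hstar hpos S, ?_⟩⟩
  exact h.E_eq_moment (isBimoduleHom_gnsRep P hstar hpos S) (vacState_gnsRep P hstar hpos S)

end GNS

section Isometries

/-! ### Isometries of Hilbert bimodules -/

variable {B : Type u} [CStarAlgebra B] [PartialOrder B] [StarOrderedRing B]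

/-- A linear map between Hilbert bimodules that preserves inner products and the left action. -/
structure BimoduleIsometry (H : HilbertBimodule.{u, v} B) (K : HilbertBimodule.{u, v'} B) where
  toLinearMap : H.carrier →ₗ[ℂ] K.carrier
  form_map : ∀ x y, K.form (toLinearMap x) (toLinearMap y) = H.form x y
  map_left : ∀ b x, toLinearMap (H.left b x) = K.left b (toLinearMap x)

/-- An isometry as a continuous linear map. -/
def BimoduleIsometry.toCLM {H : HilbertBimodule.{u, v} B} {K : HilbertBimodule.{u, v'} B}
    (f : BimoduleIsometry H K) : H.carrier →L[ℂ] K.carrier :=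
  f.toLinearMap.mkContinuous 1 fun x => by
    rw [PreHilbertBimodule.norm_def, PreHilbertBimodule.norm_def, f.form_map, one_mul]

theorem PreHilbertBimodule.norm_le_of_form {Q : PreHilbertBimodule.{u, v} B}
    {K : HilbertBimodule.{u, v'} B} (f : Q.carrier →ₗ[ℂ] K.carrier)
    (hf : ∀ x y, K.form (f x) (f y) = Q.form x y) (x : Q.carrier) : ‖f x‖ ≤ 1 * ‖x‖ := by
  rw [PreHilbertBimodule.norm_def, PreHilbertBimodule.norm_def, hf, one_mul]

/-- The extension of an isometry to the completion. -/
def BimoduleIsometry.extend {Q : PreHilbertBimodule.{u, v} B} {K : HilbertBimodule.{u, v'} B}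
    (f : Q.carrier →ₗ[ℂ] K.carrier) (hf : ∀ x y, K.form (f x) (f y) = Q.form x y)
    (hl : ∀ b x, f (Q.left b x) = K.left b (f x)) : BimoduleIsometry Q.completion K where
  toLinearMap := (PreHilbertBimodule.extend f 1 (PreHilbertBimodule.norm_le_of_form f hf) :
    Q.completion.carrier →L[ℂ] K.carrier)
  form_map x y := by
    -- The density lemma allows a left multiplication in the second variable; here it is taken to be
    -- by `1`.
    have h := form_ext_toCompletion
      (PreHilbertBimodule.extend f 1 (PreHilbertBimodule.norm_le_of_form f hf))
      (PreHilbertBimodule.extend f 1 (PreHilbertBimodule.norm_le_of_form f hf)) 1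
      (fun x x' => by
        rw [PreHilbertBimodule.extend_toCompletion, PreHilbertBimodule.extend_toCompletion, hf,
          map_one, Module.End.one_apply]) x y
    rwa [map_one, Module.End.one_apply] at h
  map_left b x := by
    have h : PreHilbertBimodule.extend f 1 (PreHilbertBimodule.norm_le_of_form f hf)
          ∘L (Q.completion.leftOp b).1
        = (K.leftOp b).1 ∘L
          PreHilbertBimodule.extend f 1 (PreHilbertBimodule.norm_le_of_form f hf) := by
      refine clm_ext_toCompletion fun x => ?_
      change PreHilbertBimodule.extend f 1 _ (Q.completion.left b (Q.toCompletion x))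
        = K.left b (PreHilbertBimodule.extend f 1 _ (Q.toCompletion x))
      rw [PreHilbertBimodule.left_toCompletion, PreHilbertBimodule.extend_toCompletion,
        PreHilbertBimodule.extend_toCompletion, hl]
    exact DFunLike.congr_fun h x

theorem BimoduleIsometry.extend_toCompletion {Q : PreHilbertBimodule.{u, v} B}
    {K : HilbertBimodule.{u, v'} B}
    (f : Q.carrier →ₗ[ℂ] K.carrier) (hf : ∀ x y, K.form (f x) (f y) = Q.form x y)
    (hl : ∀ b x, f (Q.left b x) = K.left b (f x)) (x : Q.carrier) :
    (BimoduleIsometry.extend f hf hl).toLinearMap (Q.toCompletion x) = f x :=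
  PreHilbertBimodule.extend_toCompletion f 1 (PreHilbertBimodule.norm_le_of_form f hf) x

end Isometries

section MatrixBimodule

/-! ### Matrices over a Hilbert bimodule -/

variable {B : Type u} [CStarAlgebra B] [PartialOrder B] [StarOrderedRing B]

theorem cstarMatrix_sum_apply {n : ℕ} {κ : Type*} (s : Finset κ)
    (F : κ → CStarMatrix (Fin n) (Fin n) B) (i j : Fin n) :
    (∑ p ∈ s, F p) i j = ∑ p ∈ s, F p i j :=
  Matrix.sum_apply i j s F

/-- The matrices over a Hilbert `B`-`B`-bimodule, as a bimodule over the matrices over `B`. -/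
def matPre (n : ℕ) (H : PreHilbertBimodule.{u, v} B) :
    PreHilbertBimodule.{u, v} (CStarMatrix (Fin n) (Fin n) B) where
  carrier := Fin n → Fin n → H.carrier
  left := AlgHom.ofLinearMap
    { toFun := fun b =>
        { toFun := fun x i j => ∑ p, H.left (b i p) (x p j)
          map_add' := fun x y => by
            funext i j
            simp only [Pi.add_apply, map_add, Finset.sum_add_distrib]
          map_smul' := fun c x => by
            funext i j
            simp only [Pi.smul_apply, map_smul, Finset.smul_sum, RingHom.id_apply] }
      map_add' := fun b c => by
        refine LinearMap.ext fun x => funext fun i => funext fun j => ?_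
        change ∑ p, H.left (b i p + c i p) (x p j)
          = ∑ p, H.left (b i p) (x p j) + ∑ p, H.left (c i p) (x p j)
        simp only [map_add, LinearMap.add_apply, Finset.sum_add_distrib]
      map_smul' := fun c b => by
        refine LinearMap.ext fun x => funext fun i => funext fun j => ?_
        change ∑ p, H.left (c • b i p) (x p j) = c • ∑ p, H.left (b i p) (x p j)
        simp only [map_smul, LinearMap.smul_apply, Finset.smul_sum] }
    (by
      refine LinearMap.ext fun x => funext fun i => funext fun j => ?_
      change ∑ p, H.left ((1 : CStarMatrix (Fin n) (Fin n) B) i p) (x p j) = x i j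
      rw [Finset.sum_eq_single i]
      · rw [CStarMatrix.one_apply_eq, map_one, Module.End.one_apply]
      · intro p _ hp
        rw [CStarMatrix.one_apply_ne hp.symm, map_zero, LinearMap.zero_apply]
      · simp)
    (fun b c => by
      refine LinearMap.ext fun x => funext fun i => funext fun j => ?_
      change ∑ p, H.left ((b * c) i p) (x p j)
        = ∑ q, H.left (b i q) (∑ p, H.left (c q p) (x p j))
      simp only [CStarMatrix.mul_apply, map_sum, map_mul, LinearMap.sum_apply,
        Module.End.mul_apply]
      rw [Finset.sum_comm])
  right := AlgHom.ofLinearMap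
    { toFun := fun b =>
        { toFun := fun x i j => ∑ p, H.right (op (unop b p j)) (x i p)
          map_add' := fun x y => by
            funext i j
            simp only [Pi.add_apply, map_add, Finset.sum_add_distrib]
          map_smul' := fun c x => by
            funext i j
            simp only [Pi.smul_apply, map_smul, Finset.smul_sum, RingHom.id_apply] }
      map_add' := fun b c => by
        refine LinearMap.ext fun x => funext fun i => funext fun j => ?_
        change ∑ p, H.right (op (unop b p j) + op (unop c p j)) (x i p)
          = ∑ p, H.right (op (unop b p j)) (x i p) + ∑ p, H.right (op (unop c p j)) (x i p)
        simp only [map_add, LinearMap.add_apply, Finset.sum_add_distrib]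
      map_smul' := fun c b => by
        refine LinearMap.ext fun x => funext fun i => funext fun j => ?_
        change ∑ p, H.right (c • op (unop b p j)) (x i p)
          = c • ∑ p, H.right (op (unop b p j)) (x i p)
        simp only [map_smul, LinearMap.smul_apply, Finset.smul_sum] }
    (by
      refine LinearMap.ext fun x => funext fun i => funext fun j => ?_
      change ∑ p, H.right (op ((1 : CStarMatrix (Fin n) (Fin n) B) p j)) (x i p) = x i j
      rw [Finset.sum_eq_single j]
      · rw [CStarMatrix.one_apply_eq, op_one, map_one, Module.End.one_apply]
      · intro p _ hp
        rw [CStarMatrix.one_apply_ne hp, op_zero, map_zero, LinearMap.zero_apply]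
      · simp)
    (fun b c => by
      refine LinearMap.ext fun x => funext fun i => funext fun j => ?_
      change ∑ p, H.right (op ((unop c * unop b) p j)) (x i p)
        = ∑ q, H.right (op (unop b q j)) (∑ p, H.right (op (unop c p q)) (x i p))
      simp only [CStarMatrix.mul_apply, Finset.op_sum, op_mul, map_sum, map_mul, LinearMap.sum_apply,
        Module.End.mul_apply]
      rw [Finset.sum_comm])
  left_right_comm b c x := by
    funext i j
    change ∑ p, H.left (b i p) (∑ q, H.right (op (unop c q j)) (x p q))
      = ∑ q, H.right (op (unop c q j)) (∑ p, H.left (b i p) (x p q))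
    simp only [map_sum, H.left_right_comm]
    rw [Finset.sum_comm]
  form x y := CStarMatrix.ofMatrix fun i j => ∑ p, H.form (x p i) (y p j)
  form_add_right x y z := by
    ext i j
    change ∑ p, H.form (x p i) (y p j + z p j)
      = ∑ p, H.form (x p i) (y p j) + ∑ p, H.form (x p i) (z p j)
    simp only [H.form_add_right, Finset.sum_add_distrib]
  form_mul_right x y b := by
    ext i j
    rw [CStarMatrix.mul_apply]
    change ∑ p, H.form (x p i) (∑ q, H.right (op (b q j)) (y p q))
      = ∑ q, (∑ p, H.form (x p i) (y p q)) * b q j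
    simp only [H.form_sum_right, H.form_mul_right, Finset.sum_mul]
    rw [Finset.sum_comm]
  star_form x y := by
    ext i j
    rw [CStarMatrix.star_apply]
    change star (∑ p, H.form (x p j) (y p i)) = ∑ p, H.form (y p i) (x p j)
    simp only [star_sum, H.star_form]
  form_self_nonneg x := by
    -- The matrix `⟨x, x⟩` is a sum over the rows of `x` of Gram matrices, which can be treated one
    -- by one.
    have h : (CStarMatrix.ofMatrix fun i j => ∑ p, H.form (x p i) (x p j) :
        CStarMatrix (Fin n) (Fin n) B)
        = ∑ p, CStarMatrix.ofMatrix fun i j => H.form (x p i) (x p j) := by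
      ext i j
      rw [cstarMatrix_sum_apply]
      rfl
    rw [h]
    refine Finset.sum_nonneg fun p _ => ?_
    -- A Gram matrix is positive on columns `b`, where its value is the square length of `∑ x_i
    -- b_i`, and is therefore of the form `T⋆ T`.
    obtain ⟨T, hT⟩ := exists_eq_star_mul_self (fun i j => H.form (x p i) (x p j))
      (fun i j => H.star_form _ _) (fun b => by
        have h := H.form_self_nonneg (∑ i, H.right (op (b i)) (x p i))
        simpa only [H.form_sum_left, H.form_sum_right, H.form_mul_left, H.form_mul_right,
          ← mul_assoc] using h)
    have hS : (CStarMatrix.ofMatrix fun i j => H.form (x p i) (x p j) :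
        CStarMatrix (Fin n) (Fin n) B)
        = star (CStarMatrix.ofMatrix T) * CStarMatrix.ofMatrix T := by
      ext i j
      rw [CStarMatrix.mul_apply]
      simp only [CStarMatrix.star_apply]
      exact hT i j
    rw [hS]
    exact star_mul_self_nonneg _
  form_left b x y := by
    ext i j
    change ∑ p, H.form (∑ q, H.left (b p q) (x q i)) (y p j)
      = ∑ q, H.form (x q i) (∑ p, H.left (star (b p q)) (y p j))
    simp only [H.form_sum_left, H.form_sum_right, H.form_left]
    rw [Finset.sum_comm]

section

variable (n : ℕ) (H : HilbertBimodule.{u, v} B)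

theorem form_matPre (x y : (matPre n H.toPreHilbertBimodule).carrier) (i j : Fin n) :
    (matPre n H.toPreHilbertBimodule).form x y i j = ∑ p, H.form (x p i) (y p j) := rfl

/-- `⟨x_{ij}, x_{ij}⟩` is one of the positive terms of the diagonal entry of `⟨x, x⟩` at `j`, and an
entry is bounded by the norm of its matrix. This half of the comparison with the product topology
also gives definiteness. -/
theorem norm_matPre_entry_le (x : (matPre n H.toPreHilbertBimodule).carrier) (i j : Fin n) :
    ‖(x i j : H.carrier)‖ ≤ ‖x‖ := by
  refine le_of_sq_le_sq ?_ (norm_nonneg _)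
  rw [PreHilbertBimodule.norm_sq, PreHilbertBimodule.norm_sq]
  refine le_trans ?_ (CStarMatrix.norm_entry_le_norm (i := j) (j := j))
  rw [form_matPre]
  exact CStarAlgebra.norm_le_norm_of_nonneg_of_le (H.form_self_nonneg _)
    (Finset.single_le_sum (f := fun p => H.form (x p j) (x p j))
      (fun p _ => H.form_self_nonneg _) (Finset.mem_univ i))

/-- The identification of the matrices over `H` with a product of copies of `H`. -/
def matEquivPi : (matPre n H.toPreHilbertBimodule).carrier ≃L[ℂ] (Fin n → Fin n → H.carrier) where
  toFun x := x
  invFun x := x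
  map_add' _ _ := rfl
  map_smul' _ _ := rfl
  left_inv _ := rfl
  right_inv _ := rfl
  continuous_toFun := by
    refine continuous_pi fun i => continuous_pi fun j => ?_
    let f : (matPre n H.toPreHilbertBimodule).carrier →ₗ[ℂ] H.carrier :=
      { toFun := fun x => x i j
        map_add' := fun _ _ => rfl
        map_smul' := fun _ _ => rfl }
    exact AddMonoidHomClass.continuous_of_bound f 1 fun x => by
      rw [one_mul]; exact norm_matPre_entry_le n H x i j
  continuous_invFun := by
    let f : (Fin n → Fin n → H.carrier) →+ (matPre n H.toPreHilbertBimodule).carrier :=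
      { toFun := fun x => x
        map_add' := fun _ _ => rfl
        map_zero' := rfl }
    -- By additivity it is enough to see that the norm tends to zero at `0`. The norm is the square
    -- root of that of `⟨x, x⟩`, whose entries are finite sums of continuous functions of the
    -- entries of `x`.
    refine continuous_of_continuousAt_zero f ?_
    rw [ContinuousAt, map_zero, tendsto_zero_iff_norm_tendsto_zero]
    have hc : Continuous fun x : Fin n → Fin n → H.carrier =>
        (matPre n H.toPreHilbertBimodule).form (f x) (f x) := by
      refine continuous_pi fun i => continuous_pi fun j => ?_
      change Continuous fun x : Fin n → Fin n → H.carrier => ∑ p, H.form (x p i) (x p j)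
      refine continuous_finsetSum _ fun p _ => ?_
      have hp : Continuous fun x : Fin n → Fin n → H.carrier => (x p i, x p j) :=
        (continuous_apply_apply p i).prodMk (continuous_apply_apply p j)
      exact H.continuous_form.comp hp
    have h := (hc.norm.sqrt).tendsto 0
    rw [map_zero, PreHilbertBimodule.form_zero_left, norm_zero, Real.sqrt_zero] at h
    exact h

/-- The Hilbert bimodule of matrices over a Hilbert bimodule. -/
def mat : HilbertBimodule.{u, v} (CStarMatrix (Fin n) (Fin n) B) where
  toPreHilbertBimodule := matPre n H.toPreHilbertBimodule
  eq_zero_of_form_self x hx := by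
    have h0 : ‖x‖ = 0 := by rw [PreHilbertBimodule.norm_def, hx, norm_zero, Real.sqrt_zero]
    funext i j
    have h := norm_matPre_entry_le n H x i j
    rw [h0] at h
    have h' := le_antisymm h (norm_nonneg _)
    refine H.eq_zero_of_form_self _ ?_
    rw [← norm_eq_zero, ← H.norm_sq, h', zero_pow two_ne_zero]
  completeSpace := by
    have h := (matEquivPi n H).symm.isUniformEmbedding.isUniformInducing
    exact (h.completeSpace_congr (matEquivPi n H).symm.surjective).mp inferInstance

variable {n H}

/-- The entries of a matrix over a Hilbert bimodule. -/
def matEntry (i j : Fin n) : (mat n H).carrier →L[ℂ] H.carrier :=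
  ContinuousLinearMap.proj j ∘L ContinuousLinearMap.proj i ∘L
    (matEquivPi n H).toContinuousLinearMap

theorem mat_ext {x y : (mat n H).carrier} (h : ∀ i j, matEntry i j x = matEntry i j y) : x = y :=
  funext fun i => funext fun j => h i j

/-- The map to the matrices over `H` with given entries. -/
def matLift {W : Type*} [TopologicalSpace W] [AddCommGroup W] [Module ℂ W]
    (f : Fin n → Fin n → W →L[ℂ] H.carrier) : W →L[ℂ] (mat n H).carrier :=
  (matEquivPi n H).symm.toContinuousLinearMap ∘L
    ContinuousLinearMap.pi fun i => ContinuousLinearMap.pi (f i)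

theorem matEntry_matLift {W : Type*} [TopologicalSpace W] [AddCommGroup W] [Module ℂ W]
    (f : Fin n → Fin n → W →L[ℂ] H.carrier) (i j : Fin n) (x : W) :
    matEntry i j (matLift f x) = f i j x := rfl

/-- The matrix with given entries. -/
def matOf (x : Fin n → Fin n → H.carrier) : (mat n H).carrier := x

theorem matEntry_matOf (x : Fin n → Fin n → H.carrier) (i j : Fin n) :
    matEntry i j (matOf x) = x i j := rfl

theorem matEntry_left (b : CStarMatrix (Fin n) (Fin n) B) (x : (mat n H).carrier) (i j : Fin n) :
    matEntry i j ((mat n H).left b x) = ∑ p, H.left (b i p) (matEntry p j x) := rfl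

theorem form_mat (x y : (mat n H).carrier) (i j : Fin n) :
    (mat n H).form x y i j = ∑ p, H.form (matEntry p i x) (matEntry p j y) := rfl

/-- A matrix of adjointable operators as an operator on matrices. -/
def matAct (a : Fin n → Fin n → H.adjointable) : (mat n H).adjointable :=
  ⟨matLift fun i j => ∑ p, (a i p).1 ∘L matEntry p j, by
    -- The adjoint is the transposed matrix of the entrywise adjoints.
    choose T hT using fun i j => (a i j).2
    refine ⟨fun y => matOf fun i j => ∑ p, T p i (matEntry p j y), fun x y => ?_⟩
    ext i j
    simp only [form_mat, matEntry_matLift, matEntry_matOf, _root_.sum_apply,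
      ContinuousLinearMap.comp_apply, H.form_sum_left, H.form_sum_right, hT]
    rw [Finset.sum_comm]⟩

theorem matEntry_matAct (a : Fin n → Fin n → H.adjointable) (x : (mat n H).carrier)
    (i j : Fin n) : matEntry i j ((matAct a).1 x) = ∑ p, (a i p).1 (matEntry p j x) := by
  rw [matAct, matEntry_matLift, _root_.sum_apply]
  rfl

theorem adjointable_mat_ext {T T' : (mat n H).adjointable}
    (h : ∀ x i j, matEntry i j (T.1 x) = matEntry i j (T'.1 x)) : T = T' :=
  Subtype.ext (ContinuousLinearMap.ext fun x => mat_ext (h x))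

theorem matAct_mul (a a' : Fin n → Fin n → H.adjointable) :
    matAct a * matAct a' = matAct fun i j => ∑ p, a i p * a' p j := by
  refine adjointable_mat_ext fun x i j => ?_
  change matEntry i j ((matAct a).1 ((matAct a').1 x)) = _
  simp only [matEntry_matAct, map_sum]
  rw [Finset.sum_comm]
  refine Finset.sum_congr rfl fun p _ => ?_
  have h : (∑ q, a i q * a' q p : H.adjointable).1 = ∑ q, (a i q).1 * (a' q p).1 := by
    simp
  rw [h, _root_.sum_apply]
  rfl

theorem leftOp_mat (b : CStarMatrix (Fin n) (Fin n) B) :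
    (mat n H).leftOp b = matAct fun i j => H.leftOp (b i j) := by
  refine adjointable_mat_ext fun x i j => ?_
  rw [matEntry_matAct]
  rfl

end

end MatrixBimodule

section MatrixFreeProduct

/-! ### The reduced free product of matrix bimodules -/

variable {B : Type u} [CStarAlgebra B] [PartialOrder B] [StarOrderedRing B] {n : ℕ}

/-- The pointed Hilbert bimodule of matrices over a pointed Hilbert bimodule. -/
abbrev matPointed (n : ℕ) (N : PointedHilbertBimodule.{u, v} B) :
    PointedHilbertBimodule.{u, v} (CStarMatrix (Fin n) (Fin n) B) where
  toHilbertBimodule := mat n N.toHilbertBimodule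
  vac := matOf fun i j => if i = j then N.vac else 0
  form_vac b := by
    ext i j
    rw [form_mat, Finset.sum_eq_single i]
    · rw [matEntry_left, matEntry_matOf, if_pos rfl, Finset.sum_eq_single j]
      · rw [matEntry_matOf, if_pos rfl, N.form_vac]
      · intro q _ hq
        rw [matEntry_matOf, if_neg hq, map_zero]
      · simp
    · intro p _ hp
      rw [matEntry_matOf, if_neg hp, N.form_zero_left]
    · simp

/-- Since `ξ` is diagonal, pairing with it is done entry by entry. So a matrix is orthogonal to the
matrix vacuum precisely when all its entries are orthogonal to the scalar one. -/
theorem form_matPointed_vac (N : PointedHilbertBimodule.{u, v} B)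
    (x : (mat n N.toHilbertBimodule).carrier) (i j : Fin n) :
    (mat n N.toHilbertBimodule).form (matPointed n N).vac x i j = N.form N.vac (matEntry i j x) := by
  rw [form_mat, Finset.sum_eq_single i]
  · rw [matEntry_matOf, if_pos rfl]
  · intro p _ hp
    rw [matEntry_matOf, if_neg hp, N.form_zero_left]
  · simp

/-- The inclusion of `N°` in `N`. -/
def complVal (N : PointedHilbertBimodule.{u, v} B) : N.compl.carrier →ₗ[ℂ] N.carrier :=
  N.complSubmodule.subtype

theorem form_vac_complVal (N : PointedHilbertBimodule.{u, v} B) (x : N.compl.carrier) :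
    N.form N.vac (complVal N x) = 0 := (toCompl_coe N x).2

theorem complVal_toCompl (N : PointedHilbertBimodule.{u, v} B) (x : N.carrier) :
    complVal N (N.toCompl x) = x - N.left (N.form N.vac x) N.vac := rfl

/-- The entries of a matrix in the complement of the specified vector. -/
def complMat (n : ℕ) (N : PointedHilbertBimodule.{u, v} B) :
    BimoduleIsometry (matPointed n N).compl (mat n N.compl) where
  toLinearMap :=
    { toFun := fun x => matOf fun i j => N.toCompl (matEntry i j (complVal (matPointed n N) x))
      map_add' := fun x y => mat_ext fun i j => by
        simp only [matEntry_matOf, map_add]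
      map_smul' := fun c x => mat_ext fun i j => by
        simp only [matEntry_matOf, map_smul, RingHom.id_apply] }
  form_map x y := by
    -- The entries already lie in the complement of the specified vector, so projecting them there
    -- does not change inner products.
    have h0 : ∀ x : (matPointed n N).compl.carrier, ∀ i j,
        N.form N.vac (matEntry i j (complVal (matPointed n N) x)) = 0 := fun x i j =>
      (form_matPointed_vac N (complVal (matPointed n N) x) i j).symm.trans
        (congrArg (fun T : CStarMatrix (Fin n) (Fin n) B => T i j)
          (form_vac_complVal (matPointed n N) x))
    ext i j
    change ∑ p, N.compl.form (N.toCompl (matEntry p i (complVal (matPointed n N) x)))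
        (N.toCompl (matEntry p j (complVal (matPointed n N) y)))
      = ∑ p, N.form (matEntry p i (complVal (matPointed n N) x))
        (matEntry p j (complVal (matPointed n N) y))
    refine Finset.sum_congr rfl fun p _ => ?_
    rw [N.form_eq, h0, h0, mul_zero, zero_add]
  map_left b x := mat_ext fun i j => by
    change N.toCompl (matEntry i j ((mat n N.toHilbertBimodule).left b
      (complVal (matPointed n N) x))) = ∑ p, N.compl.left (b i p)
        (N.toCompl (matEntry p j (complVal (matPointed n N) x)))
    rw [matEntry_left, map_sum]
    exact Finset.sum_congr rfl fun p _ => toCompl_left N _ _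

theorem matEntry_complMat_toCompl (N : PointedHilbertBimodule.{u, v} B)
    (x : (matPointed n N).carrier) (i j : Fin n) :
    matEntry i j ((complMat n N).toLinearMap ((matPointed n N).toCompl x))
      = N.toCompl (matEntry i j x) := by
  change N.toCompl (matEntry i j (complVal (matPointed n N) ((matPointed n N).toCompl x))) = _
  rw [complVal_toCompl, map_sub, matEntry_left, map_sub, map_sum, Finset.sum_eq_single j]
  · rw [matEntry_matOf, if_pos rfl, toCompl_left, toCompl_vac, map_zero, sub_zero]
  · intro p _ hp
    rw [matEntry_matOf, if_neg hp, map_zero, map_zero]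
  · simp

/-- The matrices over `B` as matrices over the bimodule `B`. -/
def selfMat (n : ℕ) (B : Type u) [CStarAlgebra B] [PartialOrder B] [StarOrderedRing B] :
    BimoduleIsometry (HilbertBimodule.self.{u, v} (CStarMatrix (Fin n) (Fin n) B))
      (mat n (HilbertBimodule.self.{u, v} B)) where
  toLinearMap :=
    { toFun := fun x => matOf fun i j => (ULift.up (x.down i j) : ULift.{v} B)
      map_add' := fun _ _ => rfl
      map_smul' := fun _ _ => rfl }
  form_map x y := by
    ext i j
    change ∑ p, star (x.down p i) * y.down p j = (star x.down * y.down) i j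
    rw [CStarMatrix.mul_apply]
    rfl
  map_left b x := mat_ext fun i j => by
    refine ULift.ext _ _ ?_
    change (b * x.down) i j = ULift.down (∑ p, (ULift.up (b i p * x.down p j) : ULift.{v} B))
    rw [CStarMatrix.mul_apply]
    exact (map_sum (AddEquiv.ulift : ULift.{v} B ≃+ B) _ _).symm

/-! ### Tensor products of matrix bimodules -/

section Tensor

variable {E : HilbertBimodule.{u, v} B} {F : HilbertBimodule.{u, v'} B}
  {E' : HilbertBimodule.{u, v} (CStarMatrix (Fin n) (Fin n) B)}
  {F' : HilbertBimodule.{u, v'} (CStarMatrix (Fin n) (Fin n) B)}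
  (f : BimoduleIsometry E' (mat n E)) (g : BimoduleIsometry F' (mat n F))

/-- The matrix product `M_n(E) ⊗ M_n(F) → M_n(E ⊗ F)` on the algebraic tensor product. -/
def tensorMatPre : (HilbertBimodule.tensorPre E' F').carrier →ₗ[ℂ]
    (mat n (HilbertBimodule.tensor E F)).carrier :=
  TensorProduct.lift (LinearMap.mk₂ ℂ
    (fun x y => matOf fun i j => ∑ p, HilbertBimodule.tmul E F (matEntry i p (f.toLinearMap x))
      (matEntry p j (g.toLinearMap y)))
    (fun x x' y => mat_ext fun i j => by
      simp only [matEntry_matOf, map_add, LinearMap.add_apply, Finset.sum_add_distrib])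
    (fun c x y => mat_ext fun i j => by
      simp only [matEntry_matOf, map_smul, LinearMap.smul_apply, Finset.smul_sum])
    (fun x y y' => mat_ext fun i j => by
      simp only [matEntry_matOf, map_add, Finset.sum_add_distrib])
    (fun c x y => mat_ext fun i j => by
      simp only [matEntry_matOf, map_smul, Finset.smul_sum]))

theorem matEntry_tensorMatPre (x : E'.carrier) (y : F'.carrier) (i j : Fin n) :
    matEntry i j (tensorMatPre f g (HilbertBimodule.tmulPre E' F' x y))
      = ∑ p, HilbertBimodule.tmul E F (matEntry i p (f.toLinearMap x))
        (matEntry p j (g.toLinearMap y)) := rfl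

/-- On elementary tensors both sides at `(i, j)` are the triple sum over `r, p, q` of `⟨y_{pi},
⟨x_{rp}, x'_{rq}⟩ y'_{qj}⟩`, summed in different orders. -/
theorem form_tensorMatPre (s t : (HilbertBimodule.tensorPre E' F').carrier) :
    (mat n (HilbertBimodule.tensor E F)).form (tensorMatPre f g s) (tensorMatPre f g t)
      = (HilbertBimodule.tensorPre E' F').form s t := by
  refine HilbertBimodule.tensor_form_ext E' F' (tensorMatPre f g) (fun x x' y y' => ?_) s t
  rw [← g.form_map, g.map_left, ← f.form_map]
  ext i j
  simp only [form_mat, matEntry_tensorMatPre, matEntry_left, map_sum, LinearMap.sum_apply,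
    PreHilbertBimodule.form_sum_left, PreHilbertBimodule.form_sum_right,
    HilbertBimodule.form_tmul]
  rw [Finset.sum_comm]
  exact (Finset.sum_congr rfl fun r _ => Finset.sum_comm).trans Finset.sum_comm

theorem tensor_left_tmul (b : B) (x : E.carrier) (y : F.carrier) :
    (HilbertBimodule.tensor E F).left b (HilbertBimodule.tmul E F x y)
      = HilbertBimodule.tmul E F (E.left b x) y :=
  PreHilbertBimodule.left_toCompletion (HilbertBimodule.tensorPre E F) b _

theorem tensorMatPre_left (b : CStarMatrix (Fin n) (Fin n) B)
    (t : (HilbertBimodule.tensorPre E' F').carrier) :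
    tensorMatPre f g ((HilbertBimodule.tensorPre E' F').left b t)
      = (mat n (HilbertBimodule.tensor E F)).left b (tensorMatPre f g t) := by
  refine HilbertBimodule.tensorPre_induction t ?_ (fun x y => ?_) fun s t hs ht => ?_
  · simp only [map_zero]
  · refine mat_ext fun i j => ?_
    have h1 : (HilbertBimodule.tensorPre E' F').left b (HilbertBimodule.tmulPre E' F' x y)
        = HilbertBimodule.tmulPre E' F' (E'.left b x) y := rfl
    rw [h1, matEntry_tensorMatPre, matEntry_left]
    simp only [matEntry_tensorMatPre, f.map_left, matEntry_left, map_sum, LinearMap.sum_apply,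
      tensor_left_tmul]
    rw [Finset.sum_comm]
  · simp only [map_add, hs, ht]

/-- The matrix product `M_n(E) ⊗ M_n(F) → M_n(E ⊗ F)`. -/
def tensorMat :
    BimoduleIsometry (HilbertBimodule.tensor E' F') (mat n (HilbertBimodule.tensor E F)) :=
  BimoduleIsometry.extend (tensorMatPre f g) (form_tensorMatPre f g) (tensorMatPre_left f g)

theorem matEntry_tensorMat_tmul (x : E'.carrier) (y : F'.carrier) (i j : Fin n) :
    matEntry i j ((tensorMat f g).toLinearMap (HilbertBimodule.tmul E' F' x y))
      = ∑ p, HilbertBimodule.tmul E F (matEntry i p (f.toLinearMap x))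
        (matEntry p j (g.toLinearMap y)) :=
  congrArg (matEntry i j) (BimoduleIsometry.extend_toCompletion (tensorMatPre f g)
    (form_tensorMatPre f g) (tensorMatPre_left f g) (HilbertBimodule.tmulPre E' F' x y))

end Tensor

/-- A linear map applied to the entries of a matrix. -/
def matMap {H : HilbertBimodule.{u, v} B} {K : HilbertBimodule.{u, v'} B}
    (f : H.carrier →ₗ[ℂ] K.carrier) : (mat n H).carrier →ₗ[ℂ] (mat n K).carrier where
  toFun x := matOf fun i j => f (matEntry i j x)
  map_add' x y := mat_ext fun i j => by simp only [matEntry_matOf, map_add]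
  map_smul' c x := mat_ext fun i j => by simp only [matEntry_matOf, map_smul, RingHom.id_apply]

theorem matEntry_matMap {H : HilbertBimodule.{u, v} B} {K : HilbertBimodule.{u, v'} B}
    (f : H.carrier →ₗ[ℂ] K.carrier) (x : (mat n H).carrier) (i j : Fin n) :
    matEntry i j (matMap f x) = f (matEntry i j x) := rfl

/-- `⨁ M_n(F_i) → M_n(⨁ F_i)`. -/
def directSumMat {κ : Type k} {F : κ → HilbertBimodule.{u, v} B}
    {F' : κ → HilbertBimodule.{u, v} (CStarMatrix (Fin n) (Fin n) B)}
    (g : ∀ i, BimoduleIsometry (F' i) (mat n (F i))) :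
    BimoduleIsometry (HilbertBimodule.directSum F') (mat n (HilbertBimodule.directSum F)) :=
  BimoduleIsometry.extend
    (HilbertBimodule.descPre F' fun i => matMap (HilbertBimodule.incl F i) ∘ₗ (g i).toLinearMap)
    (by
      intro x y
      induction x using HilbertBimodule.directSumPre_induction with
      | h0 => rw [map_zero, PreHilbertBimodule.form_zero_left, PreHilbertBimodule.form_zero_left]
      | ha x y hx hy => rw [map_add, PreHilbertBimodule.form_add_left, hx, hy,
          PreHilbertBimodule.form_add_left]
      | hi l x =>
        induction y using HilbertBimodule.directSumPre_induction with
        | h0 => simp only [map_zero, PreHilbertBimodule.form_zero_right]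
        | ha x y hx hy => simp only [map_add, PreHilbertBimodule.form_add_right, hx, hy]
        | hi l' y =>
          rw [HilbertBimodule.descPre_inclPre, HilbertBimodule.descPre_inclPre]
          by_cases h : l = l'
          · subst h
            rw [HilbertBimodule.form_inclPre, ← (g l).form_map]
            ext i j
            simp only [form_mat, LinearMap.comp_apply, matEntry_matMap,
              HilbertBimodule.form_incl]
          · rw [HilbertBimodule.form_inclPre_of_ne _ h]
            ext i j
            simp only [form_mat, LinearMap.comp_apply, matEntry_matMap,
              HilbertBimodule.form_incl_of_ne F h, Finset.sum_const_zero, CStarMatrix.zero_apply])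
    (by
      intro b x
      induction x using HilbertBimodule.directSumPre_induction with
      | h0 => simp only [map_zero]
      | ha x y hx hy => simp only [map_add, hx, hy]
      | hi l x =>
        rw [directSumPre_left_inclPre, HilbertBimodule.descPre_inclPre,
          HilbertBimodule.descPre_inclPre]
        refine mat_ext fun i j => ?_
        simp only [LinearMap.comp_apply, matEntry_left, matEntry_matMap, (g l).map_left, map_sum,
          HilbertBimodule.left_incl])

theorem matEntry_directSumMat_incl {κ : Type k} {F : κ → HilbertBimodule.{u, v} B}
    {F' : κ → HilbertBimodule.{u, v} (CStarMatrix (Fin n) (Fin n) B)}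
    (g : ∀ i, BimoduleIsometry (F' i) (mat n (F i))) (l : κ) (x : (F' l).carrier) (i j : Fin n) :
    matEntry i j ((directSumMat g).toLinearMap (HilbertBimodule.incl F' l x))
      = HilbertBimodule.incl F l (matEntry i j ((g l).toLinearMap x)) := by
  refine (congrArg (matEntry i j) (BimoduleIsometry.extend_toCompletion _ _ _
    (HilbertBimodule.inclPre F' l x))).trans ?_
  rw [HilbertBimodule.descPre_inclPre]
  rfl

/-! ### The isometry on the reduced free product and the operators it intertwines -/

variable {I : Type k} (M : I → PointedHilbertBimodule.{u, v} B)

/-- The isometry from the summand of a word for the matrix bimodules to the matrices over the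
summand. -/
def wordMat (n : ℕ) : ∀ l : List I,
    BimoduleIsometry (wordModule (fun i => matPointed n (M i)) l) (mat n (wordModule M l))
  | [] => selfMat.{u, v} n B
  | i :: l => tensorMat (complMat n (M i)) (wordMat n l)

theorem matEntry_wordMat_wordCons (i : I) (l : List I) (m : (matPointed n (M i)).compl.carrier)
    (x : (wordModule (fun i => matPointed n (M i)) l).carrier) (a c : Fin n) :
    matEntry a c ((wordMat M n (i :: l)).toLinearMap (wordCons (fun i => matPointed n (M i)) i l m x))
      = ∑ p, wordCons M i l (matEntry a p ((complMat n (M i)).toLinearMap m))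
        (matEntry p c ((wordMat M n l).toLinearMap x)) :=
  matEntry_tensorMat_tmul (complMat n (M i)) (wordMat M n l) m x a c

/-- The isometry from the reduced free product of the matrix bimodules to the matrices over the
reduced free product. -/
def freeMat (n : ℕ) : BimoduleIsometry (freeProduct fun i => matPointed n (M i))
    (mat n (freeProduct M)) :=
  directSumMat fun l : AltWord I => wordMat M n l.1

theorem matEntry_freeMat_wordIncl (l : AltWord I)
    (x : (wordModule (fun i => matPointed n (M i)) l.1).carrier) (a c : Fin n) :
    matEntry a c ((freeMat M n).toLinearMap (wordIncl (fun i => matPointed n (M i)) l x))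
      = wordIncl M l (matEntry a c ((wordMat M n l.1).toLinearMap x)) :=
  matEntry_directSumMat_incl (fun l : AltWord I => wordMat M n l.1) l x a c

theorem matEntry_freeMat_wordConsIncl (i : I) (l : CoWord i)
    (m : (matPointed n (M i)).compl.carrier)
    (x : (wordModule (fun i => matPointed n (M i)) l.1.1).carrier) (a c : Fin n) :
    matEntry a c ((freeMat M n).toLinearMap (wordConsIncl (fun i => matPointed n (M i)) i l m x))
      = ∑ p, wordConsIncl M i l (matEntry a p ((complMat n (M i)).toLinearMap m))
        (matEntry p c ((wordMat M n l.1.1).toLinearMap x)) := by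
  refine (matEntry_freeMat_wordIncl M (AltWord.cons i l.1 l.2) _ a c).trans ?_
  refine (congrArg (wordIncl M (AltWord.cons i l.1 l.2))
    (matEntry_wordMat_wordCons M i l.1.1 m x a c)).trans ?_
  exact map_sum (wordIncl M (AltWord.cons i l.1 l.2)) _ _

/-- The isometry turns `V_i` for the matrix bimodules into the matrix product formed with the scalar
`V_i`, because it does so separately for the component along `ξ_i` and the component in the
complement. -/
theorem matEntry_freeMat_unitaryWord (i : I) (m : (matPointed n (M i)).carrier) (l : CoWord i)
    (x : (wordModule (fun i => matPointed n (M i)) l.1.1).carrier) (a c : Fin n) :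
    matEntry a c ((freeMat M n).toLinearMap (unitaryWord (fun i => matPointed n (M i)) i m l x))
      = ∑ p, unitaryWord M i (matEntry a p m) l
        (matEntry p c ((wordMat M n l.1.1).toLinearMap x)) := by
  simp only [unitaryWord_apply, Finset.sum_add_distrib]
  rw [map_add, map_add, matEntry_freeMat_wordIncl, matEntry_freeMat_wordConsIncl,
    (wordMat M n l.1.1).map_left, matEntry_left, map_sum]
  refine congrArg₂ (· + ·) (Finset.sum_congr rfl fun p _ => ?_)
    (Finset.sum_congr rfl fun p _ => ?_)
  · exact congrArg (fun b => wordIncl M l.1 ((wordModule M l.1.1).left b _))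
      (form_matPointed_vac (M i) m a p)
  · exact congrArg (fun y => wordConsIncl M i l y _) (matEntry_complMat_toCompl (M i) m a p)

theorem unitaryWord_sum {κ : Type*} (i : I) (l : CoWord i) (s : Finset κ) (m : κ → (M i).carrier)
    (x : (wordModule M l.1.1).carrier) :
    unitaryWord M i (∑ p ∈ s, m p) l x = ∑ p ∈ s, unitaryWord M i (m p) l x :=
  map_sum (AddMonoidHom.mk' (fun m => unitaryWord M i m l x) fun m m' => by
    rw [unitaryWord_add]; rfl) m s

theorem matEntry_freeMat_freeVac (a c : Fin n) :
    matEntry a c ((freeMat M n).toLinearMap (freeVac fun i => matPointed n (M i)))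
      = if a = c then freeVac M else 0 := by
  refine (matEntry_freeMat_wordIncl M AltWord.nil
    (nilVec (fun i => matPointed n (M i)) 1) a c).trans ?_
  have h : matEntry a c ((wordMat M n (AltWord.nil : AltWord I).1).toLinearMap
      (nilVec (fun i => matPointed n (M i)) 1))
      = nilVec M ((1 : CStarMatrix (Fin n) (Fin n) B) a c) := rfl
  rw [h]
  split_ifs with hac
  · rw [hac, CStarMatrix.one_apply_eq, freeVac_eq]
  · rw [CStarMatrix.one_apply_ne hac]
    exact map_zero (wordIncl M AltWord.nil)

/-- The isometry preserves the decomposition by words, so it respects any cut to a set of words. -/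
theorem matEntry_freeMat_wordProj (J : Set (AltWord I))
    (x : (freeProduct fun i => matPointed n (M i)).carrier) (a c : Fin n) :
    matEntry a c ((freeMat M n).toLinearMap (wordProj (fun i => matPointed n (M i)) J x))
      = wordProj M J (matEntry a c ((freeMat M n).toLinearMap x)) := by
  have h : matEntry a c ∘L (freeMat M n).toCLM ∘L wordProj (fun i => matPointed n (M i)) J
      = wordProj M J ∘L matEntry a c ∘L (freeMat M n).toCLM := by
    refine freeProduct_ext _ fun l x => ?_
    change matEntry a c ((freeMat M n).toLinearMap (wordProj _ J (wordIncl _ l x)))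
      = wordProj M J (matEntry a c ((freeMat M n).toLinearMap (wordIncl _ l x)))
    rw [matEntry_freeMat_wordIncl]
    by_cases hl : l ∈ J
    · rw [wordProj_wordIncl_of_mem hl, wordProj_wordIncl_of_mem hl, matEntry_freeMat_wordIncl]
    · rw [wordProj_wordIncl_of_notMem hl, wordProj_wordIncl_of_notMem hl, map_zero, map_zero]
  exact DFunLike.congr_fun h x

/-- On vectors `V_i (m ⊗ x)` both sides let the matrix of operators act on `m` and then form the
matrix product with `x`. -/
theorem matEntry_freeMat_freeEmbed (i : I) (T : Fin n → Fin n → (M i).adjointable)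
    (x : (freeProduct fun i => matPointed n (M i)).carrier) (a c : Fin n) :
    matEntry a c ((freeMat M n).toLinearMap
        (freeEmbed (fun i => matPointed n (M i)) i (matAct T) x))
      = ∑ p, freeEmbed M i (T a p) (matEntry p c ((freeMat M n).toLinearMap x)) := by
  have h : matEntry a c ∘L (freeMat M n).toCLM
        ∘L freeEmbed (fun i => matPointed n (M i)) i (matAct T)
      = ∑ p, freeEmbed M i (T a p) ∘L matEntry p c ∘L (freeMat M n).toCLM := by
    refine freeProduct_ext_unitaryWord _ i fun m l x => ?_
    rw [_root_.sum_apply]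
    change matEntry a c ((freeMat M n).toLinearMap (freeEmbed _ i (matAct T)
        (unitaryWord _ i m l x)))
      = ∑ p, freeEmbed M i (T a p) (matEntry p c ((freeMat M n).toLinearMap
        (unitaryWord _ i m l x)))
    rw [freeEmbed_unitaryWord, matEntry_freeMat_unitaryWord]
    simp only [matEntry_freeMat_unitaryWord, map_sum, freeEmbed_unitaryWord]
    rw [Finset.sum_comm]
    refine Finset.sum_congr rfl fun q _ => ?_
    rw [matEntry_matAct]
    exact unitaryWord_sum M i l _ _ _
  have h' := DFunLike.congr_fun h x
  rw [_root_.sum_apply] at h'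
  exact h'

end MatrixFreeProduct

section MatrixIndependence

/-! ### Independence of matrix algebras -/

variable {B : Type u} [CStarAlgebra B] [PartialOrder B] [StarOrderedRing B] {I : Type k}
  {A : Type uA} [Ring A] [Algebra ℂ A] {P : BProbSpace B A} {S : I → BimoduleSubalgebra P}
  {M : I → PointedHilbertBimodule.{u, w} B} {n : ℕ}
  (γ : ∀ i, (S i).toNonUnitalSubalgebra →ₙₐ[ℂ] (M i).adjointable)

/-- The entries of a matrix over a subalgebra. -/
def subEntry {T : BimoduleSubalgebra P} (x : (T.matrix n).toNonUnitalSubalgebra) (i j : Fin n) :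
    T.toNonUnitalSubalgebra := ⟨(x : Matrix (Fin n) (Fin n) A) i j, x.2 i j⟩

theorem subEntry_mul {T : BimoduleSubalgebra P} (x y : (T.matrix n).toNonUnitalSubalgebra)
    (i j : Fin n) : subEntry (x * y) i j = ∑ p, subEntry x i p * subEntry y p j := by
  refine Subtype.ext ?_
  rw [AddSubmonoidClass.coe_finsetSum]
  exact Matrix.mul_apply

/-- The homomorphism `γ ⊗ I_n`. -/
def matRep (i : I) :
    ((S i).matrix n).toNonUnitalSubalgebra →ₙₐ[ℂ] (matPointed n (M i)).adjointable where
  toFun x := matAct fun a c => γ i (subEntry x a c)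
  map_smul' c x := adjointable_mat_ext fun y a d => by
    change _ = matEntry a d (c • (matAct fun a c => γ i (subEntry x a c)).1 y)
    rw [map_smul, matEntry_matAct, matEntry_matAct, Finset.smul_sum]
    refine Finset.sum_congr rfl fun p _ => ?_
    have h : subEntry (c • x) a p = c • subEntry x a p := rfl
    rw [h, map_smul]
    rfl
  map_zero' := adjointable_mat_ext fun y a d => by
    change _ = matEntry a d 0
    rw [map_zero, matEntry_matAct]
    refine Finset.sum_eq_zero fun p _ => ?_
    have h : subEntry (0 : ((S i).matrix n).toNonUnitalSubalgebra) a p = 0 := rfl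
    rw [h, map_zero]
    rfl
  map_add' x x' := adjointable_mat_ext fun y a d => by
    change _ = matEntry a d ((matAct fun a c => γ i (subEntry x a c)).1 y
      + (matAct fun a c => γ i (subEntry x' a c)).1 y)
    rw [map_add, matEntry_matAct, matEntry_matAct, matEntry_matAct, ← Finset.sum_add_distrib]
    refine Finset.sum_congr rfl fun p _ => ?_
    have h : subEntry (x + x') a p = subEntry x a p + subEntry x' a p := rfl
    rw [h, map_add]
    rfl
  map_mul' x x' := by
    rw [matAct_mul]
    simp only [subEntry_mul, map_sum, map_mul]

/-- The entries of `b x` and `x b` are sums of products of an entry of `b` with an entry of `x`, so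
the claim reduces to bilinearity of `γ_i`. -/
theorem isBimoduleHom_matRep (hγ : IsBimoduleHom γ) :
    IsBimoduleHom (S := fun i => (S i).matrix n) (M := fun i => matPointed n (M i)) (matRep γ) := by
  intro i b x
  constructor
  · have h : ∀ a c, subEntry (((S i).matrix n).lmul b x) a c
        = ∑ p, (S i).lmul (b a p) (subEntry x p c) := fun a c => by
      refine Subtype.ext ?_
      rw [AddSubmonoidClass.coe_finsetSum]
      exact Matrix.mul_apply
    change (matAct fun a c => γ i (subEntry (((S i).matrix n).lmul b x) a c))
      = (mat n (M i).toHilbertBimodule).leftOp b * matAct fun a c => γ i (subEntry x a c)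
    rw [leftOp_mat, matAct_mul]
    simp only [h, map_sum, (hγ i _ _).1]
  · have h : ∀ a c, subEntry (((S i).matrix n).rmul x b) a c
        = ∑ p, (S i).rmul (subEntry x a p) (b p c) := fun a c => by
      refine Subtype.ext ?_
      rw [AddSubmonoidClass.coe_finsetSum]
      exact Matrix.mul_apply
    change (matAct fun a c => γ i (subEntry (((S i).matrix n).rmul x b) a c))
      = (matAct fun a c => γ i (subEntry x a c)) * (mat n (M i).toHilbertBimodule).leftOp b
    rw [leftOp_mat, matAct_mul]
    simp only [h, map_sum, (hγ i _ _).2]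

variable (J : I → Set (AltWord I))

/-- The entries of the vector `a₁ ⋯ a_m ξ` for matrices `a_k`. -/
def wordEntry (l : List (Σ i, ((S i).matrix n).toNonUnitalSubalgebra)) (a c : Fin n) :
    (freeProduct M).carrier :=
  matEntry a c ((freeMat M n).toLinearMap
    (wordOp (S := fun i => (S i).matrix n) (M := fun i => matPointed n (M i)) J (matRep γ) l
      (freeVac fun i => matPointed n (M i))))

theorem wordEntry_nil (a c : Fin n) :
    wordEntry (n := n) γ J [] a c = if a = c then freeVac M else 0 :=
  matEntry_freeMat_freeVac M a c

/-- The vectors `a₁ ⋯ a_m ξ` follow the rule of matrix multiplication, the scalar letters being the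
operators of the original free product. -/
theorem wordEntry_cons (q : Σ i, ((S i).matrix n).toNonUnitalSubalgebra)
    (l : List (Σ i, ((S i).matrix n).toNonUnitalSubalgebra)) (a c : Fin n) :
    wordEntry γ J (q :: l) a c
      = ∑ p, letterOp J γ ⟨q.1, subEntry q.2 a p⟩ (wordEntry γ J l p c) := by
  rw [wordEntry, wordOp_cons, mul_apply_eq_comp, letterOp, mul_apply_eq_comp,
    matEntry_freeMat_wordProj]
  refine (congrArg (wordProj M (J q.1)) (matEntry_freeMat_freeEmbed M q.1
    (fun a c => γ q.1 (subEntry q.2 a c)) _ a c)).trans ?_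
  rw [map_sum]
  rfl

/-- The prefix `l'` of scalar letters makes the induction work: expanding the first matrix as a sum
over its entries turns each entry into a further scalar letter, until only scalar words are left and
the hypothesis applies. -/
theorem E_wordProd_mul_entry (h : ∀ l, P.E (wordProd S l) = moment J γ l)
    (l : List (Σ i, ((S i).matrix n).toNonUnitalSubalgebra)) :
    ∀ (l' : List (Σ i, (S i).toNonUnitalSubalgebra)) (a c : Fin n),
    P.E (wordProd S l' * wordProd (fun i => (S i).matrix n) l a c)
      = (freeProduct M).form (freeVac M) (wordOp J γ l' (wordEntry γ J l a c)) := by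
  induction l with
  | nil =>
    intro l' a c
    rw [wordEntry_nil, wordProd_nil, Matrix.one_apply]
    split_ifs with hac
    · rw [mul_one, h]; rfl
    · rw [mul_zero, map_zero, map_zero, PreHilbertBimodule.form_zero_right]
  | cons q l ih =>
    intro l' a c
    rw [wordEntry_cons, wordProd_cons, Matrix.mul_apply, Finset.mul_sum, map_sum, map_sum,
      PreHilbertBimodule.form_sum_right]
    refine Finset.sum_congr rfl fun p _ => ?_
    -- The entry `(a, p)` of the first matrix moves to the end of the prefix.
    have h1 := ih (l' ++ [⟨q.1, subEntry q.2 a p⟩]) p c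
    rw [wordProd_append, wordProd_cons, wordProd_nil, mul_one, wordOp_append, wordOp_cons,
      wordOp_nil, mul_one, mul_assoc] at h1
    exact h1

theorem JIndependent.matrix (h : JIndependent.{u, w} P J S) (n : ℕ) :
    JIndependent.{u, w} (P.matrix n) J fun i => (S i).matrix n := by
  obtain ⟨M, γ, hγ, h⟩ := (jIndependent_iff J).mp h
  refine (jIndependent_iff J).mpr ⟨fun i => matPointed n (M i), matRep γ,
    isBimoduleHom_matRep γ hγ, fun l => ?_⟩
  ext a c
  have h1 := E_wordProd_mul_entry γ J h l [] a c
  rw [wordProd_nil, one_mul] at h1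
  refine (show _ = _ from h1).trans ?_
  -- The matrix moment is computed in `M_n(M)`. There the vacuum is diagonal, so in the sum over
  -- rows only row `a` contributes to the entry `(a, c)`.
  rw [moment, ← (freeMat M n).form_map, form_mat, Finset.sum_eq_single a]
  · rw [matEntry_freeMat_freeVac, if_pos rfl]
    rfl
  · intro p _ hp
    rw [matEntry_freeMat_freeVac, if_neg hp, PreHilbertBimodule.form_zero_left]
  · simp

end MatrixIndependence

end JIndep

end

/-- The equivalences allow bimodules in the universe `max w uA`, large enough to contain the GNS
bimodule built on `A`; the matrix statement keeps the universe of the given bimodules, since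
`M_n(M_i)` is a finite product of copies. -/
theorem mainTheorem12 {B : Type u} [CStarAlgebra B] [PartialOrder B] [StarOrderedRing B] :
    (∀ (I : Type k) (J : I → Set (JIndep.AltWord I)), JIndep.Compatible J →
      ∀ (A : Type uA) [Ring A] [Algebra ℂ A] (P : JIndep.BProbSpace B A)
        (S : I → JIndep.BimoduleSubalgebra P), JIndep.JIndependent.{u, w} P J S →
        ∀ n : ℕ, JIndep.JIndependent.{u, w} (P.matrix n) J fun i => (S i).matrix n) ∧
    (∀ I : Type k, JIndep.Compatible (JIndep.freeFamily I)) ∧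
    (∀ I : Type k, JIndep.Compatible (JIndep.booleanFamily I)) ∧
    JIndep.Compatible JIndep.monotoneFamily ∧
    (∀ (A : Type uA) [CStarAlgebra A] (P : JIndep.BProbSpace B A),
      (∀ b, P.incl (star b) = star (P.incl b)) → (∀ a, 0 ≤ P.E (a * star a)) →
      (∀ (I : Type k) (S : I → JIndep.BimoduleSubalgebra P), (∀ i, 1 ∈ (S i).carrier) →
        (JIndep.JIndependent.{u, max w uA} P (JIndep.freeFamily I) S ↔
          JIndep.FreelyIndependent P S)) ∧
      (∀ (I : Type k) (S : I → JIndep.BimoduleSubalgebra P),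
        (JIndep.JIndependent.{u, max w uA} P (JIndep.booleanFamily I) S ↔
          JIndep.BooleanIndependent P S)) ∧
      (∀ S : Fin 2 → JIndep.BimoduleSubalgebra P,
        (JIndep.JIndependent.{u, max w uA} P JIndep.monotoneFamily S ↔
          JIndep.MonotoneIndependent P S))) := by
  refine ⟨fun I J _ A _ _ P S h n => JIndep.JIndependent.matrix J h n,
    JIndep.compatible_freeFamily, JIndep.compatible_booleanFamily,
    JIndep.compatible_monotoneFamily, fun A _ P hstar hpos =>
      ⟨fun I S h1 => JIndep.jIndependent_freeFamily_iff.{u, w, k, uA} hstar hpos S h1,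
        fun I S => JIndep.jIndependent_booleanFamily_iff.{u, w, k, uA} hstar hpos S,
        fun S => JIndep.jIndependent_monotoneFamily_iff.{u, w, uA} hstar hpos S⟩⟩
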